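/- **Calculus (AlgST).** Fix a set of protocol declarations $\mathsf{protocol}\ \rho\,\bar\alpha=\{C_i\,\bar T_i\}_{i\in I}$. Each declaration has a finite non-empty $I$, distinct constructors $C_i$, and argument types satisfying $\bar\alpha:\mathsf P\vdash \bar T_i\Leftarrow\mathsf P$. Phrases are identified up to renaming of bound variables, and bound names (in terms, processes and labels) are always chosen distinct from the names of their surroundings. *Types.* The kinds are $\mathsf S\le\mathsf T\le\mathsf P$ (session types, types, protocols). The types are $T ::= \mathsf{Unit}\mid T\to T\mid T\otimes T\mid\forall\alpha{:}\kappa.T\mid\alpha\mid{?}T.T\mid{!}T.T\mid\mathsf{End}_?\mid\mathsf{End}_!\mid\mathsf{Dual}\,T\mid -T\mid\rho\,\bar T$. Kinding is bidirectional, and $\Delta\vdash T\Leftarrow\kappa$ means that $T$ synthesizes a subkind of $\kappa$. $\mathsf{Unit},\to,\otimes,\forall$ have kind $\mathsf T$, with components checked at $\mathsf T$. ${?}T.S$ and ${!}T.S$ have kind $\mathsf S$, with $T\Leftarrow\mathsf P$ and $S\Leftarrow\mathsf S$. $\mathsf{End}_?$ and $\mathsf{End}_!$ have kind $\mathsf S$;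 $\mathsf{Dual}\,S$ has kind $\mathsf S$ if $S\Leftarrow\mathsf S$; $-T$ and $\rho\,\bar T$ have kind $\mathsf P$, with arguments checked at $\mathsf P$ and $\rho$ fully applied. Conversion $\Delta\vdash T\equiv U:\kappa$ is the least congruence on well-kinded types, closed under subkinding, with $\mathsf{Dual}\,\mathsf{End}_?\equiv\mathsf{End}_!$, $\mathsf{Dual}\,\mathsf{End}_!\equiv\mathsf{End}_?$, $\mathsf{Dual}({?}T.S)\equiv{!}T.\mathsf{Dual}\,S$, $\mathsf{Dual}({!}T.S)\equiv{?}T.\mathsf{Dual}\,S$, $\mathsf{Dual}(\mathsf{Dual}\,S)\equiv S$, ${?}(-T).S\equiv{!}T.S$, ${!}(-T).S\equiv{?}T.S$, $-(-T)\equiv T$. Put $+(-U)=-(U)$ and $-(-U)=+(U)$; otherwise $+(T)=T$ and $-(T)=-T$. Put $\S(-U).S={?}U.S$; otherwise $\S(T).S={!}T.S$. For sequences, $\S(\pm\bar T).S$ iterates this. The normal form $N^+(T)$ of $T$, and $N^-(S)$ of $\mathsf{Dual}\,S$, are given by $N^{\pm}({?}T.S)=\S(\mp(N^+T)).N^{\pm}S$,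 $N^{\pm}({!}T.S)=\S(\pm(N^+T)).N^{\pm}S$, $N^{\pm}(\mathsf{Dual}\,S)=N^{\mp}S$, $N^+(-T)=-(N^+T)$, $N^-(\alpha)=\mathsf{Dual}\,\alpha$, $N^-$ exchanging $\mathsf{End}_?$ and $\mathsf{End}_!$, and $N^+$ homomorphic elsewhere. *Expressions.* The constants $c$ and their types are $*:\mathsf{Unit}$; $\mathsf{fork}:(\mathsf{Unit}\to\mathsf{Unit})\to\mathsf{Unit}$; $\mathsf{new}:\forall\alpha{:}\mathsf S.\alpha\otimes\mathsf{Dual}\,\alpha$; $\mathsf{receive}:\forall\alpha{:}\mathsf T.\forall\beta{:}\mathsf S.{?}\alpha.\beta\to\alpha\otimes\beta$; $\mathsf{send}:\forall\alpha{:}\mathsf T.\forall\beta{:}\mathsf S.\alpha\to{!}\alpha.\beta\to\beta$; $\mathsf{wait}:\mathsf{End}_?\to\mathsf{Unit}$; $\mathsf{terminate}:\mathsf{End}_!\to\mathsf{Unit}$; $\mathsf{select}\,C_k:N^+(\forall\bar\alpha{:}\bar{\mathsf P}.\forall\beta{:}\mathsf S.{!}(\rho\,\bar\alpha).\beta\to\S(+\bar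 T_k).\beta)$. The expressions are $e::=c\mid x\mid\lambda x{:}T.e\mid\mathsf{rec}\,x{:}T.v\mid\Lambda\alpha{:}\kappa.v\mid(e,e)\mid e\,e\mid e[T]\mid\mathsf{let}\,{*}=e\,\mathsf{in}\,e\mid\mathsf{let}\,(x,y)=e\,\mathsf{in}\,e\mid\mathsf{match}\,e\,\mathsf{with}\,\{C_ix_i\to e_i\}_{i\in I}$. The values $v$ are constants, variables, $\lambda$, $\mathsf{rec}$, $\Lambda$, pairs of values, $\mathsf{receive}[T]$, $\mathsf{receive}[T][U]$, $\mathsf{send}[T]$, $\mathsf{send}[T][U]$, $\mathsf{send}[T][U]\,v$ and $\mathsf{select}\,C\,[\bar T]$. *Typing.* Contexts $\Gamma$ consist of linear entries $x:T$ and unrestricted entries $x:^\star T$ with pairwise distinct names, and are taken up to exchange; a comma is disjoint union. $\Delta;\Gamma_1\vdash e\Rightarrow T\dashv\Gamma_2$ (synthesis; $\Gamma_2$ is the unused part of $\Gamma_1$) is given by the following rules, with $\Delta$ left implicit. $\Gamma_1\vdash e\Leftarrow T\dashv\Gamma_2$ (checking) means that $e$ synthesizes exactly $T$, up to $\alpha$-equivalence.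 - $\Gamma\vdash c\Rightarrow T\dashv\Gamma$ if $T$ is the type of $c$. If $T\Leftarrow\mathsf T$, then $\Gamma,x{:}T\vdash x\Rightarrow T\dashv\Gamma$ and $\Gamma,x{:^\star}T\vdash x\Rightarrow T\dashv\Gamma,x{:^\star}T$. - $\Gamma_1\vdash\lambda x{:}T.e\Rightarrow V\to U\dashv\Gamma_2$ if $T\Leftarrow\mathsf T$, $V=N^+T$, $\Gamma_1,x{:}V\vdash e\Rightarrow U\dashv\Gamma_2$, $x\notin\Gamma_2$. - $\Gamma\vdash\mathsf{rec}\,x{:}T\to U.v\Rightarrow V\dashv\Gamma$ if $T\to U\Leftarrow\mathsf T$, $V=N^+(T\to U)$, $\Gamma,x{:^\star}V\vdash v\Leftarrow V\dashv\Gamma,x{:^\star}V$. - $\Gamma_1\vdash e_1e_2\Rightarrow U\dashv\Gamma_3$ if $\Gamma_1\vdash e_1\Rightarrow T\to U\dashv\Gamma_2$ and $\Gamma_2\vdash e_2\Leftarrow T\dashv\Gamma_3$; $\Gamma_1\vdash(e_1,e_2)\Rightarrow T\otimes U\dashv\Gamma_3$ if $\Gamma_1\vdash e_1\Rightarrow T\dashv\Gamma_2$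 and $\Gamma_2\vdash e_2\Rightarrow U\dashv\Gamma_3$. - $\Gamma_1\vdash\Lambda\alpha{:}\kappa.v\Rightarrow\forall\alpha{:}\kappa.T\dashv\Gamma_2$ if $\Delta,\alpha{:}\kappa;\Gamma_1\vdash v\Rightarrow T\dashv\Gamma_2$; $\Gamma_1\vdash e[T]\Rightarrow N^+(U[T/\alpha])\dashv\Gamma_2$ if $\Gamma_1\vdash e\Rightarrow\forall\alpha{:}\kappa.U\dashv\Gamma_2$ and $T\Leftarrow\kappa$. - $\Gamma_1\vdash\mathsf{let}\,{*}=e_1\,\mathsf{in}\,e_2\Rightarrow T\dashv\Gamma_3$ if $\Gamma_1\vdash e_1\Leftarrow\mathsf{Unit}\dashv\Gamma_2$ and $\Gamma_2\vdash e_2\Rightarrow T\dashv\Gamma_3$; $\Gamma_1\vdash\mathsf{let}\,(x,y)=e_1\,\mathsf{in}\,e_2\Rightarrow V\dashv\Gamma_3$ if $\Gamma_1\vdash e_1\Rightarrow T\otimes U\dashv\Gamma_2$, $\Gamma_2,x{:}N^+T,y{:}N^+U\vdash e_2\Rightarrow V\dashv\Gamma_3$, $x,y\notin\Gamma_3$.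 - $\Gamma_1\vdash\mathsf{match}\,e\,\mathsf{with}\,\{C_ix_i\to e_i\}_{i\in I}\Rightarrow V\dashv\Gamma_3$ if $\mathsf{protocol}\ \rho\,\bar\alpha=\{C_i\,\bar T_i\}_{i\in I}$, $\Gamma_1\vdash e\Rightarrow{?}(\rho\,\bar U).S\dashv\Gamma_2$ and, for all $i\in I$, $\Gamma_2,x_i{:}N^+(\S(-\bar T_i[\bar U/\bar\alpha]).S)\vdash e_i\Rightarrow V\dashv\Gamma_3$ and $x_i\notin\Gamma_3$. Processes are $p::=\langle e\rangle\mid p|p\mid(\nu xy)p$. The judgement $\Gamma\vdash p$ is given by: $\Gamma\vdash\langle e\rangle$ if $\cdot;\Gamma\vdash e\Leftarrow\mathsf{Unit}\dashv\cdot$; $\Gamma_1,\Gamma_2\vdash p_1|p_2$ if $\Gamma_i\vdash p_i$; $\Gamma\vdash(\nu xy)p$ if $\cdot\vdash T\Leftarrow\mathsf S$ and $\Gamma,x{:}N^+T,y{:}N^-T\vdash p$ for some $T$. *Transitions.* The labels are $\sigma::=x?v\mid x!v\mid x?C\mid x!C\mid\mathsf{wait}\,x\mid\mathsf{term}\,x$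 (sessions), $\lambda::=\sigma\mid\beta\mid\mathsf{fork}\,v\mid\mathsf{new}\,xy{:}T$ (expressions), $\pi::=\sigma\mid\tau\mid(\nu ab)x!c\mid\pi|\pi$ (processes). Expression transitions $e\xrightarrow{\lambda}e'$ are the left-to-right call-by-value closure (evaluation contexts $E::=[\,]\mid E\,e\mid v\,E\mid E[T]\mid(E,e)\mid(v,E)\mid\mathsf{match}\,E\,\mathsf{with}\,\{\dots\}\mid\mathsf{let}\,(x,y)=E\,\mathsf{in}\,e\mid\mathsf{let}\,{*}=E\,\mathsf{in}\,e$) of: $(\lambda x{:}T.e)v\xrightarrow{\beta}e[v/x]$; $(\Lambda\alpha{:}\kappa.v)[T]\xrightarrow{\beta}v[T/\alpha]$; $\mathsf{let}\,(x,y)=(u,v)\,\mathsf{in}\,e\xrightarrow{\beta}e[u/x][v/y]$; $\mathsf{let}\,{*}=*\,\mathsf{in}\,e\xrightarrow{\beta}e$; $(\mathsf{rec}\,x{:}T.v)u\xrightarrow{\beta}(v[\mathsf{rec}\,x{:}T.v/x])u$; $\mathsf{fork}\,v\xrightarrow{\mathsf{fork}\,v}*$; $\mathsf{new}[T]\xrightarrow{\mathsf{new}\,xy:T}(x,y)$;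 $\mathsf{receive}[T][U]\,x\xrightarrow{x?v}(v,x)$; $\mathsf{send}[T][U]\,v\,x\xrightarrow{x!v}x$; $\mathsf{match}\,x\,\mathsf{with}\,\{C_iy_i\to e_i\}_{i\in I}\xrightarrow{x?C_k}e_k[x/y_k]$ ($k\in I$); $\mathsf{select}\,C[\bar T]\,x\xrightarrow{x!C}x$; $\mathsf{wait}\,x\xrightarrow{\mathsf{wait}\,x}*$; $\mathsf{terminate}\,x\xrightarrow{\mathsf{term}\,x}*$. Process transitions $p\xrightarrow{\pi}p'$ are generated by: - $\langle e\rangle\xrightarrow{\sigma}\langle e'\rangle$ if $e\xrightarrow{\sigma}e'$; $\langle e\rangle\xrightarrow{\tau}\langle e'\rangle$ if $e\xrightarrow{\beta}e'$; $\langle e\rangle\xrightarrow{\tau}\langle e'\rangle|\langle v\,*\rangle$ if $e\xrightarrow{\mathsf{fork}\,v}e'$; $\langle e\rangle\xrightarrow{\tau}(\nu xy)\langle e'\rangle$ if $e\xrightarrow{\mathsf{new}\,xy:T}e'$. - If $p_1\xrightarrow{\pi_1}q_1$ and $p_2\xrightarrow{\pi_2}q_2$, then $p_1|p_2$ goes to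 $q_1|q_2$ with label $\pi_1|\pi_2$ and also with label $\pi_2|\pi_1$. If $p\xrightarrow{\pi}p'$, then $p|q\xrightarrow{\pi}p'|q$ and $q|p\xrightarrow{\pi}q|p'$, and $(\nu xy)p\xrightarrow{\pi}(\nu xy)p'$ provided $x,y$ do not occur free in $\pi$. - If $p\xrightarrow{x?v\,|\,y!v}p'$ or $p\xrightarrow{x?C\,|\,y!C}p'$, then $(\nu xy)p\xrightarrow{\tau}(\nu xy)p'$; if $p\xrightarrow{\mathsf{wait}\,x\,|\,\mathsf{term}\,y}p'$, then $(\nu xy)p\xrightarrow{\tau}p'$. - For $c\in\{a,b\}$: if $p\xrightarrow{x!c}p'$ and $x\ne a,b$, then $(\nu ab)p\xrightarrow{(\nu ab)x!c}p'$; if $p\xrightarrow{x?c\,|\,(\nu ab)y!c}p'$, then $(\nu xy)p\xrightarrow{\tau}(\nu xy)(\nu ab)p'$. Context transitions, written $\Gamma\xrightarrow{\lambda}\Gamma'$ and $\Gamma\xrightarrow{\pi}\Gamma'$, are generated by: - if $\cdot;\Gamma\vdash v\Leftarrow T\dashv\cdot$, then $x{:}{?}T.S\xrightarrow{x?v}\Gamma,x{:}S$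 and $\Gamma,x{:}{!}T.S\xrightarrow{x!v}x{:}S$; - for $\mathsf{protocol}\ \rho\,\bar\alpha=\{C_i\,\bar T_i\}_{i\in I}$ and $k\in I$, $x{:}{?}(\rho\,\bar U).S\xrightarrow{x?C_k}x{:}N^+(\S(-\bar T_k[\bar U/\bar\alpha]).S)$ and $x{:}{!}(\rho\,\bar U).S\xrightarrow{x!C_k}x{:}N^+(\S(+\bar T_k[\bar U/\bar\alpha]).S)$; - $x{:}\mathsf{End}_?\xrightarrow{\mathsf{wait}\,x}\cdot$, $\ x{:}\mathsf{End}_!\xrightarrow{\mathsf{term}\,x}\cdot$, $\ \cdot\xrightarrow{\beta}\cdot$, $\ \cdot\xrightarrow{\tau}\cdot$; - if $\cdot;\Gamma\vdash v\Leftarrow\mathsf{Unit}\to\mathsf{Unit}\dashv\cdot$, then $\Gamma\xrightarrow{\mathsf{fork}\,v}\cdot$; and $\cdot\xrightarrow{\mathsf{new}\,xy:T}x{:}N^+T,y{:}N^-T$; - $x{:}{!}T.S\xrightarrow{(\nu ab)x!a}b{:}N^-T,x{:}S$ and $x{:}{!}T.S\xrightarrow{(\nu ab)x!b}a{:}N^-T,x{:}S$;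 - if $\Gamma_1\xrightarrow{\pi_1}\Gamma_3$ and $\Gamma_2\xrightarrow{\pi_2}\Gamma_4$, then $\Gamma_1,\Gamma_2\xrightarrow{\pi_1|\pi_2}\Gamma_3,\Gamma_4$. Write $\Delta\vdash\Gamma$ if every type $T$ in $\Gamma$ satisfies $\Delta\vdash T\Leftarrow\mathsf T$ and is in normal form, $N^+T=T$. **Theorem (Preservation).** 1. If $e_1\xrightarrow{\lambda}e_2$, $\ \Delta;\Gamma_1,\Gamma_2,\Gamma_3\vdash e_1\Rightarrow T\dashv\Gamma_3$, $\ \Gamma_2\xrightarrow{\lambda}\Gamma_2'$, $\ \Delta\vdash\Gamma_1,\Gamma_2,\Gamma_3$, and the names of $\Gamma_1,\Gamma_2',\Gamma_3$ are distinct, then there is $T'$ with $\Delta;\Gamma_1,\Gamma_2',\Gamma_3\vdash e_2\Rightarrow T'\dashv\Gamma_3$ and $\Delta\vdash T'\equiv T:\mathsf T$. 2. If $e_1\xrightarrow{\lambda}e_2$, $\ \Delta;\Gamma_1,\Gamma_2,\Gamma_3\vdash e_1\Leftarrow T\dashv\Gamma_3$, $\ \Gamma_2\xrightarrow{\lambda}\Gamma_2'$,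 $\ \Delta\vdash\Gamma_1,\Gamma_2,\Gamma_3$, and the names of $\Gamma_1,\Gamma_2',\Gamma_3$ are distinct, then $\Delta;\Gamma_1,\Gamma_2',\Gamma_3\vdash e_2\Leftarrow T\dashv\Gamma_3$. 3. If $p_1\xrightarrow{\pi}p_2$, $\ \Gamma_1,\Gamma_2\vdash p_1$, $\ \Gamma_2\xrightarrow{\pi}\Gamma_2'$, $\ \cdot\vdash\Gamma_1,\Gamma_2$, and the names of $\Gamma_1,\Gamma_2'$ are distinct, then $\Gamma_1,\Gamma_2'\vdash p_2$. -/

import Mathlib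

/-!
AlgST: a linear System F with algebraic protocols, in which protocol declarations are an implicit
parameter `Sg` of all judgements.

Binding is represented so that alpha-equivalent phrases are equal:
* type variables are de Bruijn indices;
* term variables are locally nameless: a free variable (in particular a channel end) is a name, a
  bound one is an index. A rule that goes under a binder opens the body with a name that is fresh
  for the body.
-/

namespace AlgST

/-- Names of term variables, protocols and constructors. -/
abbrev Name := ℕ

/-! ### Kinds and types -/

/-- Session types `S`, types `T`, protocol types `P`. -/
inductive Kind where
  | S
  | T
  | P

def Kind.rank : Kind → ℕ
  | .S => 0
  | .T => 1
  | .P => 2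

/-- Subkinding `S ≤ T ≤ P`. -/
def Kind.Sub (κ κ' : Kind) : Prop := κ.rank ≤ κ'.rank

inductive Ty where
  | unit
  | arr (T U : Ty)
  | pair (T U : Ty)
  | all (κ : Kind) (T : Ty)
  | var (i : ℕ)
  /-- `?T.S` -/
  | inn (T S : Ty)
  /-- `!T.S` -/
  | out (T S : Ty)
  /-- `End?` -/
  | endW
  /-- `End!` -/
  | endT
  | dual (T : Ty)
  /-- `-T` -/
  | neg (T : Ty)
  /-- A protocol name applied to a vector of arguments. -/
  | proto (ρ : Name) (n : ℕ) (U : Fin n → Ty)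

namespace Ty

/-- Go under one binder with a renaming. -/
def upr (ξ : ℕ → ℕ) : ℕ → ℕ
  | 0 => 0
  | i + 1 => ξ i + 1

def rename : Ty → (ℕ → ℕ) → Ty
  | unit, _ => unit
  | arr T U, ξ => arr (T.rename ξ) (U.rename ξ)
  | pair T U, ξ => pair (T.rename ξ) (U.rename ξ)
  | all κ T, ξ => all κ (T.rename (upr ξ))
  | var i, ξ => var (ξ i)
  | inn T S, ξ => inn (T.rename ξ) (S.rename ξ)
  | out T S, ξ => out (T.rename ξ) (S.rename ξ)
  | endW, _ => endW
  | endT, _ => endT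
  | dual T, ξ => dual (T.rename ξ)
  | neg T, ξ => neg (T.rename ξ)
  | proto ρ n U, ξ => proto ρ n (fun i => (U i).rename ξ)

/-- Weakening by one type variable. -/
def shift (T : Ty) : Ty := T.rename Nat.succ

/-- Go under one binder with a substitution. -/
def ups (σ : ℕ → Ty) : ℕ → Ty
  | 0 => var 0
  | i + 1 => (σ i).shift

/-- Simultaneous (capture-avoiding) substitution. -/
def subst : Ty → (ℕ → Ty) → Ty
  | unit, _ => unit
  | arr T U, σ => arr (T.subst σ) (U.subst σ)
  | pair T U, σ => pair (T.subst σ) (U.subst σ)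
  | all κ T, σ => all κ (T.subst (ups σ))
  | var i, σ => σ i
  | inn T S, σ => inn (T.subst σ) (S.subst σ)
  | out T S, σ => out (T.subst σ) (S.subst σ)
  | endW, _ => endW
  | endT, _ => endT
  | dual T, σ => dual (T.subst σ)
  | neg T, σ => neg (T.subst σ)
  | proto ρ n U, σ => proto ρ n (fun i => (U i).subst σ)

/-- The substitution of `U` for the type variable bound last. -/
def single (U : Ty) : ℕ → Ty
  | 0 => U
  | i + 1 => var i

/-- `T[U/α]`, for the type variable `α` bound last. -/
def inst (T U : Ty) : Ty := T.subst (single U)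

/-- The substitution of a vector of types for the parameters `0, …, n - 1` of a protocol. -/
def params {n : ℕ} (U : Fin n → Ty) : ℕ → Ty :=
  fun j => if h : j < n then U ⟨j, h⟩ else var (j - n)

end Ty

/-! ### Protocol declarations -/

/-- `protocol ρ α₀ … αₙ₋₁ = { C₀ T₀₀ T₀₁ … | C₁ T₁₀ … | … }`; in the argument types, index `j`
stands for the parameter `αⱼ`. -/
structure ProtoDecl where
  arity : ℕ
  numCons : ℕ
  con : Fin numCons → Name
  args : Fin numCons → List Ty

/-- A set of protocol declarations. -/
abbrev Sig := Name → Option ProtoDecl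

/-! ### Type formation -/

/-- The two modes of the bidirectional judgements. -/
inductive Mode where
  | synth
  | check

/-- `Kinding Sg .synth Δ T κ` is `Δ ⊢ T ⇒ κ`, and `Kinding Sg .check Δ T κ` is `Δ ⊢ T ⇐ κ`. -/
inductive Kinding (Sg : Sig) : Mode → List Kind → Ty → Kind → Prop
  | unit {Δ} : Kinding Sg .synth Δ .unit .T
  | arr {Δ T U} : Kinding Sg .check Δ T .T → Kinding Sg .check Δ U .T →
      Kinding Sg .synth Δ (.arr T U) .T
  | pair {Δ T U} : Kinding Sg .check Δ T .T → Kinding Sg .check Δ U .T →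
      Kinding Sg .synth Δ (.pair T U) .T
  | all {Δ κ T} : Kinding Sg .check (κ :: Δ) T .T → Kinding Sg .synth Δ (.all κ T) .T
  | var {Δ : List Kind} {i κ} : Δ[i]? = some κ → Kinding Sg .synth Δ (.var i) κ
  | inn {Δ T S} : Kinding Sg .check Δ T .P → Kinding Sg .check Δ S .S →
      Kinding Sg .synth Δ (.inn T S) .S
  | out {Δ T S} : Kinding Sg .check Δ T .P → Kinding Sg .check Δ S .S →
      Kinding Sg .synth Δ (.out T S) .S
  | endW {Δ} : Kinding Sg .synth Δ .endW .S
  | endT {Δ} : Kinding Sg .synth Δ .endT .S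
  | dual {Δ T} : Kinding Sg .check Δ T .S → Kinding Sg .synth Δ (.dual T) .S
  | neg {Δ T} : Kinding Sg .check Δ T .P → Kinding Sg .synth Δ (.neg T) .P
  | proto {Δ ρ d} {U : Fin d.arity → Ty} : Sg ρ = some d →
      (∀ i, Kinding Sg .check Δ (U i) .P) → Kinding Sg .synth Δ (.proto ρ d.arity U) .P
  | sub {Δ T κ κ'} : Kinding Sg .synth Δ T κ → κ.Sub κ' → Kinding Sg .check Δ T κ'

/-- Well-formed declarations: every protocol has at least one constructor, its constructors have
distinct names, and the constructor arguments are protocol types over the parameters. -/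
def Sig.WF (Sg : Sig) : Prop :=
  ∀ ρ d, Sg ρ = some d →
    0 < d.numCons ∧ Function.Injective d.con ∧
      ∀ k, ∀ T ∈ d.args k, Kinding Sg .check (List.replicate d.arity .P) T .P

/-! ### Type conversion -/

/-- `Δ ⊢ T ≡ U : κ` -/
inductive TyConv (Sg : Sig) : List Kind → Ty → Ty → Kind → Prop
  | refl {Δ T κ} : Kinding Sg .check Δ T κ → TyConv Sg Δ T T κ
  | symm {Δ T U κ} : TyConv Sg Δ T U κ → TyConv Sg Δ U T κ
  | trans {Δ T U V κ} : TyConv Sg Δ T U κ → TyConv Sg Δ U V κ → TyConv Sg Δ T V κ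
  | sub {Δ T U κ κ'} : TyConv Sg Δ T U κ → κ.Sub κ' → TyConv Sg Δ T U κ'
  | arr {Δ T T' U U'} : TyConv Sg Δ T T' .T → TyConv Sg Δ U U' .T →
      TyConv Sg Δ (.arr T U) (.arr T' U') .T
  | pair {Δ T T' U U'} : TyConv Sg Δ T T' .T → TyConv Sg Δ U U' .T →
      TyConv Sg Δ (.pair T U) (.pair T' U') .T
  | all {Δ κ T T'} : TyConv Sg (κ :: Δ) T T' .T → TyConv Sg Δ (.all κ T) (.all κ T') .T
  | inn {Δ T T' S S'} : TyConv Sg Δ T T' .P → TyConv Sg Δ S S' .S →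
      TyConv Sg Δ (.inn T S) (.inn T' S') .S
  | out {Δ T T' S S'} : TyConv Sg Δ T T' .P → TyConv Sg Δ S S' .S →
      TyConv Sg Δ (.out T S) (.out T' S') .S
  | dual {Δ S S'} : TyConv Sg Δ S S' .S → TyConv Sg Δ (.dual S) (.dual S') .S
  | neg {Δ T T'} : TyConv Sg Δ T T' .P → TyConv Sg Δ (.neg T) (.neg T') .P
  | proto {Δ ρ d} {U U' : Fin d.arity → Ty} : Sg ρ = some d →
      (∀ i, TyConv Sg Δ (U i) (U' i) .P) →
      TyConv Sg Δ (.proto ρ d.arity U) (.proto ρ d.arity U') .P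
  | dualEndW {Δ} : TyConv Sg Δ (.dual .endW) .endT .S
  | dualEndT {Δ} : TyConv Sg Δ (.dual .endT) .endW .S
  | dualIn {Δ T S} : Kinding Sg .check Δ T .P → Kinding Sg .check Δ S .S →
      TyConv Sg Δ (.dual (.inn T S)) (.out T (.dual S)) .S
  | dualOut {Δ T S} : Kinding Sg .check Δ T .P → Kinding Sg .check Δ S .S →
      TyConv Sg Δ (.dual (.out T S)) (.inn T (.dual S)) .S
  | dualInv {Δ S} : Kinding Sg .check Δ S .S → TyConv Sg Δ (.dual (.dual S)) S .S
  | negIn {Δ T S} : Kinding Sg .check Δ T .P → Kinding Sg .check Δ S .S →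
      TyConv Sg Δ (.inn (.neg T) S) (.out T S) .S
  | negOut {Δ T S} : Kinding Sg .check Δ T .P → Kinding Sg .check Δ S .S →
      TyConv Sg Δ (.out (.neg T) S) (.inn T S) .S
  | negInv {Δ T} : Kinding Sg .check Δ T .P → TyConv Sg Δ (.neg (.neg T)) T .P

/-! ### Normalization -/

/-- Polarities. -/
inductive Pol where
  | pos
  | neg

def Pol.flip : Pol → Pol
  | .pos => .neg
  | .neg => .pos

/-- The directional operators `+(T)` and `-(T)`. -/
def dirOp : Pol → Ty → Ty
  | p, .neg T => dirOp p.flip T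
  | .pos, T => T
  | .neg, T => .neg T

/-- Materialization `§(T).S`. -/
def mat : Ty → Ty → Ty
  | .neg T, S => .inn T S
  | T, S => .out T S

/-- `§(±(T₁)).⋯.§(±(Tₘ)).S` -/
def matSeq (p : Pol) (Ts : List Ty) (S : Ty) : Ty :=
  Ts.foldr (fun T R => mat (dirOp p T) R) S

/-- `T` or `Dual T`. -/
def polDual : Pol → Ty → Ty
  | .pos, T => T
  | .neg, T => .dual T

/-- Normalization: `nrm .pos T` is the normal form of `T`, and `nrm .neg S` is the normal form of
`Dual S` for a session type `S`. (The value of `nrm .neg` at a type that is not a session type is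
irrelevant: no rule asks for it.) -/
def nrm : Pol → Ty → Ty
  | p, .unit => polDual p .unit
  | p, .arr T U => polDual p (.arr (nrm .pos T) (nrm .pos U))
  | p, .pair T U => polDual p (.pair (nrm .pos T) (nrm .pos U))
  | p, .all κ T => polDual p (.all κ (nrm .pos T))
  | p, .var i => polDual p (.var i)
  | p, .inn T S => mat (dirOp p.flip (nrm .pos T)) (nrm p S)
  | p, .out T S => mat (dirOp p (nrm .pos T)) (nrm p S)
  | .pos, .endW => .endW
  | .neg, .endW => .endT
  | .pos, .endT => .endT
  | .neg, .endT => .endW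
  | p, .dual T => nrm p.flip T
  | p, .neg T => polDual p (dirOp .neg (nrm .pos T))
  | p, .proto ρ n U => polDual p (.proto ρ n (fun i => nrm .pos (U i)))

/-! ### Expressions -/

inductive Const where
  | unit
  | fork
  | new
  | receive
  | send
  | select (C : Name)
  | wait
  | terminate

inductive Expr where
  | const (c : Const)
  | fvar (x : Name)
  | bvar (i : ℕ)
  /-- `λx:T.e` -/
  | abs (T : Ty) (e : Expr)
  /-- `rec x:T.v` -/
  | recf (T : Ty) (v : Expr)
  /-- `Λα:κ.v` -/
  | tabs (κ : Kind) (v : Expr)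
  | pair (e₁ e₂ : Expr)
  | app (e₁ e₂ : Expr)
  | tapp (e : Expr) (T : Ty)
  /-- `let * = e₁ in e₂` -/
  | letu (e₁ e₂ : Expr)
  /-- `let (x, y) = e₁ in e₂`; in `e₂`, index `1` is `x` and index `0` is `y`. -/
  | letp (e₁ e₂ : Expr)
  /-- `match e with {Cᵢ xᵢ → eᵢ}`, for a finite family of branches. -/
  | mtch (e : Expr) (n : ℕ) (C : Fin n → Name) (b : Fin n → Expr)

namespace Expr

/-- Substitution of types in an expression. -/
def tsubst : Expr → (ℕ → Ty) → Expr
  | const c, _ => const c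
  | fvar x, _ => fvar x
  | bvar i, _ => bvar i
  | abs T e, σ => abs (T.subst σ) (e.tsubst σ)
  | recf T v, σ => recf (T.subst σ) (v.tsubst σ)
  | tabs κ v, σ => tabs κ (v.tsubst (Ty.ups σ))
  | pair e₁ e₂, σ => pair (e₁.tsubst σ) (e₂.tsubst σ)
  | app e₁ e₂, σ => app (e₁.tsubst σ) (e₂.tsubst σ)
  | tapp e T, σ => tapp (e.tsubst σ) (T.subst σ)
  | letu e₁ e₂, σ => letu (e₁.tsubst σ) (e₂.tsubst σ)
  | letp e₁ e₂, σ => letp (e₁.tsubst σ) (e₂.tsubst σ)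
  | mtch e n C b, σ => mtch (e.tsubst σ) n C (fun i => (b i).tsubst σ)

/-- Weakening by one type variable. -/
def tshift (e : Expr) : Expr := e.tsubst (fun i => .var (i + 1))

/-- `e[U/α]`, for the type variable `α` bound last. -/
def tinst (e : Expr) (U : Ty) : Expr := e.tsubst (Ty.single U)

/-- Replace the bound variable `k` by `u`, an expression without dangling indices. -/
def openAt : Expr → ℕ → Expr → Expr
  | const c, _, _ => const c
  | fvar x, _, _ => fvar x
  | bvar i, k, u => if i = k then u else bvar i
  | abs T e, k, u => abs T (e.openAt (k + 1) u)
  | recf T v, k, u => recf T (v.openAt (k + 1) u)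
  | tabs κ v, k, u => tabs κ (v.openAt k u.tshift)
  | pair e₁ e₂, k, u => pair (e₁.openAt k u) (e₂.openAt k u)
  | app e₁ e₂, k, u => app (e₁.openAt k u) (e₂.openAt k u)
  | tapp e T, k, u => tapp (e.openAt k u) T
  | letu e₁ e₂, k, u => letu (e₁.openAt k u) (e₂.openAt k u)
  | letp e₁ e₂, k, u => letp (e₁.openAt k u) (e₂.openAt (k + 2) u)
  | mtch e n C b, k, u => mtch (e.openAt k u) n C (fun i => (b i).openAt (k + 1) u)

/-- `e[u/x]`, for the body `e` of a binder of `x`. -/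
def open1 (e u : Expr) : Expr := e.openAt 0 u

/-- `e[u/x][v/y]`, for the body `e` of a binder of `x, y`. -/
def open2 (e u v : Expr) : Expr := (e.openAt 1 u).openAt 0 v

/-- Turn the free variable `x` into the bound variable `k`. -/
def closeAt : Expr → ℕ → Name → Expr
  | const c, _, _ => const c
  | fvar y, k, x => if y = x then bvar k else fvar y
  | bvar i, _, _ => bvar i
  | abs T e, k, x => abs T (e.closeAt (k + 1) x)
  | recf T v, k, x => recf T (v.closeAt (k + 1) x)
  | tabs κ v, k, x => tabs κ (v.closeAt k x)
  | pair e₁ e₂, k, x => pair (e₁.closeAt k x) (e₂.closeAt k x)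
  | app e₁ e₂, k, x => app (e₁.closeAt k x) (e₂.closeAt k x)
  | tapp e T, k, x => tapp (e.closeAt k x) T
  | letu e₁ e₂, k, x => letu (e₁.closeAt k x) (e₂.closeAt k x)
  | letp e₁ e₂, k, x => letp (e₁.closeAt k x) (e₂.closeAt (k + 2) x)
  | mtch e n C b, k, x => mtch (e.closeAt k x) n C (fun i => (b i).closeAt (k + 1) x)

/-- Free term variables. -/
def fv : Expr → Finset Name
  | const _ => ∅
  | fvar x => {x}
  | bvar _ => ∅
  | abs _ e => e.fv
  | recf _ v => v.fv
  | tabs _ v => v.fv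
  | pair e₁ e₂ => e₁.fv ∪ e₂.fv
  | app e₁ e₂ => e₁.fv ∪ e₂.fv
  | tapp e _ => e.fv
  | letu e₁ e₂ => e₁.fv ∪ e₂.fv
  | letp e₁ e₂ => e₁.fv ∪ e₂.fv
  | mtch e n _ b => e.fv ∪ (Finset.univ : Finset (Fin n)).biUnion (fun i => (b i).fv)

end Expr

/-- Expressions of the form `(select C) [T₁] ⋯ [Tₘ]`, with `m ≥ 0`. -/
inductive IsSelect (C : Name) : Expr → Prop
  | base : IsSelect C (.const (.select C))
  | tapp {e T} : IsSelect C e → IsSelect C (.tapp e T)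

inductive IsValue : Expr → Prop
  | const {c} : IsValue (.const c)
  | fvar {x} : IsValue (.fvar x)
  | bvar {i} : IsValue (.bvar i)
  | abs {T e} : IsValue (.abs T e)
  | recf {T v} : IsValue v → IsValue (.recf T v)
  | tabs {κ v} : IsValue v → IsValue (.tabs κ v)
  | pair {u v} : IsValue u → IsValue v → IsValue (.pair u v)
  | receive1 {T} : IsValue (.tapp (.const .receive) T)
  | receive2 {T U} : IsValue (.tapp (.tapp (.const .receive) T) U)
  | send1 {T} : IsValue (.tapp (.const .send) T)
  | send2 {T U} : IsValue (.tapp (.tapp (.const .send) T) U)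
  | send3 {T U v} : IsValue v → IsValue (.app (.tapp (.tapp (.const .send) T) U) v)
  | select {C e} : IsSelect C e → IsValue e

/-! ### Expression typing -/

/-- `∀α₁:P. ⋯ ∀αₙ:P. T` -/
def allP : ℕ → Ty → Ty
  | 0, T => T
  | n + 1, T => .all .P (allP n T)

/-- Types for constants, in normal form. In the type of `select Cₖ`, index `0` is `β` and index
`n - j` is the protocol parameter `αⱼ`, where `n` is the arity. -/
inductive TypeOf (Sg : Sig) : Const → Ty → Prop
  | unit : TypeOf Sg .unit .unit
  | fork : TypeOf Sg .fork (.arr (.arr .unit .unit) .unit)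
  | new : TypeOf Sg .new (.all .S (.pair (.var 0) (.dual (.var 0))))
  | receive : TypeOf Sg .receive
      (.all .T (.all .S (.arr (.inn (.var 1) (.var 0)) (.pair (.var 1) (.var 0)))))
  | send : TypeOf Sg .send
      (.all .T (.all .S (.arr (.var 1) (.arr (.out (.var 1) (.var 0)) (.var 0)))))
  | wait : TypeOf Sg .wait (.arr .endW .unit)
  | terminate : TypeOf Sg .terminate (.arr .endT .unit)
  | select {ρ d} : Sg ρ = some d → ∀ k : Fin d.numCons,
      TypeOf Sg (.select (d.con k))
        (nrm .pos (allP d.arity (.all .S (.arr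
          (.out (.proto ρ d.arity (fun j => .var (d.arity - j))) (.var 0))
          (matSeq .pos ((d.args k).map (fun T => T.subst (fun j => .var (d.arity - j))))
            (.var 0))))))

/-- Entries of typing contexts are linear, `x : T`, or unrestricted, `x :* T`. -/
inductive Mult where
  | lin
  | un

/-- Typing contexts, up to exchange; `Γ₁ + Γ₂` is the context `Γ₁, Γ₂`. -/
abbrev Ctx := Multiset (Name × Mult × Ty)

/-- The names bound in a context. -/
def Ctx.dom (Γ : Ctx) : Multiset Name := Γ.map (fun b => b.1)

/-- The context under one more type variable. -/
def Ctx.shift (Γ : Ctx) : Ctx := Γ.map (fun b => (b.1, b.2.1, b.2.2.shift))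

/-- The normalized session type `§(±(T₁[U/α])).⋯.§(±(Tₘ[U/α])).S`, where `T₁, …, Tₘ` are the
arguments of the `k`-th constructor: the type of a channel end after that constructor has been
received (`-`) or selected (`+`) on it. -/
def contTy (p : Pol) (d : ProtoDecl) (k : Fin d.numCons) (U : Fin d.arity → Ty) (S : Ty) : Ty :=
  nrm .pos (matSeq p ((d.args k).map (fun T => T.subst (Ty.params U))) S)

/-- `Typed Sg .synth Δ Γ₁ e T Γ₂` is `Δ; Γ₁ ⊢ e ⇒ T ⊣ Γ₂`, and `Typed Sg .check Δ Γ₁ e T Γ₂` is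
`Δ; Γ₁ ⊢ e ⇐ T ⊣ Γ₂`; the context `Γ₂` is the part of `Γ₁` that `e` does not consume. -/
inductive Typed (Sg : Sig) : Mode → List Kind → Ctx → Expr → Ty → Ctx → Prop
  | const {Δ Γ c T} : TypeOf Sg c T → Typed Sg .synth Δ Γ (.const c) T Γ
  | var {Δ Γ x T} : Kinding Sg .check Δ T .T →
      Typed Sg .synth Δ ((x, .lin, T) ::ₘ Γ) (.fvar x) T Γ
  | varStar {Δ Γ x T} : Kinding Sg .check Δ T .T →
      Typed Sg .synth Δ ((x, .un, T) ::ₘ Γ) (.fvar x) T ((x, .un, T) ::ₘ Γ)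
  | letu {Δ Γ₁ Γ₂ Γ₃ e₁ e₂ T} : Typed Sg .check Δ Γ₁ e₁ .unit Γ₂ →
      Typed Sg .synth Δ Γ₂ e₂ T Γ₃ → Typed Sg .synth Δ Γ₁ (.letu e₁ e₂) T Γ₃
  | abs {Δ Γ₁ Γ₂ T e U} (x : Name) : x ∉ e.fv → x ∉ Ctx.dom Γ₁ →
      Kinding Sg .check Δ T .T →
      Typed Sg .synth Δ ((x, .lin, nrm .pos T) ::ₘ Γ₁) (e.open1 (.fvar x)) U Γ₂ →
      x ∉ Ctx.dom Γ₂ →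
      Typed Sg .synth Δ Γ₁ (.abs T e) (.arr (nrm .pos T) U) Γ₂
  | app {Δ Γ₁ Γ₂ Γ₃ e₁ e₂ T U} : Typed Sg .synth Δ Γ₁ e₁ (.arr T U) Γ₂ →
      Typed Sg .check Δ Γ₂ e₂ T Γ₃ → Typed Sg .synth Δ Γ₁ (.app e₁ e₂) U Γ₃
  | pair {Δ Γ₁ Γ₂ Γ₃ e₁ e₂ T U} : Typed Sg .synth Δ Γ₁ e₁ T Γ₂ →
      Typed Sg .synth Δ Γ₂ e₂ U Γ₃ → Typed Sg .synth Δ Γ₁ (.pair e₁ e₂) (.pair T U) Γ₃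
  | recf {Δ Γ T U v V} (x : Name) : x ∉ v.fv → x ∉ Ctx.dom Γ → IsValue v →
      Kinding Sg .check Δ (.arr T U) .T → nrm .pos (.arr T U) = V →
      Typed Sg .check Δ ((x, .un, V) ::ₘ Γ) (v.open1 (.fvar x)) V ((x, .un, V) ::ₘ Γ) →
      Typed Sg .synth Δ Γ (.recf (.arr T U) v) V Γ
  | tabs {Δ Γ₁ Γ₂ κ v T} : IsValue v →
      Typed Sg .synth (κ :: Δ) (Ctx.shift Γ₁) v T (Ctx.shift Γ₂) →
      Typed Sg .synth Δ Γ₁ (.tabs κ v) (.all κ T) Γ₂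
  | tapp {Δ Γ₁ Γ₂ e κ U T} : Typed Sg .synth Δ Γ₁ e (.all κ U) Γ₂ →
      Kinding Sg .check Δ T κ →
      Typed Sg .synth Δ Γ₁ (.tapp e T) (nrm .pos (U.inst T)) Γ₂
  | letp {Δ Γ₁ Γ₂ Γ₃ e₁ e₂ T U V} (x y : Name) : x ≠ y → x ∉ e₂.fv → y ∉ e₂.fv →
      x ∉ Ctx.dom Γ₂ → y ∉ Ctx.dom Γ₂ →
      Typed Sg .synth Δ Γ₁ e₁ (.pair T U) Γ₂ →
      Typed Sg .synth Δ ((x, .lin, nrm .pos T) ::ₘ (y, .lin, nrm .pos U) ::ₘ Γ₂)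
        (e₂.open2 (.fvar x) (.fvar y)) V Γ₃ →
      x ∉ Ctx.dom Γ₃ → y ∉ Ctx.dom Γ₃ →
      Typed Sg .synth Δ Γ₁ (.letp e₁ e₂) V Γ₃
  /- The branches are those of the declaration, in any order (`π` matches them up). -/
  | mtch {Δ Γ₁ Γ₂ Γ₃ ρ d} {U : Fin d.arity → Ty} {S V e n} {C : Fin n → Name}
      {b : Fin n → Expr} (π : Fin n ≃ Fin d.numCons) (x : Fin n → Name) :
      Sg ρ = some d → (∀ i, C i = d.con (π i)) →
      Typed Sg .synth Δ Γ₁ e (.inn (.proto ρ d.arity U) S) Γ₂ →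
      (∀ i, x i ∉ (b i).fv) → (∀ i, x i ∉ Ctx.dom Γ₂) →
      (∀ i, Typed Sg .synth Δ ((x i, .lin, contTy .neg d (π i) U S) ::ₘ Γ₂)
        ((b i).open1 (.fvar (x i))) V Γ₃) →
      (∀ i, x i ∉ Ctx.dom Γ₃) →
      Typed Sg .synth Δ Γ₁ (.mtch e n C b) V Γ₃
  /- Types that differ only in the names of bound variables are equal in this representation. -/
  | check {Δ Γ₁ Γ₂ e T U} : Typed Sg .synth Δ Γ₁ e U Γ₂ → T = U →
      Typed Sg .check Δ Γ₁ e T Γ₂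

/-- A context binds each name at most once. -/
def Ctx.Distinct (Γ : Ctx) : Prop := (Ctx.dom Γ).Nodup

/-- Well-formed contexts: names are distinct, types have kind `T` and are in normal form. -/
def Ctx.WF (Sg : Sig) (Δ : List Kind) (Γ : Ctx) : Prop :=
  Γ.Distinct ∧ ∀ b ∈ Γ, Kinding Sg .check Δ b.2.2 .T ∧ nrm .pos b.2.2 = b.2.2

/-! ### Labels and transitions of expressions -/

/-- Labels `σ` for session operations. -/
inductive SLabel where
  /-- `x?v` -/
  | rcv (x : Name) (v : Expr)
  /-- `x!v` -/
  | snd (x : Name) (v : Expr)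
  /-- `x?C` -/
  | rcvC (x : Name) (C : Name)
  /-- `x!C` -/
  | sndC (x : Name) (C : Name)
  /-- `wait` on `x` -/
  | wait (x : Name)
  /-- `terminate` on `x` -/
  | term (x : Name)

/-- Labels `λ` for expressions. -/
inductive ELabel where
  | sess (σ : SLabel)
  | beta
  | fork (v : Expr)
  | new (x y : Name) (T : Ty)

inductive EStep : Expr → ELabel → Expr → Prop
  | app {T e v} : IsValue v → EStep (.app (.abs T e) v) .beta (e.open1 v)
  | tapp {κ v T} : IsValue v → EStep (.tapp (.tabs κ v) T) .beta (v.tinst T)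
  | letp {u v e} : IsValue u → IsValue v → EStep (.letp (.pair u v) e) .beta (e.open2 u v)
  | letu {e} : EStep (.letu (.const .unit) e) .beta e
  | recf {T v u} : IsValue v → IsValue u →
      EStep (.app (.recf T v) u) .beta (.app (v.open1 (.recf T v)) u)
  | fork {v} : IsValue v → EStep (.app (.const .fork) v) (.fork v) (.const .unit)
  | new {T} (x y : Name) :
      EStep (.tapp (.const .new) T) (.new x y T) (.pair (.fvar x) (.fvar y))
  | rcv {T U x v} : IsValue v →
      EStep (.app (.tapp (.tapp (.const .receive) T) U) (.fvar x)) (.sess (.rcv x v))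
        (.pair v (.fvar x))
  | send {T U v x} : IsValue v →
      EStep (.app (.app (.tapp (.tapp (.const .send) T) U) v) (.fvar x)) (.sess (.snd x v))
        (.fvar x)
  | mtch {x n} {C : Fin n → Name} {b : Fin n → Expr} (k : Fin n) :
      EStep (.mtch (.fvar x) n C b) (.sess (.rcvC x (C k))) ((b k).open1 (.fvar x))
  | sel {C e x} : IsSelect C e →
      EStep (.app e (.fvar x)) (.sess (.sndC x C)) (.fvar x)
  | wait {x} : EStep (.app (.const .wait) (.fvar x)) (.sess (.wait x)) (.const .unit)
  | term {x} : EStep (.app (.const .terminate) (.fvar x)) (.sess (.term x)) (.const .unit)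
  | appL {e₁ l e₂ e₃} : EStep e₁ l e₂ → EStep (.app e₁ e₃) l (.app e₂ e₃)
  | appR {v e₁ l e₂} : IsValue v → EStep e₁ l e₂ → EStep (.app v e₁) l (.app v e₂)
  | tappE {e₁ l e₂ T} : EStep e₁ l e₂ → EStep (.tapp e₁ T) l (.tapp e₂ T)
  | pairL {e₁ l e₂ e₃} : EStep e₁ l e₂ → EStep (.pair e₁ e₃) l (.pair e₂ e₃)
  | pairR {v e₁ l e₂} : IsValue v → EStep e₁ l e₂ → EStep (.pair v e₁) l (.pair v e₂)
  | mtchE {e₁ l e₂ n} {C : Fin n → Name} {b : Fin n → Expr} : EStep e₁ l e₂ →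
      EStep (.mtch e₁ n C b) l (.mtch e₂ n C b)
  | letpE {e₁ l e₂ e₃} : EStep e₁ l e₂ → EStep (.letp e₁ e₃) l (.letp e₂ e₃)
  | letuE {e₁ l e₂ e₃} : EStep e₁ l e₂ → EStep (.letu e₁ e₃) l (.letu e₂ e₃)

/-! ### Processes -/

inductive Proc where
  /-- `⟨e⟩` -/
  | exp (e : Expr)
  | par (p q : Proc)
  /-- `(νxy)p`; in `p`, index `1` is `x` and index `0` is `y`. -/
  | nu (p : Proc)

namespace Proc

def openAt : Proc → ℕ → Expr → Proc
  | exp e, k, u => exp (e.openAt k u)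
  | par p q, k, u => par (p.openAt k u) (q.openAt k u)
  | nu p, k, u => nu (p.openAt (k + 2) u)

/-- The body `p` of `(νxy)p`, with the names `x` and `y` for its channel ends. -/
def opened (p : Proc) (x y : Name) : Proc := (p.openAt 1 (.fvar x)).openAt 0 (.fvar y)

def closeAt : Proc → ℕ → Name → Proc
  | exp e, k, x => exp (e.closeAt k x)
  | par p q, k, x => par (p.closeAt k x) (q.closeAt k x)
  | nu p, k, x => nu (p.closeAt (k + 2) x)

/-- `(νxy)p`, for a process `p` in which `x` and `y` are free names. -/
def res (x y : Name) (p : Proc) : Proc := nu ((p.closeAt 1 x).closeAt 0 y)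

/-- Free term variables. -/
def fv : Proc → Finset Name
  | exp e => e.fv
  | par p q => p.fv ∪ q.fv
  | nu p => p.fv

end Proc

/-- Labels `π` for processes. -/
inductive PLabel where
  | sess (σ : SLabel)
  | tau
  /-- `(νab)x!c` -/
  | scope (a b x c : Name)
  | par (π π' : PLabel)

def SLabel.fv : SLabel → Finset Name
  | rcv x v => {x} ∪ v.fv
  | snd x v => {x} ∪ v.fv
  | rcvC x _ => {x}
  | sndC x _ => {x}
  | wait x => {x}
  | term x => {x}

/-- Free names of a label. -/
def PLabel.fv : PLabel → Finset Name
  | sess σ => σ.fv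
  | tau => ∅
  | scope a b x c => {x, c} \ {a, b}
  | par π π' => π.fv ∪ π'.fv

/-- Bound names of a label. -/
def PLabel.bn : PLabel → Finset Name
  | sess _ => ∅
  | tau => ∅
  | scope a b _ _ => {a, b}
  | par π π' => π.bn ∪ π'.bn

/-- Transitions of processes. The disjointness and freshness conditions are those of the variable
convention: names that are bound, in a process or in a label, are distinct from all names in their
surroundings. -/
inductive PStep : Proc → PLabel → Proc → Prop
  | session {e₁ σ e₂} : EStep e₁ (.sess σ) e₂ → PStep (.exp e₁) (.sess σ) (.exp e₂)
  | beta {e₁ e₂} : EStep e₁ .beta e₂ → PStep (.exp e₁) .tau (.exp e₂)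
  | fork {e₁ v e₂} : EStep e₁ (.fork v) e₂ →
      PStep (.exp e₁) .tau (.par (.exp e₂) (.exp (.app v (.const .unit))))
  | new {e₁ e₂ T} (x y : Name) : x ≠ y → x ∉ e₁.fv → y ∉ e₁.fv →
      EStep e₁ (.new x y T) e₂ → PStep (.exp e₁) .tau (.res x y (.exp e₂))
  | joinL {p₁ p₂ q₁ q₂ π₁ π₂} : PStep p₁ π₁ q₁ → PStep p₂ π₂ q₂ →
      Disjoint π₁.bn p₂.fv → Disjoint π₂.bn p₁.fv →
      PStep (.par p₁ p₂) (.par π₁ π₂) (.par q₁ q₂)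
  | joinR {p₁ p₂ q₁ q₂ π₁ π₂} : PStep p₁ π₁ q₁ → PStep p₂ π₂ q₂ →
      Disjoint π₁.bn p₂.fv → Disjoint π₂.bn p₁.fv →
      PStep (.par p₁ p₂) (.par π₂ π₁) (.par q₁ q₂)
  | msg {p q v} (x y : Name) : x ≠ y → x ∉ p.fv → y ∉ p.fv →
      PStep (p.opened x y) (.par (.sess (.rcv x v)) (.sess (.snd y v))) q →
      PStep (.nu p) .tau (.res x y q)
  | bra {p q C} (x y : Name) : x ≠ y → x ∉ p.fv → y ∉ p.fv →
      PStep (p.opened x y) (.par (.sess (.rcvC x C)) (.sess (.sndC y C))) q →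
      PStep (.nu p) .tau (.res x y q)
  | wait {p q} (x y : Name) : x ≠ y → x ∉ p.fv → y ∉ p.fv →
      PStep (p.opened x y) (.par (.sess (.wait x)) (.sess (.term y))) q →
      PStep (.nu p) .tau q
  | parL {p₁ p₂ q π} : PStep p₁ π p₂ → Disjoint π.bn q.fv → PStep (.par p₁ q) π (.par p₂ q)
  | parR {p q₁ q₂ π} : PStep q₁ π q₂ → Disjoint π.bn p.fv → PStep (.par p q₁) π (.par p q₂)
  | res {p q π} (x y : Name) : x ≠ y → x ∉ p.fv → y ∉ p.fv →
      PStep (p.opened x y) π q → x ∉ π.fv ∪ π.bn → y ∉ π.fv ∪ π.bn →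
      PStep (.nu p) π (.res x y q)
  | openL {p q x} (a b : Name) : a ≠ b → a ∉ p.fv → b ∉ p.fv →
      PStep (p.opened a b) (.sess (.snd x (.fvar a))) q → x ≠ a → x ≠ b →
      PStep (.nu p) (.scope a b x a) q
  | openR {p q x} (a b : Name) : a ≠ b → a ∉ p.fv → b ∉ p.fv →
      PStep (p.opened a b) (.sess (.snd x (.fvar b))) q → x ≠ a → x ≠ b →
      PStep (.nu p) (.scope a b x b) q
  | closeL {p q a b} (x y : Name) : x ≠ y → x ∉ p.fv → y ∉ p.fv →
      PStep (p.opened x y) (.par (.sess (.rcv x (.fvar a))) (.scope a b y a)) q →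
      PStep (.nu p) .tau (.res x y (.res a b q))
  | closeR {p q a b} (x y : Name) : x ≠ y → x ∉ p.fv → y ∉ p.fv →
      PStep (p.opened x y) (.par (.sess (.rcv x (.fvar b))) (.scope a b y b)) q →
      PStep (.nu p) .tau (.res x y (.res a b q))

/-- `Γ ⊢ p` -/
inductive ProcTyped (Sg : Sig) : Ctx → Proc → Prop
  | exp {Γ e} : Typed Sg .check [] Γ e .unit 0 → ProcTyped Sg Γ (.exp e)
  | par {Γ₁ Γ₂ p₁ p₂} : ProcTyped Sg Γ₁ p₁ → ProcTyped Sg Γ₂ p₂ →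
      ProcTyped Sg (Γ₁ + Γ₂) (.par p₁ p₂)
  | new {Γ p T} (x y : Name) : x ≠ y → x ∉ p.fv → y ∉ p.fv → x ∉ Ctx.dom Γ → y ∉ Ctx.dom Γ →
      Kinding Sg .check [] T .S →
      ProcTyped Sg ((x, .lin, nrm .pos T) ::ₘ (y, .lin, nrm .neg T) ::ₘ Γ) (p.opened x y) →
      ProcTyped Sg Γ (.nu p)

/-! ### Transitions of typing contexts -/

inductive CtxSStep (Sg : Sig) : Ctx → SLabel → Ctx → Prop
  | rcv {Γ v x T S} : Typed Sg .check [] Γ v T 0 →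
      CtxSStep Sg {(x, .lin, .inn T S)} (.rcv x v) (Γ + {(x, .lin, S)})
  | snd {Γ v x T S} : Typed Sg .check [] Γ v T 0 →
      CtxSStep Sg (Γ + {(x, .lin, .out T S)}) (.snd x v) {(x, .lin, S)}
  | rcvC {x ρ d S} {U : Fin d.arity → Ty} : Sg ρ = some d → ∀ k : Fin d.numCons,
      CtxSStep Sg {(x, .lin, .inn (.proto ρ d.arity U) S)} (.rcvC x (d.con k))
        {(x, .lin, contTy .neg d k U S)}
  | sndC {x ρ d S} {U : Fin d.arity → Ty} : Sg ρ = some d → ∀ k : Fin d.numCons,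
      CtxSStep Sg {(x, .lin, .out (.proto ρ d.arity U) S)} (.sndC x (d.con k))
        {(x, .lin, contTy .pos d k U S)}
  | wait {x} : CtxSStep Sg {(x, .lin, .endW)} (.wait x) 0
  | term {x} : CtxSStep Sg {(x, .lin, .endT)} (.term x) 0

/-- Context transitions for the labels of expressions. -/
inductive CtxEStep (Sg : Sig) : Ctx → ELabel → Ctx → Prop
  | sess {Γ σ Γ'} : CtxSStep Sg Γ σ Γ' → CtxEStep Sg Γ (.sess σ) Γ'
  | beta : CtxEStep Sg 0 .beta 0
  | fork {Γ v} : Typed Sg .check [] Γ v (.arr .unit .unit) 0 → CtxEStep Sg Γ (.fork v) 0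
  | new {x y T} :
      CtxEStep Sg 0 (.new x y T) {(x, .lin, nrm .pos T), (y, .lin, nrm .neg T)}

/-- Context transitions for the labels of processes. -/
inductive CtxPStep (Sg : Sig) : Ctx → PLabel → Ctx → Prop
  | sess {Γ σ Γ'} : CtxSStep Sg Γ σ Γ' → CtxPStep Sg Γ (.sess σ) Γ'
  | tau : CtxPStep Sg 0 .tau 0
  | openL {a b x T S} : CtxPStep Sg {(x, .lin, .out T S)} (.scope a b x a)
      {(b, .lin, nrm .neg T), (x, .lin, S)}
  | openR {a b x T S} : CtxPStep Sg {(x, .lin, .out T S)} (.scope a b x b)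
      {(a, .lin, nrm .neg T), (x, .lin, S)}
  | par {Γ₁ Γ₂ Γ₃ Γ₄ π₁ π₂} : CtxPStep Sg Γ₁ π₁ Γ₃ → CtxPStep Sg Γ₂ π₂ Γ₄ →
      CtxPStep Sg (Γ₁ + Γ₂) (.par π₁ π₂) (Γ₃ + Γ₄)

end AlgST

/-! The algorithmic judgement threads contexts: what one premise leaves over is the input of the
next. Substitution is awkward in this form, so the proof passes to a declarative judgement `Decl`
over environments that type both names and indices. There linearity is a matter of occurrences: no
linear variable occurs in two parts of an expression, a linearly bound variable occurs in its scope,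
a recursive value mentions no linear variable, and all branches of a match mention the same ones.
For contexts with distinct names the two judgements are equivalent (`Typed.decl`, `Decl.typed`), and
the output context is always the input without the linear entries whose names occur in the
expression (`Ctx.rest`).

On types, everything rests on one identity, `Kinding.nrm_subst`: N^p((N^q T)σ) = N^{pq}(Tσ), with
polarities multiplied like signs. It contains idempotence of normalization, involutivity of duality,
and the fact that typing survives a substitution of types followed by normalization (`Decl.tsubst`).
The substitution of values, `Decl.openAt`, holds because a value for a linear variable brings its
own linear variables to the one place where that variable was used, while a value for an
unrestricted variable has no linear variables.

For expressions, `EStep.preserved` is an induction on the transition with a stronger invariant: the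
type stays literally the same, and the linear names that occur change exactly as the context does.
The second half restores the separation conditions of the surrounding evaluation context
(`Change.frame`) and determines the output context (`EStep.typed`). The conversion in the first
statement is therefore reflexivity.

For processes, a communication under a restriction is reduced to the induction hypothesis for the
opened body, whose label is not τ. The context transition for that label is not given and has to be
built. `PStep.cap` reads off from the typing of the process that the channels and payloads in the
label have suitable types. The two ends of a restricted channel have types N⁺T and N⁻T, so an input
type at one end forces the matching output type at the other, with dual continuations
(`Kinding.dual_inn`, `nrm_neg_cont`). For parallel composition, the names that each component needs
determine how the context splits (`Ctx.Distinct.split`). -/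

namespace AlgST

/-! ### Algebra of renamings and substitutions of types. -/

namespace Ty

theorem upr_comp (ξ ζ : ℕ → ℕ) : (fun i => upr ζ (upr ξ i)) = upr (fun i => ζ (ξ i)) := by
  funext i; cases i <;> rfl

theorem rename_rename (T : Ty) : ∀ ξ ζ : ℕ → ℕ,
    (T.rename ξ).rename ζ = T.rename (fun i => ζ (ξ i)) := by
  induction T <;> intro ξ ζ <;> simp_all [rename, upr_comp]

theorem ups_upr (ξ : ℕ → ℕ) (σ : ℕ → Ty) :
    (fun i => ups σ (upr ξ i)) = ups (fun i => σ (ξ i)) := by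
  funext i; cases i <;> rfl

theorem rename_subst (T : Ty) : ∀ (ξ : ℕ → ℕ) (σ : ℕ → Ty),
    (T.rename ξ).subst σ = T.subst (fun i => σ (ξ i)) := by
  induction T <;> intro ξ σ <;> simp_all [rename, subst, ups_upr]

theorem ups_rename (ξ : ℕ → ℕ) (σ : ℕ → Ty) :
    (fun i => (ups σ i).rename (upr ξ)) = ups (fun i => (σ i).rename ξ) := by
  funext i
  cases i with
  | zero => rfl
  | succ i => simp only [ups, shift, rename_rename]; rfl

theorem subst_rename (T : Ty) : ∀ (ξ : ℕ → ℕ) (σ : ℕ → Ty),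
    (T.subst σ).rename ξ = T.subst (fun i => (σ i).rename ξ) := by
  induction T <;> intro ξ σ <;> simp_all [rename, subst, ups_rename]

/-- The successor case moves a shift through a substitution, which is why both mixed laws for
renamings have to come before the composition law for substitutions. -/
theorem ups_subst (τ σ : ℕ → Ty) :
    (fun i => (ups σ i).subst (ups τ)) = ups (fun i => (σ i).subst τ) := by
  funext i
  cases i with
  | zero => rfl
  | succ i => simp only [ups, shift, rename_subst, subst_rename]

theorem subst_subst (T : Ty) : ∀ (σ τ : ℕ → Ty),
    (T.subst σ).subst τ = T.subst (fun i => (σ i).subst τ) := by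
  induction T <;> intro σ τ <;> simp_all [subst, ups_subst]

theorem ups_var : ups var = var := by
  funext i; cases i <;> rfl

theorem subst_var (T : Ty) : T.subst var = T := by
  induction T <;> simp_all [subst, ups_var]

theorem rename_eq_subst (T : Ty) (ξ : ℕ → ℕ) : T.rename ξ = T.subst (fun i => var (ξ i)) := by
  conv_lhs => rw [← subst_var (T.rename ξ), rename_subst]

theorem shift_eq_subst (T : Ty) : T.shift = T.subst (fun i => var (i + 1)) :=
  rename_eq_subst T _

theorem shift_subst_ups (T : Ty) (σ : ℕ → Ty) :
    T.shift.subst (ups σ) = (T.subst σ).shift := by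
  simp only [shift, rename_subst, subst_rename, ups]

theorem shift_inst (T U : Ty) : T.shift.inst U = T := by
  simp only [inst, shift, rename_subst]; exact subst_var T

/-- Extend a substitution by an image of the variable bound last. -/
def scons (U : Ty) (σ : ℕ → Ty) : ℕ → Ty
  | 0 => U
  | i + 1 => σ i

theorem subst_ups_inst (T U : Ty) (σ : ℕ → Ty) :
    (T.subst (ups σ)).inst U = T.subst (scons U σ) := by
  simp only [inst, subst_subst]
  congr 1
  funext i
  cases i with
  | zero => rfl
  | succ i => exact shift_inst (σ i) U

/-- Both sides are the single simultaneous substitution that extends σ by the image of `U`. -/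
theorem inst_subst (T U : Ty) (σ : ℕ → Ty) :
    (T.inst U).subst σ = (T.subst (ups σ)).inst (U.subst σ) := by
  rw [subst_ups_inst, inst, subst_subst]
  congr 1
  funext i
  cases i <;> rfl

/-- A type that is not of the form `-T`. -/
def NonNeg : Ty → Prop
  | neg _ => False
  | _ => True

end Ty

open Ty

/-! ### Kinding -/

theorem Kind.Sub.refl (κ : Kind) : κ.Sub κ := le_refl κ.rank

theorem Kind.Sub.trans {κ κ' κ'' : Kind} (h : κ.Sub κ') (h' : κ'.Sub κ'') : κ.Sub κ'' :=
  le_trans (b := κ'.rank) h h'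

theorem Kind.Sub.toP (κ : Kind) : κ.Sub .P := by cases κ <;> simp [Kind.Sub, Kind.rank]

theorem Kind.Sub.ofS (κ : Kind) : Kind.Sub .S κ := by cases κ <;> simp [Kind.Sub, Kind.rank]

theorem Kind.Sub.eq_S {κ : Kind} (h : κ.Sub .S) : κ = .S := by
  cases κ <;> simp_all [Kind.Sub, Kind.rank]

section Kinding

variable {Sg : Sig}

theorem Kinding.toCheck {m Δ T κ} (h : Kinding Sg m Δ T κ) : Kinding Sg .check Δ T κ := by
  cases m with
  | synth => exact .sub h (Kind.Sub.refl _)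
  | check => exact h

theorem Kinding.weaken {Δ T κ κ'} (h : Kinding Sg .check Δ T κ) (hs : κ.Sub κ') :
    Kinding Sg .check Δ T κ' := by
  cases h with
  | sub h hs' => exact .sub h (hs'.trans hs)

theorem Kinding.rename {m Δ T κ} (h : Kinding Sg m Δ T κ) : ∀ {Δ' : List Kind} {ξ : ℕ → ℕ},
    (∀ i κ, Δ[i]? = some κ → Δ'[ξ i]? = some κ) → Kinding Sg m Δ' (T.rename ξ) κ := by
  induction h with
  | unit => intros; exact .unit
  | arr _ _ ih₁ ih₂ => intro _ _ h; exact .arr (ih₁ h) (ih₂ h)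
  | pair _ _ ih₁ ih₂ => intro _ _ h; exact .pair (ih₁ h) (ih₂ h)
  | all _ ih =>
    intro _ _ h
    refine .all (ih ?_)
    intro i κ hi
    cases i with
    | zero => exact hi
    | succ i => exact h i κ hi
  | var hi => intro _ _ h; exact .var (h _ _ hi)
  | inn _ _ ih₁ ih₂ => intro _ _ h; exact .inn (ih₁ h) (ih₂ h)
  | out _ _ ih₁ ih₂ => intro _ _ h; exact .out (ih₁ h) (ih₂ h)
  | endW => intros; exact .endW
  | endT => intros; exact .endT
  | dual _ ih => intro _ _ h; exact .dual (ih h)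
  | neg _ ih => intro _ _ h; exact .neg (ih h)
  | proto hρ _ ih => intro _ _ h; exact .proto hρ (fun i => ih i h)
  | sub _ hs ih => intro _ _ h; exact .sub (ih h) hs

theorem Kinding.shift {m Δ T κ} (κ' : Kind) (h : Kinding Sg m Δ T κ) :
    Kinding Sg m (κ' :: Δ) T.shift κ :=
  h.rename (fun _ _ hi => hi)

/-- `σ` maps the variables of `Δ` to types of their kinds over `Δ'`. -/
def KSubst (Sg : Sig) (Δ Δ' : List Kind) (σ : ℕ → Ty) : Prop :=
  ∀ i κ, Δ[i]? = some κ → Kinding Sg .check Δ' (σ i) κ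

theorem KSubst.ups {Δ Δ' σ} (κ : Kind) (h : KSubst Sg Δ Δ' σ) :
    KSubst Sg (κ :: Δ) (κ :: Δ') (ups σ) := by
  intro i κ' hi
  cases i with
  | zero => exact Kinding.toCheck (.var hi)
  | succ i => exact (h i κ' hi).shift κ

theorem KSubst.scons {Δ Δ' σ κ U} (h : KSubst Sg Δ Δ' σ) (hU : Kinding Sg .check Δ' U κ) :
    KSubst Sg (κ :: Δ) Δ' (scons U σ) := by
  intro i κ' hi
  cases i with
  | zero => cases hi; exact hU
  | succ i => exact h i κ' hi

theorem KSubst.shift (Δ : List Kind) (κ : Kind) :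
    KSubst Sg Δ (κ :: Δ) (fun i => Ty.var (i + 1)) :=
  fun _ _ hi => Kinding.toCheck (.var hi)

theorem KSubst.single {Δ κ U} (hU : Kinding Sg .check Δ U κ) :
    KSubst Sg (κ :: Δ) Δ (single U) := by
  intro i κ' hi
  cases i with
  | zero => cases hi; exact hU
  | succ i => exact Kinding.toCheck (.var hi)

/-- The result is in checking mode even when the premise synthesizes, because the type put for a
variable may have a strictly smaller kind than the variable. -/
theorem Kinding.subst {m Δ T κ} (h : Kinding Sg m Δ T κ) : ∀ {Δ' : List Kind} {σ : ℕ → Ty},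
    KSubst Sg Δ Δ' σ → Kinding Sg .check Δ' (T.subst σ) κ := by
  induction h with
  | unit => intros; exact Kinding.unit.toCheck
  | arr _ _ ih₁ ih₂ => intro _ _ h; exact (Kinding.arr (ih₁ h) (ih₂ h)).toCheck
  | pair _ _ ih₁ ih₂ => intro _ _ h; exact (Kinding.pair (ih₁ h) (ih₂ h)).toCheck
  | all _ ih => intro _ _ h; exact (Kinding.all (ih (h.ups _))).toCheck
  | var hi => intro _ _ h; exact h _ _ hi
  | inn _ _ ih₁ ih₂ => intro _ _ h; exact (Kinding.inn (ih₁ h) (ih₂ h)).toCheck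
  | out _ _ ih₁ ih₂ => intro _ _ h; exact (Kinding.out (ih₁ h) (ih₂ h)).toCheck
  | endW => intros; exact Kinding.endW.toCheck
  | endT => intros; exact Kinding.endT.toCheck
  | dual _ ih => intro _ _ h; exact (Kinding.dual (ih h)).toCheck
  | neg _ ih => intro _ _ h; exact (Kinding.neg (ih h)).toCheck
  | proto hρ _ ih => intro _ _ h; exact (Kinding.proto hρ (fun i => ih i h)).toCheck
  | sub _ hs ih => intro _ _ h; exact (ih h).weaken hs

theorem Kinding.inst {m Δ T U κ κ'} (h : Kinding Sg m (κ' :: Δ) T κ)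
    (hU : Kinding Sg .check Δ U κ') : Kinding Sg .check Δ (T.inst U) κ :=
  h.subst (KSubst.single hU)

/-- The new kinds are appended at the outer end, so no index changes and the renaming involved is
the identity. -/
theorem Kinding.extend {m Δ T κ} (h : Kinding Sg m Δ T κ) (Δ' : List Kind) :
    Kinding Sg m (Δ ++ Δ') T κ := by
  have h' := h.rename (Δ' := Δ ++ Δ') (ξ := fun i => i) (by
    intro i κ hi
    have hlt : i < Δ.length := by
      by_contra hn
      rw [List.getElem?_eq_none (by omega)] at hi
      cases hi
    rw [List.getElem?_append_left hlt, hi])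
  rwa [rename_eq_subst, subst_var] at h'

theorem Kinding.subst_congr {m Δ T κ} (h : Kinding Sg m Δ T κ) : ∀ {σ τ : ℕ → Ty},
    (∀ i, i < Δ.length → σ i = τ i) → T.subst σ = T.subst τ := by
  induction h with
  | unit | endW | endT => intros; rfl
  | arr _ _ ih₁ ih₂ | pair _ _ ih₁ ih₂ | inn _ _ ih₁ ih₂ | out _ _ ih₁ ih₂ =>
    intro _ _ h; simp only [Ty.subst, ih₁ h, ih₂ h]
  | all _ ih =>
    intro _ _ h
    simp only [Ty.subst]
    rw [ih]
    intro i hi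
    cases i with
    | zero => rfl
    | succ i => simp only [Ty.ups]; rw [h i (by simpa using hi)]
  | var hi =>
    intro _ _ h
    exact h _ (by by_contra hn; rw [List.getElem?_eq_none (by omega)] at hi; cases hi)
  | dual _ ih | neg _ ih => intro _ _ h; simp only [Ty.subst, ih h]
  | proto _ _ ih => intro _ _ h; simp only [Ty.subst]; congr 1; funext i; exact ih i h
  | sub _ _ ih => exact ih

theorem Kinding.subst_closed {m T κ} (h : Kinding Sg m [] T κ) (σ : ℕ → Ty) : T.subst σ = T :=
  (h.subst_congr (τ := Ty.var) (fun _ hi => absurd hi (by simp))).trans (subst_var T)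

/-- A negation synthesizes `P`, which is not a subkind of `T`. Payloads of `send` and `receive` thus
never carry a sign that could reverse the direction of communication. -/
theorem Kinding.nonNeg {Δ T} (h : Kinding Sg .check Δ T .T) : T.NonNeg := by
  cases h with
  | sub h hs => cases h <;> trivial

theorem Kinding.arr_inv {Δ T U κ} (h : Kinding Sg .check Δ (.arr T U) κ) :
    Kinding Sg .check Δ T .T ∧ Kinding Sg .check Δ U .T := by
  cases h with | sub h _ => cases h; exact ⟨‹_›, ‹_›⟩

theorem Kinding.pair_inv {Δ T U κ} (h : Kinding Sg .check Δ (.pair T U) κ) :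
    Kinding Sg .check Δ T .T ∧ Kinding Sg .check Δ U .T := by
  cases h with | sub h _ => cases h; exact ⟨‹_›, ‹_›⟩

theorem Kinding.inn_inv {Δ T U κ} (h : Kinding Sg .check Δ (.inn T U) κ) :
    Kinding Sg .check Δ T .P ∧ Kinding Sg .check Δ U .S := by
  cases h with | sub h _ => cases h; exact ⟨‹_›, ‹_›⟩

theorem Kinding.out_inv {Δ T U κ} (h : Kinding Sg .check Δ (.out T U) κ) :
    Kinding Sg .check Δ T .P ∧ Kinding Sg .check Δ U .S := by
  cases h with | sub h _ => cases h; exact ⟨‹_›, ‹_›⟩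

theorem Kinding.all_inv {Δ T κ κ'} (h : Kinding Sg .check Δ (.all κ' T) κ) :
    Kinding Sg .check (κ' :: Δ) T .T := by
  cases h with | sub h _ => cases h; assumption

theorem Kinding.neg_inv {Δ T κ} (h : Kinding Sg .check Δ (.neg T) κ) :
    Kinding Sg .check Δ T .P := by
  cases h with | sub h _ => cases h; assumption

/-- The length of the argument vector depends on the declaration, so the type is generalized before
inversion; the two declarations are identified afterwards, since both are found under the same
protocol name. -/
theorem Kinding.proto_inv {Δ ρ d κ} {U : Fin d.arity → Ty} (hρ : Sg ρ = some d)
    (h : Kinding Sg .check Δ (.proto ρ d.arity U) κ) : ∀ i, Kinding Sg .check Δ (U i) .P := by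
  generalize hT : Ty.proto ρ d.arity U = T at h
  cases h with
  | sub h _ =>
    cases h with
    | proto hρ' h =>
      rename_i d' _
      obtain ⟨rfl, hn, hU⟩ := Ty.proto.inj hT
      cases hρ.symm.trans hρ'
      cases hU
      exact h
    | _ => cases hT

/-! ### Normalization -/

/-- Composition of polarities. -/
def Pol.mul : Pol → Pol → Pol
  | .pos, q => q
  | .neg, q => q.flip

@[simp] theorem Pol.flip_pos : Pol.flip .pos = .neg := rfl
@[simp] theorem Pol.flip_neg : Pol.flip .neg = .pos := rfl
@[simp] theorem Pol.pos_mul (p : Pol) : Pol.mul .pos p = p := rfl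
@[simp] theorem Pol.mul_pos (p : Pol) : p.mul .pos = p := by cases p <;> rfl
@[simp] theorem Pol.mul_neg (p : Pol) : p.mul .neg = p.flip := by cases p <;> rfl
@[simp] theorem Pol.mul_flip (p q : Pol) : p.mul q.flip = (p.mul q).flip := by
  cases p <;> cases q <;> rfl

theorem dirOp_neg (p : Pol) (T : Ty) : dirOp p (.neg T) = dirOp p.flip T := by
  cases p <;> rw [dirOp]

theorem dirOp_pos {T : Ty} (h : T.NonNeg) : dirOp .pos T = T := by
  cases T <;> first | exact h.elim | (rw [dirOp]; simp)

theorem dirOp_neg_of_nonNeg {T : Ty} (h : T.NonNeg) : dirOp .neg T = .neg T := by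
  cases T <;> first | exact h.elim | (rw [dirOp]; simp)

/-- Every type is an iterated negation of a non-negative one. -/
theorem Ty.neg_induction {P : Ty → Prop} (base : ∀ T : Ty, T.NonNeg → P T)
    (neg : ∀ T, P T → P (.neg T)) : ∀ T, P T := by
  intro T
  induction T with
  | neg T ih => exact neg T ih
  | _ => exact base _ trivial

/-- The directional operators form an action of the group of signs: stacked minus signs cancel in
pairs. -/
theorem dirOp_dirOp (p q : Pol) (T : Ty) : dirOp p (dirOp q T) = dirOp (p.mul q) T := by
  induction T using Ty.neg_induction generalizing q with
  | base T h =>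
    cases q with
    | pos => rw [dirOp_pos h, Pol.mul_pos]
    | neg => rw [dirOp_neg_of_nonNeg h, dirOp_neg, Pol.mul_neg]
  | neg T ih => rw [dirOp_neg, dirOp_neg, ih, Pol.mul_flip]

theorem mat_of_nonNeg {T S : Ty} (h : T.NonNeg) : mat T S = .out T S := by
  cases T <;> first | exact h.elim | rw [mat]; simp

theorem nrm_inn (p : Pol) (T S : Ty) :
    nrm p (.inn T S) = mat (dirOp p.flip (nrm .pos T)) (nrm p S) := by
  cases p <;> rw [nrm]

theorem nrm_out (p : Pol) (T S : Ty) :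
    nrm p (.out T S) = mat (dirOp p (nrm .pos T)) (nrm p S) := by
  cases p <;> rw [nrm]

theorem nrm_dual (p : Pol) (T : Ty) : nrm p (.dual T) = nrm p.flip T := by cases p <;> rw [nrm]

theorem nrm_neg' (p : Pol) (T : Ty) :
    nrm p (.neg T) = polDual p (dirOp .neg (nrm .pos T)) := by
  cases p <;> rw [nrm]

theorem nrm_neg (T : Ty) : nrm .pos (.neg T) = dirOp .neg (nrm .pos T) := by rw [nrm, polDual]

theorem nrm_polDual (p q : Pol) (T : Ty) : nrm p (polDual q T) = nrm (p.mul q) T := by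
  cases q
  · rw [polDual, Pol.mul_pos]
  · rw [polDual, nrm_dual, Pol.mul_neg]

theorem polDual_subst (p : Pol) (T : Ty) (σ : ℕ → Ty) :
    (polDual p T).subst σ = polDual p (T.subst σ) := by
  cases p <;> rfl

/-- Materialization alone does not commute with substitution, as a variable in payload position may
become a negated type. Normalizing afterwards repairs this: the sign already turned into a direction
is multiplied with the sign of the new payload. -/
theorem nrm_mat_subst (p : Pol) (T S : Ty) (σ : ℕ → Ty) :
    nrm p ((mat T S).subst σ) = mat (dirOp p (nrm .pos (T.subst σ))) (nrm p (S.subst σ)) := by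
  cases T with
  | neg T => rw [mat, Ty.subst, nrm_inn, Ty.subst, nrm_neg, dirOp_dirOp, Pol.mul_neg]
  | _ => rw [mat_of_nonNeg (by trivial)]; exact nrm_out _ _ _

theorem mat_nonNeg (T S : Ty) : (mat T S).NonNeg := by
  cases T <;> rw [mat] <;> simp [Ty.NonNeg]

theorem polDual_nonNeg {T : Ty} (p : Pol) (h : T.NonNeg) : (polDual p T).NonNeg := by
  cases p
  · exact h
  · trivial

/-- A normal form has at most one outermost minus sign: each clause of `nrm` ends either in a type
that is not a negation or in the operator `-`, and composing `+` with `-` gives `-`. -/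
theorem dirOp_pos_nrm (p : Pol) (T : Ty) : dirOp .pos (nrm p T) = nrm p T := by
  induction T generalizing p with
  | inn => rw [nrm_inn]; exact dirOp_pos (mat_nonNeg _ _)
  | out => rw [nrm_out]; exact dirOp_pos (mat_nonNeg _ _)
  | dual T ih => rw [nrm_dual]; exact ih _
  | neg T =>
    cases p with
    | pos => rw [nrm_neg, dirOp_dirOp, Pol.pos_mul]
    | neg => exact dirOp_pos trivial
  | endW | endT => cases p <;> exact dirOp_pos trivial
  | _ => rw [nrm]; exact dirOp_pos (polDual_nonNeg _ trivial)

theorem nrm_dirOp_subst (p : Pol) (T : Ty) (σ : ℕ → Ty) :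
    nrm .pos ((dirOp p T).subst σ) = dirOp p (nrm .pos (T.subst σ)) := by
  induction T using Ty.neg_induction generalizing p with
  | base T h =>
    cases p with
    | pos => rw [dirOp_pos h, dirOp_pos_nrm]
    | neg => rw [dirOp_neg_of_nonNeg h, Ty.subst, nrm_neg]
  | neg T ih => rw [dirOp_neg, ih, Ty.subst, nrm_neg, dirOp_dirOp, Pol.mul_neg]

theorem nrm_unit (p : Pol) : nrm p .unit = polDual p .unit := by rw [nrm]
theorem nrm_arr (p : Pol) (T U : Ty) :
    nrm p (.arr T U) = polDual p (.arr (nrm .pos T) (nrm .pos U)) := by rw [nrm]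
theorem nrm_pair (p : Pol) (T U : Ty) :
    nrm p (.pair T U) = polDual p (.pair (nrm .pos T) (nrm .pos U)) := by rw [nrm]
theorem nrm_all (p : Pol) (κ : Kind) (T : Ty) :
    nrm p (.all κ T) = polDual p (.all κ (nrm .pos T)) := by rw [nrm]
theorem nrm_var (p : Pol) (i : ℕ) : nrm p (.var i) = polDual p (.var i) := by rw [nrm]
theorem nrm_proto (p : Pol) (ρ : Name) (n : ℕ) (U : Fin n → Ty) :
    nrm p (.proto ρ n U) = polDual p (.proto ρ n (fun i => nrm .pos (U i))) := by rw [nrm]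

/-- Normalization commutes with substitution, up to normalization of the result. -/
theorem Kinding.nrm_subst {m Δ T κ} (h : Kinding Sg m Δ T κ) : ∀ (p q : Pol) (σ : ℕ → Ty),
    (p = .pos ∧ q = .pos ∨ κ = .S) →
    nrm p ((nrm q T).subst σ) = nrm (p.mul q) (T.subst σ) := by
  induction h with
  | unit => intro p q σ _; rw [nrm_unit, polDual_subst, nrm_polDual]
  | arr _ _ ih₁ ih₂ =>
    intro p q σ _
    rw [nrm_arr, polDual_subst, nrm_polDual, Ty.subst, Ty.subst, nrm_arr, nrm_arr,
      ih₁ _ _ _ (.inl ⟨rfl, rfl⟩), ih₂ _ _ _ (.inl ⟨rfl, rfl⟩), Pol.pos_mul]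
  | pair _ _ ih₁ ih₂ =>
    intro p q σ _
    rw [nrm_pair, polDual_subst, nrm_polDual, Ty.subst, Ty.subst, nrm_pair, nrm_pair,
      ih₁ _ _ _ (.inl ⟨rfl, rfl⟩), ih₂ _ _ _ (.inl ⟨rfl, rfl⟩), Pol.pos_mul]
  | all _ ih =>
    intro p q σ _
    rw [nrm_all, polDual_subst, nrm_polDual, Ty.subst, Ty.subst, nrm_all, nrm_all,
      ih _ _ _ (.inl ⟨rfl, rfl⟩), Pol.pos_mul]
  | var => intro p q σ _; rw [nrm_var, polDual_subst, nrm_polDual]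
  | inn _ _ ih₁ ih₂ =>
    intro p q σ _
    rw [nrm_inn, nrm_mat_subst, nrm_dirOp_subst, ih₁ _ _ _ (.inl ⟨rfl, rfl⟩),
      ih₂ _ _ _ (.inr rfl), dirOp_dirOp, Ty.subst, nrm_inn, Pol.mul_flip, Pol.pos_mul]
  | out _ _ ih₁ ih₂ =>
    intro p q σ _
    rw [nrm_out, nrm_mat_subst, nrm_dirOp_subst, ih₁ _ _ _ (.inl ⟨rfl, rfl⟩),
      ih₂ _ _ _ (.inr rfl), dirOp_dirOp, Ty.subst, nrm_out, Pol.pos_mul]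
  | endW | endT => intro p q σ _; cases p <;> cases q <;> rfl
  | dual _ ih =>
    intro p q σ _
    rw [nrm_dual, ih _ _ _ (.inr rfl), Ty.subst, nrm_dual, Pol.mul_flip]
  | neg _ ih =>
    intro p q σ hpq
    -- A negation has kind `P`, so the side condition leaves only the positive polarities.
    obtain ⟨rfl, rfl⟩ : p = .pos ∧ q = .pos := by simpa using hpq
    rw [nrm_neg, nrm_dirOp_subst, ih _ _ _ (.inl ⟨rfl, rfl⟩), Ty.subst, Pol.pos_mul, nrm_neg]
  | proto _ _ ih =>
    intro p q σ _
    rw [nrm_proto, polDual_subst, nrm_polDual, Ty.subst, Ty.subst, nrm_proto, nrm_proto]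
    congr 2
    funext i
    rw [ih i _ _ _ (.inl ⟨rfl, rfl⟩), Pol.pos_mul]
  | sub _ hs ih =>
    intro p q σ hpq
    refine ih p q σ (hpq.imp_right ?_)
    rintro rfl
    exact hs.eq_S

theorem Kinding.nrm_nrm_subst {m Δ T κ} (h : Kinding Sg m Δ T κ) (σ : ℕ → Ty) :
    nrm .pos ((nrm .pos T).subst σ) = nrm .pos (T.subst σ) :=
  h.nrm_subst _ _ σ (.inl ⟨rfl, rfl⟩)

theorem Kinding.nrm_idem {m Δ T κ} (h : Kinding Sg m Δ T κ) :
    nrm .pos (nrm .pos T) = nrm .pos T := by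
  simpa only [subst_var] using h.nrm_nrm_subst Ty.var

/-- The case of the identity substitution at session kind; with both polarities negative it says
that duality is an involution on normal forms. -/
theorem Kinding.nrm_nrm {m Δ T} (h : Kinding Sg m Δ T .S) (p q : Pol) :
    nrm p (nrm q T) = nrm (p.mul q) T := by
  simpa only [subst_var] using h.nrm_subst p q Ty.var (.inr rfl)

theorem NonNeg.rename {T : Ty} (h : T.NonNeg) (ξ : ℕ → ℕ) : (T.rename ξ).NonNeg := by
  cases T <;> first | exact h.elim | trivial

theorem polDual_rename (p : Pol) (T : Ty) (ξ : ℕ → ℕ) :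
    (polDual p T).rename ξ = polDual p (T.rename ξ) := by
  cases p <;> rfl

theorem dirOp_rename (p : Pol) (T : Ty) (ξ : ℕ → ℕ) :
    (dirOp p T).rename ξ = dirOp p (T.rename ξ) := by
  induction T using Ty.neg_induction generalizing p with
  | base T h =>
    cases p with
    | pos => rw [dirOp_pos h, dirOp_pos (NonNeg.rename h ξ)]
    | neg => rw [dirOp_neg_of_nonNeg h, dirOp_neg_of_nonNeg (NonNeg.rename h ξ), Ty.rename]
  | neg T ih => rw [dirOp_neg, ih, Ty.rename, dirOp_neg]

theorem mat_rename (T S : Ty) (ξ : ℕ → ℕ) :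
    (mat T S).rename ξ = mat (T.rename ξ) (S.rename ξ) := by
  cases T <;> rfl

/-- Renamings send variables to variables and create neither signs nor duals; unlike for
substitutions, neither kinding nor a second normalization is needed. -/
theorem nrm_rename (T : Ty) : ∀ (p : Pol) (ξ : ℕ → ℕ),
    nrm p (T.rename ξ) = (nrm p T).rename ξ := by
  induction T with
  | inn _ _ ih₁ ih₂ =>
    intro p ξ; rw [Ty.rename, nrm_inn, nrm_inn, mat_rename, dirOp_rename, ih₁, ih₂]
  | out _ _ ih₁ ih₂ =>
    intro p ξ; rw [Ty.rename, nrm_out, nrm_out, mat_rename, dirOp_rename, ih₁, ih₂]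
  | dual _ ih => intro p ξ; rw [Ty.rename, nrm_dual, nrm_dual, ih]
  | endW | endT => intro p ξ; cases p <;> rfl
  | neg _ ih => intro p ξ; rw [Ty.rename, nrm_neg', nrm_neg', ih, polDual_rename, dirOp_rename]
  | _ =>
    intro p ξ
    simp_all [Ty.rename, nrm_unit, nrm_arr, nrm_pair, nrm_all, nrm_var, nrm_proto, polDual_rename]

theorem nrm_shift (p : Pol) (T : Ty) : nrm p T.shift = (nrm p T).shift := nrm_rename T p _

/-- Substitutions with the same normal forms yield types with the same normal form. -/
theorem Kinding.nrm_subst_congr {m Δ T κ} (h : Kinding Sg m Δ T κ) :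
    ∀ (p : Pol) (σ τ : ℕ → Ty), (p = .pos ∨ κ = .S) →
    (∀ (i : ℕ) κ (p : Pol), Δ[i]? = some κ → (p = .pos ∨ κ = .S) →
      nrm p (σ i) = nrm p (τ i)) →
    nrm p (T.subst σ) = nrm p (T.subst τ) := by
  induction h with
  | unit | endW | endT => intros; rfl
  | arr _ _ ih₁ ih₂ | pair _ _ ih₁ ih₂ =>
    intro p σ τ _ h
    rw [Ty.subst, Ty.subst, nrm, nrm, ih₁ _ _ _ (.inl rfl) h, ih₂ _ _ _ (.inl rfl) h]
  | all _ ih =>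
    intro p σ τ _ h
    rw [Ty.subst, Ty.subst, nrm, nrm, ih _ _ _ (.inl rfl)]
    intro i κ p hi hp
    cases i with
    | zero => rfl
    | succ i =>
      simp only [Ty.ups]
      rw [nrm_shift, nrm_shift, h i κ p hi hp]
  | var hi => intro p σ τ hp h; exact h _ _ _ hi hp
  | inn _ _ ih₁ ih₂ =>
    intro p σ τ _ h
    rw [Ty.subst, Ty.subst, nrm_inn, nrm_inn, ih₁ _ _ _ (.inl rfl) h, ih₂ _ _ _ (.inr rfl) h]
  | out _ _ ih₁ ih₂ =>
    intro p σ τ _ h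
    rw [Ty.subst, Ty.subst, nrm_out, nrm_out, ih₁ _ _ _ (.inl rfl) h, ih₂ _ _ _ (.inr rfl) h]
  | dual _ ih =>
    intro p σ τ _ h; rw [Ty.subst, Ty.subst, nrm_dual, nrm_dual, ih _ _ _ (.inr rfl) h]
  | neg _ ih => intro p σ τ _ h; rw [Ty.subst, Ty.subst, nrm, nrm, ih _ _ _ (.inl rfl) h]
  | proto _ _ ih =>
    intro p σ τ _ h
    rw [Ty.subst, Ty.subst, nrm_proto, nrm_proto]
    congr 2
    funext i
    exact ih i _ _ _ (.inl rfl) h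
  | sub _ hs ih =>
    intro p σ τ hp h
    refine ih p σ τ (hp.imp_right ?_) h
    rintro rfl
    exact hs.eq_S

theorem Kinding.dirOp {Δ T} (h : Kinding Sg .check Δ T .P) (p : Pol) :
    Kinding Sg .check Δ (dirOp p T) .P := by
  induction T using Ty.neg_induction generalizing p with
  | base T h' =>
    cases p with
    | pos => rwa [dirOp_pos h']
    | neg => rw [dirOp_neg_of_nonNeg h']; exact (Kinding.neg h).toCheck
  | neg T ih => rw [dirOp_neg]; exact ih h.neg_inv _

theorem Kinding.mat {Δ T S} (h : Kinding Sg .check Δ T .P) (h' : Kinding Sg .check Δ S .S) :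
    Kinding Sg .check Δ (mat T S) .S := by
  cases T with
  | neg T => exact (Kinding.inn h.neg_inv h').toCheck
  | _ => exact (Kinding.out h h').toCheck

/-- The negative polarity is admitted at session kind only: it may put a variable under `Dual`,
which requires kind `S`. Subsumption is harmless because `S` is its own only subkind. -/
theorem Kinding.nrm {m Δ T κ} (h : Kinding Sg m Δ T κ) : ∀ (p : Pol), (p = .pos ∨ κ = .S) →
    Kinding Sg .check Δ (nrm p T) κ := by
  have hT : ¬ Kind.T = Kind.S := by simp
  have hP : ¬ Kind.P = Kind.S := by simp
  induction h with
  | unit =>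
    intro p hp; obtain rfl := hp.resolve_right hT; exact Kinding.unit.toCheck
  | arr _ _ ih₁ ih₂ =>
    intro p hp; obtain rfl := hp.resolve_right hT
    exact (Kinding.arr (ih₁ _ (.inl rfl)) (ih₂ _ (.inl rfl))).toCheck
  | pair _ _ ih₁ ih₂ =>
    intro p hp; obtain rfl := hp.resolve_right hT
    exact (Kinding.pair (ih₁ _ (.inl rfl)) (ih₂ _ (.inl rfl))).toCheck
  | all _ ih =>
    intro p hp; obtain rfl := hp.resolve_right hT
    exact (Kinding.all (ih _ (.inl rfl))).toCheck
  | var hi =>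
    intro p hp
    cases p with
    | pos => exact (Kinding.var hi).toCheck
    | neg =>
      obtain rfl := hp.resolve_left (by simp)
      exact (Kinding.dual (Kinding.var hi).toCheck).toCheck
  | inn _ _ ih₁ ih₂ =>
    intro p _; rw [nrm_inn]; exact ((ih₁ _ (.inl rfl)).dirOp _).mat (ih₂ _ (.inr rfl))
  | out _ _ ih₁ ih₂ =>
    intro p _; rw [nrm_out]; exact ((ih₁ _ (.inl rfl)).dirOp _).mat (ih₂ _ (.inr rfl))
  | endW =>
    intro p _
    cases p
    · exact Kinding.endW.toCheck
    · exact Kinding.endT.toCheck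
  | endT =>
    intro p _
    cases p
    · exact Kinding.endT.toCheck
    · exact Kinding.endW.toCheck
  | dual _ ih => intro p _; rw [nrm_dual]; exact ih _ (.inr rfl)
  | neg _ ih =>
    intro p hp; obtain rfl := hp.resolve_right hP; rw [nrm_neg]; exact (ih _ (.inl rfl)).dirOp _
  | proto hρ _ ih =>
    intro p hp; obtain rfl := hp.resolve_right hP
    exact (Kinding.proto hρ (fun i => ih i _ (.inl rfl))).toCheck
  | sub _ hs ih =>
    intro p hp
    refine (ih p (hp.imp_right ?_)).weaken hs
    rintro rfl
    exact hs.eq_S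

theorem Kinding.nrm_pos {m Δ T κ} (h : Kinding Sg m Δ T κ) :
    Kinding Sg .check Δ (AlgST.nrm .pos T) κ :=
  h.nrm _ (.inl rfl)

/-! ### Materialization of sequences -/

/-- The outer polarity multiplies the sign of every element. In particular the dual of a sequence of
inputs is the same sequence with outputs, which later matches the two ends of a channel after a
choice. -/
theorem nrm_matSeq_subst (q p : Pol) (Ts : List Ty) (S : Ty) (σ : ℕ → Ty) :
    nrm q ((matSeq p Ts S).subst σ) =
      Ts.foldr (fun T R => mat (dirOp (q.mul p) (nrm .pos (T.subst σ))) R)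
        (nrm q (S.subst σ)) := by
  induction Ts with
  | nil => rfl
  | cons T Ts ih =>
    rw [List.foldr_cons, ← ih, matSeq, List.foldr_cons, nrm_mat_subst, nrm_dirOp_subst,
      dirOp_dirOp, matSeq]

theorem nrm_matSeq (q p : Pol) (Ts : List Ty) (S : Ty) :
    nrm q (matSeq p Ts S) =
      Ts.foldr (fun T R => mat (dirOp (q.mul p) (nrm .pos T)) R) (nrm q S) := by
  simpa only [subst_var] using nrm_matSeq_subst q p Ts S Ty.var

theorem Kinding.matSeq {Δ Ts S} (p : Pol) (h : ∀ T ∈ Ts, Kinding Sg .check Δ T .P)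
    (hS : Kinding Sg .check Δ S .S) : Kinding Sg .check Δ (matSeq p Ts S) .S := by
  induction Ts with
  | nil => exact hS
  | cons T Ts ih =>
    exact ((h T (by simp)).dirOp p).mat (ih (fun T hT => h T (by simp [hT])))

theorem foldr_mat_congr {α : Type*} {f g : α → Ty} {p : Pol} {l : List α} {S : Ty}
    (h : ∀ a ∈ l, f a = g a) :
    (l.map f).foldr (fun T R => mat (AlgST.dirOp p T) R) S =
      (l.map g).foldr (fun T R => mat (AlgST.dirOp p T) R) S := by
  rw [List.map_congr_left h]

theorem contTy_eq (p : Pol) (d : ProtoDecl) (k : Fin d.numCons) (U : Fin d.arity → Ty) (S : Ty) :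
    contTy p d k U S =
      ((d.args k).map (fun T => AlgST.nrm .pos (T.subst (params U)))).foldr
        (fun T R => AlgST.mat (AlgST.dirOp p T) R) (AlgST.nrm .pos S) := by
  rw [contTy, nrm_matSeq, List.foldr_map, List.foldr_map, Pol.pos_mul]

theorem KSubst.params {Δ n} {U : Fin n → Ty} (hU : ∀ i, Kinding Sg .check Δ (U i) .P) :
    KSubst Sg (List.replicate n .P) Δ (Ty.params U) := by
  intro i κ hi
  rw [List.getElem?_replicate] at hi
  split at hi
  · rename_i hlt
    cases hi
    rw [Ty.params, dif_pos hlt]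
    exact hU _
  · cases hi

theorem contTy_kinding (hSg : Sg.WF) {Δ ρ d} (hρ : Sg ρ = some d) (p : Pol) (k : Fin d.numCons)
    {U : Fin d.arity → Ty} {S : Ty} (hU : ∀ i, Kinding Sg .check Δ (U i) .P)
    (hS : Kinding Sg .check Δ S .S) :
    Kinding Sg .check Δ (AlgST.matSeq p ((d.args k).map (fun T => T.subst (Ty.params U))) S) .S := by
  refine Kinding.matSeq p ?_ hS
  intro T hT
  obtain ⟨T', hT', rfl⟩ := List.mem_map.1 hT
  exact ((hSg ρ d hρ).2.2 k T' hT').subst (KSubst.params hU)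

/-- A continuation type is determined by the normal forms of the parameters. -/
theorem foldr_args_congr (hSg : Sg.WF) {ρ d} (hρ : Sg ρ = some d) (p : Pol) (k : Fin d.numCons)
    {σ τ : ℕ → Ty} (h : ∀ i, i < d.arity → AlgST.nrm .pos (σ i) = AlgST.nrm .pos (τ i)) (S : Ty) :
    ((d.args k).map (fun T => AlgST.nrm .pos (T.subst σ))).foldr
        (fun T R => AlgST.mat (AlgST.dirOp p T) R) S =
      ((d.args k).map (fun T => AlgST.nrm .pos (T.subst τ))).foldr
        (fun T R => AlgST.mat (AlgST.dirOp p T) R) S := by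
  refine foldr_mat_congr ?_
  intro T hT
  refine ((hSg ρ d hρ).2.2 k T hT).nrm_subst_congr _ _ _ (.inl rfl) ?_
  intro i κ q hi hq
  rw [List.getElem?_replicate] at hi
  split at hi
  · rename_i hlt
    cases hi
    obtain rfl := hq.resolve_right (by simp)
    exact h i hlt
  · cases hi

/-- A continuation type depends on its parameters only through their normal forms, so it makes no
difference whether they are substituted and normalized before or after it is formed. The two
idempotence hypotheses stand in for kinding of the substituted components. -/
theorem contTy_subst (hSg : Sg.WF) {ρ d} (hρ : Sg ρ = some d) (p : Pol) (k : Fin d.numCons)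
    {Δ : List Kind} {U : Fin d.arity → Ty} {S : Ty} {σ : ℕ → Ty}
    (hU : ∀ i, Kinding Sg .check Δ (U i) .P) (hS : Kinding Sg .check Δ S .S)
    (hσU : ∀ i, AlgST.nrm .pos (AlgST.nrm .pos ((U i).subst σ)) = AlgST.nrm .pos ((U i).subst σ))
    (hσS : AlgST.nrm .pos (AlgST.nrm .pos (S.subst σ)) = AlgST.nrm .pos (S.subst σ)) :
    AlgST.nrm .pos ((contTy p d k U S).subst σ) =
      contTy p d k (fun i => AlgST.nrm .pos ((U i).subst σ)) (AlgST.nrm .pos (S.subst σ)) := by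
  rw [contTy, (contTy_kinding hSg hρ p k hU hS).nrm_nrm_subst, nrm_matSeq_subst, contTy_eq, hσS,
    Pol.pos_mul, List.foldr_map]
  simp only [subst_subst]
  rw [← foldr_args_congr hSg hρ p k (σ := fun i => (params U i).subst σ), List.foldr_map]
  intro i hi
  simp only [params, dif_pos hi, hσU]

end Kinding
end AlgST

namespace AlgST

open Ty

/-! ### Occurrences of free and bound variables -/

/-- Term variables: names and indices. -/
abbrev Var := Name ⊕ ℕ

/-- A variable, seen from under one more binder. -/
def Var.up : Var → Var
  | .inl x => .inl x
  | .inr i => .inr (i + 1)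

@[simp] theorem Var.up_inl (x : Name) : Var.up (.inl x) = .inl x := rfl
@[simp] theorem Var.up_inr (i : ℕ) : Var.up (.inr i) = .inr (i + 1) := rfl

theorem Var.up_injective : Function.Injective Var.up := by
  rintro (x | i) (y | j) h <;> simp_all

@[simp] theorem Var.up_eq_inr_succ (w : Var) (k : ℕ) : w.up = .inr (k + 1) ↔ w = .inr k :=
  Var.up_injective.eq_iff (b := .inr k)

@[simp] theorem Var.up_eq_inl (w : Var) (x : Name) : w.up = .inl x ↔ w = .inl x :=
  Var.up_injective.eq_iff (b := .inl x)

theorem Var.cases_up (w : Var) : w = .inr 0 ∨ ∃ w', w = Var.up w' := by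
  rcases w with x | i
  · exact .inr ⟨.inl x, rfl⟩
  · cases i with
    | zero => exact .inl rfl
    | succ i => exact .inr ⟨.inr i, rfl⟩

/-- `e.Occ w`: the variable `w` occurs free in `e`. -/
def Expr.Occ : Expr → Var → Prop
  | .const _, _ => False
  | .fvar x, w => w = .inl x
  | .bvar i, w => w = .inr i
  | .abs _ e, w => e.Occ w.up
  | .recf _ v, w => v.Occ w.up
  | .tabs _ v, w => v.Occ w
  | .pair e₁ e₂, w => e₁.Occ w ∨ e₂.Occ w
  | .app e₁ e₂, w => e₁.Occ w ∨ e₂.Occ w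
  | .tapp e _, w => e.Occ w
  | .letu e₁ e₂, w => e₁.Occ w ∨ e₂.Occ w
  | .letp e₁ e₂, w => e₁.Occ w ∨ e₂.Occ w.up.up
  | .mtch e _ _ b, w => e.Occ w ∨ ∃ i, (b i).Occ w.up

/-- Expressions without dangling indices. -/
def Expr.LC (e : Expr) : Prop := ∀ i, ¬ e.Occ (.inr i)

namespace Expr

theorem occ_inl (e : Expr) (x : Name) : e.Occ (.inl x) ↔ x ∈ e.fv := by
  induction e <;> simp_all [Occ, fv]

@[simp] theorem occ_tsubst (e : Expr) : ∀ (σ : ℕ → Ty) (w : Var),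
    (e.tsubst σ).Occ w ↔ e.Occ w := by
  induction e <;> intro σ w <;> simp_all [Occ, tsubst, -Sum.forall]

@[simp] theorem occ_tshift (e : Expr) (w : Var) : e.tshift.Occ w ↔ e.Occ w := occ_tsubst e _ w

theorem LC.tshift {e : Expr} (h : e.LC) : e.tshift.LC := fun i hi => h i ((occ_tshift _ _).1 hi)

theorem LC.occ_up {e : Expr} (h : e.LC) (w : Var) : e.Occ w.up ↔ e.Occ w := by
  rcases w with x | i
  · rfl
  · exact iff_of_false (h _) (h _)

theorem LC.fvar (x : Name) : (Expr.fvar x).LC := fun i h => by cases h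

/-- The variables of an expression with variables `P`, after the index `k` is replaced by `u`. -/
def OpenOcc (k : ℕ) (u : Expr) (P : Var → Prop) (w : Var) : Prop :=
  w ≠ .inr k ∧ P w ∨ P (.inr k) ∧ u.Occ w

/-- An exact description is needed rather than an inclusion: typing forbids some occurrences of
linear variables and demands others. -/
theorem occ_openAt (e : Expr) : ∀ (k : ℕ) (u : Expr), u.LC → ∀ w : Var,
    (e.openAt k u).Occ w ↔ OpenOcc k u e.Occ w := by
  induction e with
  | const c => intro k u hu w; simp [openAt, OpenOcc, Occ]
  | fvar x => intro k u hu w; simp only [openAt, OpenOcc, Occ]; aesop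
  | bvar i =>
    intro k u hu w
    simp only [openAt, OpenOcc, Occ]
    split
    · aesop
    · simp only [Occ]; aesop
  | abs T e ih | recf T e ih =>
    intro k u hu w
    simp only [openAt, Occ, ih _ u hu, OpenOcc, hu.occ_up, Var.up_inr, ne_eq, Var.up_eq_inr_succ]
  | tabs κ e ih =>
    intro k u hu w
    simp only [openAt, Occ, ih _ u.tshift hu.tshift, OpenOcc, occ_tshift]
  | pair e₁ e₂ ih₁ ih₂ | app e₁ e₂ ih₁ ih₂ | letu e₁ e₂ ih₁ ih₂ =>
    intro k u hu w
    simp only [openAt, Occ, ih₁ _ u hu, ih₂ _ u hu, OpenOcc]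
    tauto
  | tapp e T ih => intro k u hu w; simp only [openAt, Occ, ih _ u hu, OpenOcc]
  | letp e₁ e₂ ih₁ ih₂ =>
    intro k u hu w
    simp only [openAt, Occ, ih₁ _ u hu, ih₂ _ u hu, OpenOcc, hu.occ_up, Var.up_inr, ne_eq,
      Var.up_eq_inr_succ]
    tauto
  | mtch e n C b ih ihb =>
    intro k u hu w
    simp only [openAt, Occ, ih _ u hu, fun i => ihb i (k + 1) u hu, OpenOcc, hu.occ_up,
      Var.up_inr, ne_eq, Var.up_eq_inr_succ]
    constructor
    · rintro (h | ⟨i, h | h⟩)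
      · tauto
      · exact .inl ⟨h.1, .inr ⟨i, h.2⟩⟩
      · exact .inr ⟨.inr ⟨i, h.1⟩, h.2⟩
    · rintro (⟨h, h' | ⟨i, h'⟩⟩ | ⟨h' | ⟨i, h'⟩, h⟩)
      · tauto
      · exact .inr ⟨i, .inl ⟨h, h'⟩⟩
      · tauto
      · exact .inr ⟨i, .inr ⟨h', h⟩⟩

end Expr

/-! ### Stability and reflection of values under substitution and opening. -/

theorem IsSelect.tsubst {C e} (h : IsSelect C e) (σ : ℕ → Ty) : IsSelect C (e.tsubst σ) := by
  induction h with
  | base => exact .base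
  | tapp _ ih => exact .tapp ih

theorem IsValue.tsubst {v} (h : IsValue v) : ∀ σ : ℕ → Ty, IsValue (v.tsubst σ) := by
  induction h with
  | recf _ ih => intro σ; exact .recf (ih σ)
  | tabs _ ih => intro σ; exact .tabs (ih _)
  | pair _ _ ih₁ ih₂ => intro σ; exact .pair (ih₁ σ) (ih₂ σ)
  | send3 _ ih => intro σ; exact .send3 (ih σ)
  | select h => intro σ; exact .select (h.tsubst σ)
  | _ => intro σ; constructor

theorem IsSelect.openAt {C e} (h : IsSelect C e) (k : ℕ) (u : Expr) :
    IsSelect C (e.openAt k u) := by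
  induction h with
  | base => exact .base
  | tapp _ ih => exact .tapp ih

theorem IsValue.openAt {v} (h : IsValue v) : ∀ (k : ℕ) {u : Expr}, IsValue u →
    IsValue (v.openAt k u) := by
  induction h with
  | bvar =>
    intro k u hu
    rw [Expr.openAt]
    split
    · exact hu
    · exact .bvar
  | recf _ ih => intro k u hu; exact .recf (ih _ hu)
  | tabs _ ih => intro k u hu; exact .tabs (ih _ (hu.tsubst _))
  | pair _ _ ih₁ ih₂ => intro k u hu; exact .pair (ih₁ _ hu) (ih₂ _ hu)
  | send3 _ ih => intro k u hu; exact .send3 (ih _ hu)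
  | select h => intro k u hu; exact .select (h.openAt k u)
  | _ => intro k u hu; constructor

theorem IsSelect.of_openAt {C : Name} {x : Name} {k : ℕ} : ∀ {e : Expr},
    IsSelect C (e.openAt k (.fvar x)) → IsSelect C e := by
  intro e
  induction e with
  | const c => intro h; exact h
  | tapp e T ih => intro h; cases h with | tapp h => exact .tapp (ih h)
  | bvar i =>
    intro h
    rw [Expr.openAt] at h
    split at h <;> cases h
  | _ => intro h; cases h

theorem Expr.openAt_fvar_eq_const {e : Expr} {k x c} (h : e.openAt k (.fvar x) = .const c) :
    e = .const c := by
  cases e <;> simp only [Expr.openAt] at h <;> first | exact h | (split at h <;> cases h) | cases h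

/-- Opening with a name cannot create values: a bound variable is a value already, and the constants
that head the partial applications among the values cannot arise from a name. -/
theorem IsValue.of_openAt {x : Name} : ∀ {e : Expr} {k : ℕ},
    IsValue (e.openAt k (.fvar x)) → IsValue e := by
  intro e
  induction e with
  | const => intros; exact .const
  | fvar => intros; exact .fvar
  | bvar => intros; exact .bvar
  | abs => intros; exact .abs
  | recf T v ih =>
    intro k h
    cases h with
    | recf h => exact .recf (ih h)
    | select h => cases h
  | tabs κ v ih =>
    intro k h
    cases h with
    | tabs h => exact .tabs (ih h)
    | select h => cases h
  | pair e₁ e₂ ih₁ ih₂ =>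
    intro k h
    cases h with
    | pair h₁ h₂ => exact .pair (ih₁ h₁) (ih₂ h₂)
    | select h => cases h
  | app e₁ e₂ ih₁ ih₂ =>
    intro k h
    generalize he : (Expr.app e₁ e₂).openAt k (.fvar x) = e at h
    cases h with
    | send3 h =>
      rw [Expr.openAt] at he
      obtain ⟨he₁, rfl⟩ := Expr.app.inj he
      cases e₁ with
      | tapp e₁ T =>
        obtain ⟨he₁, _⟩ := Expr.tapp.inj he₁
        cases e₁ with
        | tapp e₁ T' =>
          obtain ⟨he₁, _⟩ := Expr.tapp.inj he₁
          cases Expr.openAt_fvar_eq_const he₁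
          exact .send3 (ih₂ h)
        | bvar => rw [Expr.openAt] at he₁; split at he₁ <;> cases he₁
        | _ => cases he₁
      | bvar => rw [Expr.openAt] at he₁; split at he₁ <;> cases he₁
      | _ => cases he₁
    | select h => subst he; cases h
    | _ => cases he
  | tapp e T ih =>
    intro k h
    generalize he : (Expr.tapp e T).openAt k (.fvar x) = e' at h
    cases h with
    | receive1 =>
      obtain ⟨he₁, _⟩ := Expr.tapp.inj he
      cases Expr.openAt_fvar_eq_const he₁
      exact .receive1
    | send1 =>
      obtain ⟨he₁, _⟩ := Expr.tapp.inj he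
      cases Expr.openAt_fvar_eq_const he₁
      exact .send1
    | receive2 | send2 =>
      obtain ⟨he₁, _⟩ := Expr.tapp.inj he
      cases e with
      | tapp e T' =>
        obtain ⟨he₁, _⟩ := Expr.tapp.inj he₁
        cases Expr.openAt_fvar_eq_const he₁
        constructor
      | bvar => rw [Expr.openAt] at he₁; split at he₁ <;> cases he₁
      | _ => cases he₁
    | select h => subst he; exact .select (IsSelect.of_openAt h)
    | _ => cases he
  | letu | letp | mtch =>
    intro k h
    cases h with | select h => cases h

/-! ### Environments -/

/-- Typing environments, for names and indices. -/
abbrev Env := Var → Mult → Ty → Prop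

namespace Env

/-- The environment under a binder of a variable. -/
def push (m : Mult) (A : Ty) (E : Env) : Env
  | .inl x => E (.inl x)
  | .inr 0 => fun m' T => m' = m ∧ T = A
  | .inr (i + 1) => E (.inr i)

/-- Apply an operation to all types of an environment. -/
def map (f : Ty → Ty) (E : Env) : Env := fun w m T => ∃ T₀, E w m T₀ ∧ T = f T₀

/-- The linear variables. -/
def Lin (E : Env) (w : Var) : Prop := ∃ T, E w .lin T

@[simp] theorem push_up (m A) (E : Env) (w : Var) : E.push m A w.up = E w := by
  cases w <;> rfl

@[simp] theorem lin_push_up (m A) (E : Env) (w : Var) : (E.push m A).Lin w.up ↔ E.Lin w := by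
  rw [Lin, push_up]; rfl

@[simp] theorem lin_map (f) (E : Env) (w : Var) : (E.map f).Lin w ↔ E.Lin w := by
  simp only [Lin, map]
  exact ⟨fun ⟨_, T, h, _⟩ => ⟨T, h⟩, fun ⟨T, h⟩ => ⟨_, T, h, rfl⟩⟩

theorem map_push (f m A) (E : Env) : (E.push m A).map f = (E.map f).push m (f A) := by
  funext w m' T
  rcases Var.cases_up w with rfl | ⟨w, rfl⟩
  · simp [map, push]
  · simp only [map, push_up]

theorem map_map (f g) (E : Env) : (E.map f).map g = E.map (fun T => g (f T)) := by
  funext w m T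
  simp only [map, eq_iff_iff]
  constructor
  · rintro ⟨_, ⟨T₀, h, rfl⟩, rfl⟩; exact ⟨_, h, rfl⟩
  · rintro ⟨T₀, h, rfl⟩; exact ⟨_, ⟨_, h, rfl⟩, rfl⟩

theorem map_congr {E E' : Env} {w : Var} (f) (h : E w = E' w) : E.map f w = E'.map f w := by
  funext m T; simp only [map, h]

theorem lin_congr {E E' : Env} {w : Var} (h : E w = E' w) : E.Lin w ↔ E'.Lin w := by
  rw [Lin, h]; rfl

theorem push_congr {E E' : Env} {m A} {P : Var → Prop} (h : ∀ w, P w.up → E w = E' w) (w : Var)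
    (hw : P w) : E.push m A w = E'.push m A w := by
  rcases Var.cases_up w with rfl | ⟨w, rfl⟩
  · rfl
  · rw [push_up, push_up, h w hw]

end Env

/-! ### Declarative typing -/

/-- Typing without output contexts: linearity is expressed by conditions on occurrences. Bound
variables are typed by the indices of the environment. -/
inductive Decl (Sg : Sig) : List Kind → Env → Expr → Ty → Prop
  | const {Δ E c T} : TypeOf Sg c T → Decl Sg Δ E (.const c) T
  | fvar {Δ} {E : Env} {x m T} : E (.inl x) m T → Kinding Sg .check Δ T .T →
      Decl Sg Δ E (.fvar x) T
  | bvar {Δ} {E : Env} {i m T} : E (.inr i) m T → Kinding Sg .check Δ T .T →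
      Decl Sg Δ E (.bvar i) T
  | letu {Δ E e₁ e₂ T} : Decl Sg Δ E e₁ .unit → Decl Sg Δ E e₂ T →
      (∀ w, E.Lin w → e₁.Occ w → ¬ e₂.Occ w) → Decl Sg Δ E (.letu e₁ e₂) T
  | abs {Δ E T e U} : Kinding Sg .check Δ T .T → Decl Sg Δ (E.push .lin (nrm .pos T)) e U →
      e.Occ (.inr 0) → Decl Sg Δ E (.abs T e) (.arr (nrm .pos T) U)
  | app {Δ E e₁ e₂ T U} : Decl Sg Δ E e₁ (.arr T U) → Decl Sg Δ E e₂ T →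
      (∀ w, E.Lin w → e₁.Occ w → ¬ e₂.Occ w) → Decl Sg Δ E (.app e₁ e₂) U
  | pair {Δ E e₁ e₂ T U} : Decl Sg Δ E e₁ T → Decl Sg Δ E e₂ U →
      (∀ w, E.Lin w → e₁.Occ w → ¬ e₂.Occ w) → Decl Sg Δ E (.pair e₁ e₂) (.pair T U)
  | recf {Δ E T U v} : IsValue v → Kinding Sg .check Δ (.arr T U) .T →
      Decl Sg Δ (E.push .un (nrm .pos (.arr T U))) v (nrm .pos (.arr T U)) →
      (∀ w, E.Lin w → ¬ v.Occ w.up) →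
      Decl Sg Δ E (.recf (.arr T U) v) (nrm .pos (.arr T U))
  | tabs {Δ E κ v T} : IsValue v → Decl Sg (κ :: Δ) (E.map Ty.shift) v T →
      Decl Sg Δ E (.tabs κ v) (.all κ T)
  | tapp {Δ E e κ U T} : Decl Sg Δ E e (.all κ U) → Kinding Sg .check Δ T κ →
      Decl Sg Δ E (.tapp e T) (nrm .pos (U.inst T))
  | letp {Δ E e₁ e₂ T U V} : Decl Sg Δ E e₁ (.pair T U) →
      Decl Sg Δ ((E.push .lin (nrm .pos T)).push .lin (nrm .pos U)) e₂ V →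
      e₂.Occ (.inr 0) → e₂.Occ (.inr 1) →
      (∀ w, E.Lin w → e₁.Occ w → ¬ e₂.Occ w.up.up) → Decl Sg Δ E (.letp e₁ e₂) V
  | mtch {Δ E ρ d} {U : Fin d.arity → Ty} {S V e n} {C : Fin n → Name} {b : Fin n → Expr}
      (π : Fin n ≃ Fin d.numCons) : Sg ρ = some d → (∀ i, C i = d.con (π i)) →
      Decl Sg Δ E e (.inn (.proto ρ d.arity U) S) →
      (∀ i, Decl Sg Δ (E.push .lin (contTy .neg d (π i) U S)) (b i) V) →
      (∀ i, (b i).Occ (.inr 0)) →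
      (∀ i j w, E.Lin w → (b i).Occ w.up → (b j).Occ w.up) →
      (∀ i w, E.Lin w → e.Occ w → ¬ (b i).Occ w.up) → Decl Sg Δ E (.mtch e n C b) V

section Decl

variable {Sg : Sig}

/-- Typing looks at the environment only at variables that occur. This one fact does the work of
weakening, strengthening and exchange. -/
theorem Decl.congr {Δ E e T} (h : Decl Sg Δ E e T) : ∀ {E' : Env},
    (∀ w, e.Occ w → E w = E' w) → Decl Sg Δ E' e T := by
  induction h with
  | const h => intros; exact .const h
  | fvar h hk => intro E' h'; exact .fvar (by rwa [← h' _ rfl]) hk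
  | bvar h hk => intro E' h'; exact .bvar (by rwa [← h' _ rfl]) hk
  | letu _ _ hs ih₁ ih₂ =>
    intro E' h
    exact .letu (ih₁ fun w hw => h w (.inl hw)) (ih₂ fun w hw => h w (.inr hw))
      fun w hl h₁ => hs w ((Env.lin_congr (h w (.inl h₁))).2 hl) h₁
  | abs hk _ ho ih => intro E' h; exact .abs hk (ih (Env.push_congr h)) ho
  | app _ _ hs ih₁ ih₂ =>
    intro E' h
    exact .app (ih₁ fun w hw => h w (.inl hw)) (ih₂ fun w hw => h w (.inr hw))
      fun w hl h₁ => hs w ((Env.lin_congr (h w (.inl h₁))).2 hl) h₁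
  | pair _ _ hs ih₁ ih₂ =>
    intro E' h
    exact .pair (ih₁ fun w hw => h w (.inl hw)) (ih₂ fun w hw => h w (.inr hw))
      fun w hl h₁ => hs w ((Env.lin_congr (h w (.inl h₁))).2 hl) h₁
  | recf hv hk _ hn ih =>
    intro E' h
    exact .recf hv hk (ih (Env.push_congr h))
      fun w hl ho => hn w ((Env.lin_congr (h w ho)).2 hl) ho
  | tabs hv _ ih => intro E' h; exact .tabs hv (ih fun w hw => Env.map_congr _ (h w hw))
  | tapp _ hk ih => intro E' h; exact .tapp (ih h) hk
  | letp _ _ h0 h1 hs ih₁ ih₂ =>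
    intro E' h
    refine .letp (ih₁ fun w hw => h w (.inl hw)) (ih₂ ?_) h0 h1
      fun w hl h₁ => hs w ((Env.lin_congr (h w (.inl h₁))).2 hl) h₁
    exact Env.push_congr (Env.push_congr (P := fun w => Expr.Occ _ w.up)
      fun w hw => h w (.inr hw))
  | mtch π hρ hC _ _ h0 hc hs ih ihb =>
    intro E' h
    exact .mtch π hρ hC (ih fun w hw => h w (.inl hw))
      (fun i => ihb i (Env.push_congr fun w hw => h w (.inr ⟨i, hw⟩))) h0
      (fun i j w hl ho => hc i j w ((Env.lin_congr (h w (.inr ⟨i, ho⟩))).2 hl) ho)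
      (fun i w hl h₁ => hs i w ((Env.lin_congr (h w (.inl h₁))).2 hl) h₁)

/-- Values in labels are typed without type variables, but may be received under some Δ. Appending
at the outer end keeps the indices, so the environment is not shifted. -/
theorem Decl.extend {Δ E e T} (h : Decl Sg Δ E e T) (Δ' : List Kind) :
    Decl Sg (Δ ++ Δ') E e T := by
  induction h with
  | const h => exact .const h
  | fvar h hk => exact .fvar h (hk.extend Δ')
  | bvar h hk => exact .bvar h (hk.extend Δ')
  | letu _ _ hs ih₁ ih₂ => exact .letu ih₁ ih₂ hs
  | abs hk _ ho ih => exact .abs (hk.extend Δ') ih ho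
  | app _ _ hs ih₁ ih₂ => exact .app ih₁ ih₂ hs
  | pair _ _ hs ih₁ ih₂ => exact .pair ih₁ ih₂ hs
  | recf hv hk _ hn ih => exact .recf hv (hk.extend Δ') ih hn
  | tabs hv _ ih => exact .tabs hv ih
  | tapp _ hk ih => exact .tapp ih (hk.extend Δ')
  | letp _ _ h0 h1 hs ih₁ ih₂ => exact .letp ih₁ ih₂ h0 h1 hs
  | mtch π hρ hC _ _ h0 hc hs ih ihb => exact .mtch π hρ hC ih ihb h0 hc hs

/-! ### Types of constants and of expressions -/

theorem Kinding.allP {n Δ T} (h : Kinding Sg .check (List.replicate n .P ++ Δ) T .T) :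
    Kinding Sg .check Δ (allP n T) .T := by
  induction n generalizing Δ with
  | zero => exact h
  | succ n ih =>
    refine (Kinding.all (ih ?_)).toCheck
    rw [List.replicate_succ'] at h
    simpa using h

/-- The body of the type of `select Cₖ`. -/
def selectBody (ρ : Name) (d : ProtoDecl) (k : Fin d.numCons) : Ty :=
  .arr (.out (.proto ρ d.arity (fun j => .var (d.arity - j))) (.var 0))
    (matSeq .pos ((d.args k).map (fun T => T.subst (fun j => .var (d.arity - j)))) (.var 0))

/-- Index 0 is the continuation variable of kind `S`, and the indices from 1 to the arity are the
parameters; for j below the arity, `d.arity - j` stays in that range. -/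
theorem selectBody_kinding (hSg : Sg.WF) {ρ d} (hρ : Sg ρ = some d) (k : Fin d.numCons) :
    Kinding Sg .check (.S :: List.replicate d.arity .P) (selectBody ρ d k) .T := by
  have hv : ∀ j < d.arity,
      Kinding Sg .check (.S :: List.replicate d.arity .P) (.var (d.arity - j)) .P := by
    intro j hj
    refine Kinding.toCheck (.var ?_)
    obtain ⟨i, hi⟩ : ∃ i, d.arity - j = i + 1 := ⟨d.arity - j - 1, by omega⟩
    rw [hi, List.getElem?_cons_succ, List.getElem?_replicate, if_pos (by omega)]
  have h0 : Kinding Sg .check (.S :: List.replicate d.arity .P) (.var 0) .S :=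
    Kinding.toCheck (.var rfl)
  refine (Kinding.arr ((Kinding.out ?_ h0).toCheck.weaken (Kind.Sub.ofS _)) ?_).toCheck
  · exact (Kinding.proto hρ fun j => hv j j.2).toCheck
  · refine (Kinding.matSeq _ ?_ h0).weaken (Kind.Sub.ofS _)
    intro T' hT'
    obtain ⟨T, hT, rfl⟩ := List.mem_map.1 hT'
    refine ((hSg ρ d hρ).2.2 k T hT).subst ?_
    intro i κ hi
    rw [List.getElem?_replicate] at hi
    split at hi
    · cases hi; exact hv i ‹_›
    · cases hi

theorem TypeOf.kinding (hSg : Sg.WF) {c T} (h : TypeOf Sg c T) : Kinding Sg .check [] T .T := by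
  have hS : ∀ {Δ T}, Kinding Sg .check Δ T .S → Kinding Sg .check Δ T .T :=
    fun h => h.weaken (Kind.Sub.ofS _)
  have hP : ∀ {Δ T}, Kinding Sg .check Δ T .T → Kinding Sg .check Δ T .P :=
    fun h => h.weaken (Kind.Sub.toP _)
  cases h with
  | unit => exact Kinding.unit.toCheck
  | fork =>
    exact (Kinding.arr (Kinding.arr Kinding.unit.toCheck Kinding.unit.toCheck).toCheck
      Kinding.unit.toCheck).toCheck
  | new =>
    have h0 : Kinding Sg .check [.S] (.var 0) .S := Kinding.toCheck (.var rfl)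
    exact (Kinding.all (Kinding.pair (hS h0) (hS (Kinding.dual h0).toCheck)).toCheck).toCheck
  | receive =>
    have h0 : Kinding Sg .check [.S, .T] (.var 0) .S := Kinding.toCheck (.var rfl)
    have h1 : Kinding Sg .check [.S, .T] (.var 1) .T := Kinding.toCheck (.var rfl)
    exact (Kinding.all (Kinding.all (Kinding.arr (hS (Kinding.inn (hP h1) h0).toCheck)
      (Kinding.pair h1 (hS h0)).toCheck).toCheck).toCheck).toCheck
  | send =>
    have h0 : Kinding Sg .check [.S, .T] (.var 0) .S := Kinding.toCheck (.var rfl)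
    have h1 : Kinding Sg .check [.S, .T] (.var 1) .T := Kinding.toCheck (.var rfl)
    exact (Kinding.all (Kinding.all (Kinding.arr h1
      (Kinding.arr (hS (Kinding.out (hP h1) h0).toCheck) (hS h0)).toCheck).toCheck).toCheck).toCheck
  | wait => exact (Kinding.arr (hS Kinding.endW.toCheck) Kinding.unit.toCheck).toCheck
  | terminate => exact (Kinding.arr (hS Kinding.endT.toCheck) Kinding.unit.toCheck).toCheck
  | select hρ k =>
    refine Kinding.nrm_pos (Kinding.allP ?_)
    rw [List.append_nil]
    exact (Kinding.all (selectBody_kinding hSg hρ k)).toCheck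

theorem TypeOf.normal (hSg : Sg.WF) {c T} (h : TypeOf Sg c T) : nrm .pos T = T := by
  cases h with
  | select hρ k =>
    refine Kinding.nrm_idem (Sg := Sg) (m := .check) (Δ := []) (κ := .T) (Kinding.allP ?_)
    rw [List.append_nil]
    exact (Kinding.all (selectBody_kinding hSg hρ k)).toCheck
  | _ => rfl

/-- Synthesized types are well-formed. -/
theorem Decl.kinding (hSg : Sg.WF) {Δ E e T} (h : Decl Sg Δ E e T) :
    Kinding Sg .check Δ T .T := by
  induction h with
  | const h => exact (h.kinding hSg).extend _
  | fvar _ hk => exact hk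
  | bvar _ hk => exact hk
  | letu _ _ _ _ ih => exact ih
  | abs hk _ _ ih => exact (Kinding.arr hk.nrm_pos ih).toCheck
  | app _ _ _ ih _ => exact ih.arr_inv.2
  | pair _ _ _ ih₁ ih₂ => exact (Kinding.pair ih₁ ih₂).toCheck
  | recf _ hk => exact hk.nrm_pos
  | tabs _ _ ih => exact (Kinding.all ih).toCheck
  | tapp _ hk ih => exact (ih.all_inv.inst hk).nrm_pos
  | letp _ _ _ _ _ _ ih => exact ih
  -- A declaration has at least one constructor, so there is a branch from which to read the result
  -- type.
  | mtch π hρ _ _ _ _ _ _ _ ih => exact ih (π.symm ⟨0, (hSg _ _ hρ).1⟩)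

/-- The variables that occur in `e` have types in normal form. -/
def NormalOn (E : Env) (P : Var → Prop) : Prop := ∀ w m T, P w → E w m T → nrm .pos T = T

theorem NormalOn.push {E : Env} {P : Var → Prop} {m A} (h : NormalOn E fun w => P w.up)
    (hA : nrm .pos A = A) : NormalOn (E.push m A) P := by
  intro w m' T hP hw
  rcases Var.cases_up w with rfl | ⟨w, rfl⟩
  · rw [hw.2, hA]
  · rw [Env.push_up] at hw
    exact h w m' T hP hw

theorem NormalOn.shift {E : Env} {P : Var → Prop} (h : NormalOn E P) :
    NormalOn (E.map Ty.shift) P := by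
  rintro w m _ hP ⟨T, hw, rfl⟩
  rw [nrm_shift, h w m T hP hw]

theorem NormalOn.mono {E : Env} {P Q : Var → Prop} (h : NormalOn E P) (hQ : ∀ w, Q w → P w) :
    NormalOn E Q :=
  fun w m T hw => h w m T (hQ w hw)

theorem nrm_arr_iff {T U : Ty} :
    nrm .pos (.arr T U) = .arr T U ↔ nrm .pos T = T ∧ nrm .pos U = U := by
  rw [nrm_arr, polDual, Ty.arr.injEq]

theorem nrm_pair_iff {T U : Ty} :
    nrm .pos (.pair T U) = .pair T U ↔ nrm .pos T = T ∧ nrm .pos U = U := by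
  rw [nrm_pair, polDual, Ty.pair.injEq]

theorem contTy_normal (hSg : Sg.WF) {Δ ρ d} (hρ : Sg ρ = some d) (p : Pol) (k : Fin d.numCons)
    {U : Fin d.arity → Ty} {S : Ty} (hU : ∀ i, Kinding Sg .check Δ (U i) .P)
    (hS : Kinding Sg .check Δ S .S) : nrm .pos (contTy p d k U S) = contTy p d k U S :=
  (contTy_kinding hSg hρ p k hU hS).nrm_idem

/-- Each rule normalizes the types that it introduces, so a type that is not normal could only come
from a variable; the hypothesis concerns just those that occur. -/
theorem Decl.normal (hSg : Sg.WF) {Δ E e T} (h : Decl Sg Δ E e T) :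
    NormalOn E e.Occ → nrm .pos T = T := by
  induction h with
  | const h => intro _; exact h.normal hSg
  | fvar hw _ => intro h; exact h _ _ _ rfl hw
  | bvar hw _ => intro h; exact h _ _ _ rfl hw
  | letu _ _ _ _ ih => intro h; exact ih (h.mono fun _ => .inr)
  | abs hk _ _ ih =>
    intro h
    exact nrm_arr_iff.2 ⟨hk.nrm_idem, ih (NormalOn.push h hk.nrm_idem)⟩
  | app _ _ _ ih _ => intro h; exact (nrm_arr_iff.1 (ih (h.mono fun _ => .inl))).2
  | pair _ _ _ ih₁ ih₂ =>
    intro h; exact nrm_pair_iff.2 ⟨ih₁ (h.mono fun _ => .inl), ih₂ (h.mono fun _ => .inr)⟩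
  | recf _ hk => intro _; exact hk.nrm_idem
  | tabs _ _ ih => intro h; rw [nrm_all, polDual, ih h.shift]
  | tapp h hk ih => intro _; exact ((h.kinding hSg).all_inv.inst hk).nrm_idem
  | letp h₁ _ _ _ _ _ ih =>
    intro h
    have hk := (h₁.kinding hSg).pair_inv
    refine ih (NormalOn.push (NormalOn.push (P := fun w => Expr.Occ _ w.up)
      (h.mono fun _ => .inr) hk.1.nrm_idem) hk.2.nrm_idem)
  | mtch π hρ _ he _ _ _ _ _ ih =>
    intro h
    have hk := (he.kinding hSg).inn_inv
    exact ih (π.symm ⟨0, (hSg _ _ hρ).1⟩) (NormalOn.push (h.mono fun _ hw => .inr ⟨_, hw⟩)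
      (contTy_normal hSg hρ _ _ (Kinding.proto_inv hρ hk.1) hk.2))

/-! ### Substitution of types -/

/-- Substitution can destroy normal forms, so the environment and the synthesized type are
normalized again. The normalizations inside the rules are absorbed by `Kinding.nrm_nrm_subst`. -/
theorem Decl.tsubst (hSg : Sg.WF) {Δ E e T} (h : Decl Sg Δ E e T) :
    ∀ {Δ' : List Kind} {σ : ℕ → Ty}, KSubst Sg Δ Δ' σ →
    Decl Sg Δ' (E.map fun T => nrm .pos (T.subst σ)) (e.tsubst σ) (nrm .pos (T.subst σ)) := by
  induction h with
  | const h =>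
    intro Δ' σ _
    -- Types of constants are closed and normal, so neither the substitution nor the normalization
    -- affects them.
    rw [(h.kinding hSg).subst_closed, h.normal hSg]
    exact .const h
  | fvar h hk => intro Δ' σ hσ; exact .fvar ⟨_, h, rfl⟩ (hk.subst hσ).nrm_pos
  | bvar h hk => intro Δ' σ hσ; exact .bvar ⟨_, h, rfl⟩ (hk.subst hσ).nrm_pos
  | letu _ _ hs ih₁ ih₂ =>
    intro Δ' σ hσ
    refine .letu (ih₁ hσ) (ih₂ hσ) ?_
    simpa using hs
  | abs hk _ ho ih =>
    intro Δ' σ hσ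
    have := ih hσ
    rw [Env.map_push, hk.nrm_nrm_subst] at this
    rw [Ty.subst, nrm_arr, polDual, hk.nrm_nrm_subst]
    exact .abs (hk.subst hσ) this (by simpa using ho)
  | app _ _ hs ih₁ ih₂ =>
    intro Δ' σ hσ
    refine .app ?_ (ih₂ hσ) ?_
    · have := ih₁ hσ
      rwa [Ty.subst, nrm_arr] at this
    · simpa using hs
  | pair _ _ hs ih₁ ih₂ =>
    intro Δ' σ hσ
    rw [Ty.subst, nrm_pair]
    refine .pair (ih₁ hσ) (ih₂ hσ) ?_
    simpa using hs
  | recf hv hk _ hn ih =>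
    intro Δ' σ hσ
    have := ih hσ
    rw [Env.map_push, hk.nrm_nrm_subst] at this
    rw [hk.nrm_nrm_subst]
    exact .recf (hv.tsubst σ) (hk.subst hσ) this (by simpa using hn)
  | tabs hv _ ih =>
    intro Δ' σ hσ
    rw [Ty.subst, nrm_all]
    refine .tabs (hv.tsubst _) ?_
    have := ih (hσ.ups _)
    rw [Env.map_map] at this ⊢
    simpa only [shift_subst_ups, nrm_shift] using this
  | tapp h hk ih =>
    intro Δ' σ hσ
    have hU := (h.kinding hSg).all_inv
    have h' := ih hσ
    rw [Ty.subst, nrm_all] at h'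
    have := Decl.tapp h' (hk.subst hσ)
    -- The rule yields the normal form of N(Uσ) instantiated with Tσ. Dropping the inner
    -- normalization, exchanging instantiation with σ, and inserting a normalization of U[T] gives
    -- the required type.
    rwa [Ty.inst, (hU.subst (hσ.ups _)).nrm_nrm_subst, ← Ty.inst, ← inst_subst,
      ← (hU.inst hk).nrm_nrm_subst] at this
  | letp h₁ _ h0 h1 hs ih₁ ih₂ =>
    intro Δ' σ hσ
    have hk := (h₁.kinding hSg).pair_inv
    have h₁' := ih₁ hσ
    have h₂' := ih₂ hσ
    rw [Ty.subst, nrm_pair] at h₁'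
    -- The component types of the substituted pair are already normal, and the rule normalizes them
    -- once more; idempotence is used backwards to match.
    rw [Env.map_push, Env.map_push, hk.1.nrm_nrm_subst, hk.2.nrm_nrm_subst,
      ← (hk.1.subst hσ).nrm_idem, ← (hk.2.subst hσ).nrm_idem] at h₂'
    exact .letp h₁' h₂' (by simpa using h0) (by simpa using h1) (by simpa using hs)
  | mtch π hρ hC he _ h0 hc hs ih ihb =>
    intro Δ' σ hσ
    have hk := (he.kinding hSg).inn_inv
    have hU := Kinding.proto_inv hρ hk.1
    have he' := ih hσ
    have hb' := fun i => ihb i hσ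
    rw [Ty.subst, nrm_inn, Ty.subst, nrm_proto, polDual, Pol.flip_pos,
      dirOp_neg_of_nonNeg (by trivial), mat] at he'
    simp only [Env.map_push] at hb'
    refine .mtch π hρ hC he' ?_ (by simpa using h0) (by simpa using hc) (by simpa using hs)
    intro i
    have := hb' i
    rwa [contTy_subst hSg hρ _ _ hU hk.2 (fun i => ((hU i).subst hσ).nrm_idem)
      (hk.2.subst hσ).nrm_idem] at this

end Decl

end AlgST

namespace AlgST

open Ty AlgST.Expr

section Decl

variable {Sg : Sig}

/-! ### Substitution of values for bound variables -/

/-- `u` is a closed value for a variable `m A` in the environment `G`. -/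
structure Subst (Sg : Sig) (Δ : List Kind) (G : Env) (m : Mult) (A : Ty) (u : Expr) : Prop where
  value : IsValue u
  lc : u.LC
  decl : Decl Sg Δ G u A
  normal : nrm .pos A = A
  normalOn : NormalOn G u.Occ
  un : m = .un → ∀ w, G.Lin w → ¬ u.Occ w

theorem Subst.push {Δ G m A u} (h : Subst Sg Δ G m A u) (m' : Mult) (B : Ty) :
    Subst Sg Δ (G.push m' B) m A u := by
  have hG : ∀ w, u.Occ w → G w = G.push m' B w := by
    rintro (x | i) hw
    · rfl
    · exact absurd hw (h.lc i)
  refine ⟨h.value, h.lc, h.decl.congr hG, h.normal, ?_, ?_⟩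
  · intro w m T hw hG'
    rw [← hG w hw] at hG'
    exact h.normalOn w m T hw hG'
  · intro hm w hl hw
    exact h.un hm w ((Env.lin_congr (hG w hw)).2 hl) hw

theorem Env.map_congr_on {E : Env} {f g : Ty → Ty} {w : Var} (h : ∀ m T, E w m T → f T = g T) :
    E.map f w = E.map g w := by
  funext m T
  simp only [Env.map, eq_iff_iff]
  constructor
  · rintro ⟨T₀, hT, rfl⟩; exact ⟨T₀, hT, h _ _ hT⟩
  · rintro ⟨T₀, hT, rfl⟩; exact ⟨T₀, hT, (h _ _ hT).symm⟩

/-- Weakening is the substitution of shifted variables. Normality of the environment makes the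
normalization that comes with `Decl.tsubst` trivial. -/
theorem Decl.tshift (hSg : Sg.WF) {Δ E e T} (h : Decl Sg Δ E e T) (hE : NormalOn E e.Occ)
    (κ : Kind) : Decl Sg (κ :: Δ) (E.map Ty.shift) e.tshift T.shift := by
  have h' := h.tsubst hSg (KSubst.shift Δ κ)
  simp only [← shift_eq_subst, nrm_shift] at h'
  rw [h.normal hSg hE] at h'
  refine h'.congr fun w hw => Env.map_congr_on fun m T hT => ?_
  rw [hE w m T ((occ_tsubst _ _ _).1 hw) hT]

theorem Subst.shift (hSg : Sg.WF) {Δ G m A u} (h : Subst Sg Δ G m A u) (κ : Kind) :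
    Subst Sg (κ :: Δ) (G.map Ty.shift) m A.shift u.tshift := by
  refine ⟨h.value.tsubst _, h.lc.tshift, h.decl.tshift hSg h.normalOn κ, ?_, ?_, ?_⟩
  · rw [nrm_shift, h.normal]
  · simpa only [occ_tshift, funext fun w => propext (occ_tshift u w)] using h.normalOn.shift
  · simpa using h.un

/-- `E` and `G` differ only in the variable `k`, for which `u` is to be substituted in an
expression with variables `P`. -/
structure OpenEnv (E G : Env) (k : ℕ) (m : Mult) (A : Ty) (u : Expr) (P : Var → Prop) : Prop where
  agree : ∀ w, w ≠ .inr k → P w → E w = G w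
  at_index : E (.inr k) = fun m' T => m' = m ∧ T = A
  sep : ∀ w, G.Lin w → u.Occ w → ¬ P w

theorem OpenEnv.mono {E G k m A u} {P Q : Var → Prop} (h : OpenEnv E G k m A u P)
    (hQ : ∀ w, Q w → P w) : OpenEnv E G k m A u Q :=
  ⟨fun w hw hw' => h.agree w hw (hQ w hw'), h.at_index,
    fun w hl hu hw => h.sep w hl hu (hQ w hw)⟩

theorem OpenEnv.push {E G k m A u} {P : Var → Prop} (h : OpenEnv E G k m A u fun w => P w.up)
    (hu : u.LC) (m' : Mult) (B : Ty) :
    OpenEnv (E.push m' B) (G.push m' B) (k + 1) m A u P := by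
  refine ⟨?_, h.at_index, ?_⟩
  · intro w hw hP
    rcases Var.cases_up w with rfl | ⟨w, rfl⟩
    · rfl
    · rw [Env.push_up, Env.push_up]
      exact h.agree w (by simpa using hw) hP
  · intro w hl ho hP
    rcases Var.cases_up w with rfl | ⟨w, rfl⟩
    · exact hu _ ho
    · exact h.sep w (by simpa using hl) ((hu.occ_up w).1 ho) hP

theorem OpenEnv.shift {E G k m A u} {P : Var → Prop} (h : OpenEnv E G k m A u P) :
    OpenEnv (E.map Ty.shift) (G.map Ty.shift) k m A.shift u.tshift P := by
  refine ⟨fun w hw hP => Env.map_congr _ (h.agree w hw hP), ?_, ?_⟩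
  · funext m' T
    simp [Env.map, h.at_index]
  · simpa using h.sep

theorem OpenEnv.lin {E G k m A u} {P : Var → Prop} (h : OpenEnv E G k m A u P) {w : Var}
    (hw : w ≠ .inr k) (hP : P w) : E.Lin w ↔ G.Lin w :=
  Env.lin_congr (h.agree w hw hP)

theorem OpenEnv.lin_at {E G k A u} {P : Var → Prop} (h : OpenEnv E G k .lin A u P) :
    E.Lin (.inr k) :=
  ⟨A, by rw [h.at_index]; exact ⟨rfl, rfl⟩⟩

/-- If the bound variable is linear, it occurs in at most one of the two parts, so only that part
receives the linear variables of `u`. If it is unrestricted, both may receive `u`, which then has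
none. Those of `u` meet no old occurrence by `OpenEnv.sep`. -/
theorem OpenEnv.sep_open {Δ E G k m A u} {P Q : Var → Prop}
    (h : OpenEnv E G k m A u fun w => P w ∨ Q w) (hu : Subst Sg Δ G m A u)
    (hs : ∀ w, E.Lin w → P w → ¬ Q w) (w : Var) (hw : G.Lin w) (hP : OpenOcc k u P w) :
    ¬ OpenOcc k u Q w := by
  rintro (⟨hk, hQ⟩ | ⟨hk, hQ⟩)
  · rcases hP with ⟨_, hP⟩ | ⟨_, hP⟩
    · exact hs w ((h.lin hk (.inl hP)).2 hw) hP hQ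
    · exact h.sep w hw hP (.inr hQ)
  · rcases hP with ⟨_, hP⟩ | ⟨hk', _⟩
    · exact h.sep w hw hQ (.inl hP)
    · cases m with
      | lin => exact hs _ h.lin_at hk' hk
      | un => exact hu.un rfl w hw hQ

/-- The substitution lemma. The separation conditions are restored by `OpenEnv.sep_open`, and under
binders nothing happens to `u` because it has no dangling indices; only type abstractions shift it.
-/
theorem Decl.openAt (hSg : Sg.WF) {Δ E e T} (h : Decl Sg Δ E e T) :
    ∀ {G : Env} {k m A u}, Subst Sg Δ G m A u → OpenEnv E G k m A u e.Occ →
    Decl Sg Δ G (e.openAt k u) T := by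
  induction h with
  | const h => intros; exact .const h
  | fvar h hk =>
    intro G k m A u hu hE
    exact .fvar (by rwa [← hE.agree _ (by simp) rfl]) hk
  | @bvar Δ E i m T h hk =>
    intro G k m A u hu hE
    rw [Expr.openAt]
    split
    · subst_vars
      rw [hE.at_index] at h
      rw [h.2]
      exact hu.decl
    · exact .bvar (by rwa [← hE.agree _ (by simpa) rfl]) hk
  | letu _ _ hs ih₁ ih₂ =>
    intro G k m A u hu hE
    refine .letu (ih₁ hu (hE.mono fun _ => .inl)) (ih₂ hu (hE.mono fun _ => .inr)) ?_
    simp only [occ_openAt _ k u hu.lc]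
    exact hE.sep_open hu hs
  | app _ _ hs ih₁ ih₂ =>
    intro G k m A u hu hE
    refine .app (ih₁ hu (hE.mono fun _ => .inl)) (ih₂ hu (hE.mono fun _ => .inr)) ?_
    simp only [occ_openAt _ k u hu.lc]
    exact hE.sep_open hu hs
  | pair _ _ hs ih₁ ih₂ =>
    intro G k m A u hu hE
    refine .pair (ih₁ hu (hE.mono fun _ => .inl)) (ih₂ hu (hE.mono fun _ => .inr)) ?_
    simp only [occ_openAt _ k u hu.lc]
    exact hE.sep_open hu hs
  | abs hk _ ho ih =>
    intro G k m A u hu hE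
    refine .abs hk (ih (hu.push _ _) (OpenEnv.push hE hu.lc _ _)) ?_
    rw [occ_openAt _ _ _ hu.lc]
    exact .inl ⟨by simp, ho⟩
  | recf hv hk _ hn ih =>
    intro G k m A u hu hE
    refine .recf (hv.openAt _ hu.value) hk (ih (hu.push _ _) (OpenEnv.push hE hu.lc _ _)) ?_
    intro w hl ho
    rw [occ_openAt _ _ _ hu.lc] at ho
    rcases ho with ⟨hw, ho⟩ | ⟨hw, ho⟩
    · exact hn w ((hE.lin (by simpa using hw) ho).2 hl) ho
    -- A linear variable cannot occur in a recursive value, and a value substituted for an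
    -- unrestricted one has no linear variables.
    · cases m with
      | lin => exact hn (.inr k) hE.lin_at hw
      | un => exact hu.un rfl w hl ((hu.lc.occ_up w).1 ho)
  | tabs hv _ ih =>
    intro G k m A u hu hE
    exact .tabs (hv.openAt _ (hu.value.tsubst _)) (ih (hu.shift hSg _) hE.shift)
  | tapp _ hk ih => intro G k m A u hu hE; exact .tapp (ih hu hE) hk
  | letp _ _ h0 h1 hs ih₁ ih₂ =>
    intro G k m A u hu hE
    refine .letp (ih₁ hu (hE.mono fun _ => .inl)) (ih₂ ((hu.push _ _).push _ _)
      (OpenEnv.push (OpenEnv.push (P := fun w => Expr.Occ _ w.up) (hE.mono fun _ => .inr)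
        hu.lc _ _) hu.lc _ _)) ?_ ?_ ?_
    · rw [occ_openAt _ _ _ hu.lc]
      exact .inl ⟨by simp, h0⟩
    · rw [occ_openAt _ _ _ hu.lc]
      exact .inl ⟨by simp, h1⟩
    · intro w hl ho₁ ho₂
      rw [occ_openAt _ _ _ hu.lc] at ho₁ ho₂
      refine hE.sep_open hu hs w hl ho₁ ?_
      simpa only [OpenOcc, ne_eq, Var.up_inr, Var.up_eq_inr_succ, hu.lc.occ_up] using ho₂
  | mtch π hρ hC _ _ h0 hc hs ih ihb =>
    intro G k m A u hu hE
    refine .mtch π hρ hC (ih hu (hE.mono fun _ => .inl)) (fun i => ihb i (hu.push _ _)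
      (OpenEnv.push (hE.mono fun _ hw => .inr ⟨i, hw⟩) hu.lc _ _)) ?_ ?_ ?_
    · intro i
      rw [occ_openAt _ _ _ hu.lc]
      exact .inl ⟨by simp, h0 i⟩
    · intro i j w hl ho
      rw [occ_openAt _ _ _ hu.lc] at ho ⊢
      rcases ho with ⟨hw, ho⟩ | ⟨hw, ho⟩
      · refine .inl ⟨hw, hc i j w ((hE.lin (by simpa using hw) (.inr ⟨i, ho⟩)).2 hl) ho⟩
      -- A linear bound variable that occurs in one branch occurs in all of them, so every branch
      -- receives the linear variables of `u`.
      · cases m with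
        | lin => exact .inr ⟨hc i j (.inr k) hE.lin_at hw, ho⟩
        | un => exact absurd ((hu.lc.occ_up w).1 ho) (hu.un rfl w hl)
    · intro i w hl ho₁ ho₂
      rw [occ_openAt _ _ _ hu.lc] at ho₁ ho₂
      refine OpenEnv.sep_open (Q := fun w => Expr.Occ _ w.up)
        (hE.mono fun w hw => hw.imp_right fun hw => ⟨i, hw⟩) hu (hs i) w hl ho₁ ?_
      simpa only [OpenOcc, ne_eq, Var.up_inr, Var.up_eq_inr_succ, hu.lc.occ_up] using ho₂

/-! ### Names instead of bound variables -/

/-- Give the index `k` the types of the name `x`. -/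
def Env.bind (E : Env) (k : ℕ) (x : Name) : Env :=
  fun w => if w = .inr k then E (.inl x) else E w

theorem Env.bind_push (E : Env) (k : ℕ) (x : Name) (m A) :
    (E.push m A).bind (k + 1) x = (E.bind k x).push m A := by
  funext w
  rcases Var.cases_up w with rfl | ⟨w, rfl⟩
  · simp [Env.bind, Env.push]
  · simp only [Env.bind, Env.push_up, Var.up_eq_inr_succ]
    rfl

theorem Env.bind_map (E : Env) (k : ℕ) (x : Name) (f) :
    (E.map f).bind k x = (E.bind k x).map f := by
  funext w m T
  simp only [Env.bind, Env.map]
  split <;> rfl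

/-- The variable of the opened expression that stands for `w`. -/
def openVar (k : ℕ) (x : Name) (w : Var) : Var := if w = .inr k then .inl x else w

theorem Env.lin_bind {E : Env} {k : ℕ} {x : Name} {w : Var} :
    (E.bind k x).Lin w ↔ E.Lin (openVar k x w) := by
  simp only [Env.Lin, Env.bind, openVar]
  split <;> rfl

theorem occ_openVar {e : Expr} {k : ℕ} {x : Name} {w : Var} (h : e.Occ w) :
    (e.openAt k (.fvar x)).Occ (openVar k x w) := by
  rw [occ_openAt _ _ _ (LC.fvar x), openVar]
  split
  · subst_vars; exact .inr ⟨h, rfl⟩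
  · exact .inl ⟨by assumption, h⟩

theorem of_occ_openVar {e : Expr} {k : ℕ} {x : Name} {w : Var} (hx : x ∉ e.fv)
    (hw : w ≠ .inl x) (h : (e.openAt k (.fvar x)).Occ (openVar k x w)) : e.Occ w := by
  rw [occ_openAt _ _ _ (LC.fvar x), openVar] at h
  rcases h with ⟨_, h⟩ | ⟨h, h'⟩
  · split at h
    · exact absurd ((occ_inl e x).1 h) hx
    · exact h
  · split at h'
    · subst_vars; exact h
    · exact absurd h' hw

theorem openVar_up (k : ℕ) (x : Name) (w : Var) :
    openVar (k + 1) x w.up = (openVar k x w).up := by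
  simp only [openVar, Var.up_eq_inr_succ]
  split <;> rfl

theorem occ_of_openAt {e : Expr} {k i : ℕ} {x : Name}
    (h : (e.openAt k (.fvar x)).Occ (.inr i)) : e.Occ (.inr i) := by
  rw [occ_openAt _ _ _ (LC.fvar x)] at h
  rcases h with ⟨_, h⟩ | ⟨_, h⟩
  · exact h
  · cases h

/-- The converse of opening: the index inherits the types of the name. The induction is on the
unopened expression, since the subject of the derivation is not in the form of a binder body. -/
theorem Decl.bind {x : Name} (e : Expr) : ∀ {Δ E k T}, Decl Sg Δ E (e.openAt k (.fvar x)) T →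
    x ∉ e.fv → Decl Sg Δ (E.bind k x) e T := by
  induction e with
  | const c => intro Δ E k T h _; cases h with | const h => exact .const h
  | fvar y =>
    intro Δ E k T h _
    cases h with | fvar h hk => exact .fvar (by simpa [Env.bind] using h) hk
  | bvar i =>
    intro Δ E k T h _
    rw [Expr.openAt] at h
    split at h
    · subst_vars
      cases h with | fvar h hk => exact .bvar (by rw [Env.bind, if_pos rfl]; exact h) hk
    · cases h with | bvar h hk => exact .bvar (by rw [Env.bind, if_neg (by simpa)]; exact h) hk
  | abs T e ih =>
    intro Δ E k T h hx
    cases h with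
    | abs hk h ho =>
      have := ih h hx
      rw [Env.bind_push] at this
      exact .abs hk this (occ_of_openAt ho)
  | recf T e ih =>
    intro Δ E k T h hx
    cases h with
    | recf hv hk h hn =>
      have := ih h hx
      rw [Env.bind_push] at this
      refine .recf hv.of_openAt hk this fun w hl ho => hn _ (Env.lin_bind.1 hl) ?_
      rw [← openVar_up]
      exact occ_openVar ho
  | tabs κ e ih =>
    intro Δ E k T h hx
    cases h with
    | tabs hv h =>
      have := ih h hx
      rw [Env.bind_map] at this
      exact .tabs hv.of_openAt this
  | pair e₁ e₂ ih₁ ih₂ =>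
    intro Δ E k T h hx
    simp only [Expr.fv, Finset.mem_union, not_or] at hx
    cases h with
    | pair h₁ h₂ hs =>
      exact .pair (ih₁ h₁ hx.1) (ih₂ h₂ hx.2) fun w hl ho₁ ho₂ =>
        hs _ (Env.lin_bind.1 hl) (occ_openVar ho₁) (occ_openVar ho₂)
  | app e₁ e₂ ih₁ ih₂ =>
    intro Δ E k T h hx
    simp only [Expr.fv, Finset.mem_union, not_or] at hx
    cases h with
    | app h₁ h₂ hs =>
      exact .app (ih₁ h₁ hx.1) (ih₂ h₂ hx.2) fun w hl ho₁ ho₂ =>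
        hs _ (Env.lin_bind.1 hl) (occ_openVar ho₁) (occ_openVar ho₂)
  | letu e₁ e₂ ih₁ ih₂ =>
    intro Δ E k T h hx
    simp only [Expr.fv, Finset.mem_union, not_or] at hx
    cases h with
    | letu h₁ h₂ hs =>
      exact .letu (ih₁ h₁ hx.1) (ih₂ h₂ hx.2) fun w hl ho₁ ho₂ =>
        hs _ (Env.lin_bind.1 hl) (occ_openVar ho₁) (occ_openVar ho₂)
  | tapp e T ih => intro Δ E k T h hx; cases h with | tapp h hk => exact .tapp (ih h hx) hk
  | letp e₁ e₂ ih₁ ih₂ =>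
    intro Δ E k T h hx
    simp only [Expr.fv, Finset.mem_union, not_or] at hx
    cases h with
    | letp h₁ h₂ h0 h1 hs =>
      have := ih₂ h₂ hx.2
      rw [Env.bind_push, Env.bind_push] at this
      refine .letp (ih₁ h₁ hx.1) this (occ_of_openAt h0)
        (occ_of_openAt h1) fun w hl ho₁ ho₂ =>
        hs _ (Env.lin_bind.1 hl) (occ_openVar ho₁) ?_
      rw [← openVar_up, ← openVar_up]
      exact occ_openVar ho₂
  | mtch e n C b ih ihb =>
    intro Δ E k T h hx
    simp only [Expr.fv, Finset.mem_union, not_or, Finset.mem_biUnion, Finset.mem_univ, true_and,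
      not_exists] at hx
    cases h with
    | mtch π hρ hC h hb h0 hc hs =>
      have := fun i => ihb i (hb i) (hx.2 i)
      simp only [Env.bind_push] at this
      refine .mtch π hρ hC (ih h hx.1) this (fun i => occ_of_openAt (h0 i)) ?_ ?_
      · intro i j w hl ho
        -- After opening, `x` and the index can no longer be told apart; freshness of `x` for the
        -- branch rules out that the variable in question is `x` itself.
        have hw : w.up ≠ .inl x := by
          rw [ne_eq, Var.up_eq_inl]
          rintro rfl
          exact hx.2 i ((occ_inl _ _).1 ho)
        refine of_occ_openVar (hx.2 j) hw (k := k + 1) ?_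
        rw [openVar_up]
        refine hc i j _ (Env.lin_bind.1 hl) ?_
        rw [← openVar_up]
        exact occ_openVar ho
      · intro i w hl ho₁ ho₂
        refine hs i _ (Env.lin_bind.1 hl) (occ_openVar ho₁) ?_
        rw [← openVar_up]
        exact occ_openVar ho₂

end Decl

end AlgST

namespace AlgST

open Ty AlgST.Expr

section Algorithmic

variable {Sg : Sig}

/-- Every occurrence is typed by the environment. Contexts give no types to indices, so expressions
typed in a context have no dangling indices. -/
theorem Decl.dom {Δ E e T} (h : Decl Sg Δ E e T) :
    ∀ w, e.Occ w → ∃ m T, E w m T := by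
  have hup : ∀ {m A} {E : Env} {P : Var → Prop},
      (∀ w, P w → ∃ m' T, E.push m A w m' T) → ∀ w, P w.up → ∃ m T, E w m T := by
    intro m A E P h w hw
    simpa using h _ hw
  induction h with
  | const => intro w hw; cases hw
  | fvar h _ => intro w hw; cases hw; exact ⟨_, _, h⟩
  | bvar h _ => intro w hw; cases hw; exact ⟨_, _, h⟩
  | letu _ _ _ ih₁ ih₂ | app _ _ _ ih₁ ih₂ | pair _ _ _ ih₁ ih₂ =>
    intro w hw; exact hw.elim (ih₁ w) (ih₂ w)
  | abs _ _ _ ih => exact hup ih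
  | recf _ _ _ _ ih => exact hup ih
  | tabs _ _ ih =>
    intro w hw
    obtain ⟨m, _, T, hT, _⟩ := ih w hw
    exact ⟨m, T, hT⟩
  | tapp _ _ ih => exact ih
  | letp _ _ _ _ _ ih₁ ih₂ =>
    intro w hw
    exact hw.elim (ih₁ w) (hup (P := fun w => Expr.Occ _ w.up) (hup ih₂) w)
  | mtch _ _ _ _ _ _ _ _ ih ihb =>
    intro w hw
    exact hw.elim (ih w) fun ⟨i, hi⟩ => hup (ihb i) w hi

/-! ### Contexts as environments -/

/-- The environment given by a context. -/
def Ctx.env (Γ : Ctx) : Env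
  | .inl x, m, T => (x, m, T) ∈ Γ
  | .inr _, _, _ => False

instance : DecidableEq Mult := fun a b => by
  cases a <;> cases b <;> first | exact isTrue rfl | exact isFalse (by simp)

/-- The part of a context that is not consumed by an expression with free names `s`. -/
def Ctx.rest (Γ : Ctx) (s : Finset Name) : Ctx :=
  Γ.filter fun b => ¬ (b.2.1 = .lin ∧ b.1 ∈ s)

theorem Ctx.mem_dom {Γ : Ctx} {x : Name} : x ∈ Γ.dom ↔ ∃ m T, (x, m, T) ∈ Γ := by
  simp [Ctx.dom]

theorem Ctx.mem_dom_of_mem {Γ : Ctx} {x m T} (h : (x, m, T) ∈ Γ) : x ∈ Γ.dom :=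
  Ctx.mem_dom.2 ⟨m, T, h⟩

@[simp] theorem Ctx.dom_cons (b : Name × Mult × Ty) (Γ : Ctx) :
    Ctx.dom (b ::ₘ Γ) = b.1 ::ₘ Γ.dom := Multiset.map_cons _ _ _

@[simp] theorem Ctx.dom_add (Γ Γ' : Ctx) : Ctx.dom (Γ + Γ') = Γ.dom + Γ'.dom :=
  Multiset.map_add _ _ _

@[simp] theorem Ctx.dom_shift (Γ : Ctx) : Γ.shift.dom = Γ.dom := by
  simp [Ctx.dom, Ctx.shift]

theorem Ctx.dom_mono {Γ Γ' : Ctx} (h : Γ ≤ Γ') : Γ.dom ≤ Γ'.dom := Multiset.map_le_map h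

theorem Ctx.Distinct.mono {Γ Γ' : Ctx} (h : Γ'.Distinct) (hle : Γ ≤ Γ') : Γ.Distinct :=
  Multiset.nodup_of_le (Ctx.dom_mono hle) h

theorem Ctx.distinct_cons {x m T} {Γ : Ctx} :
    Ctx.Distinct ((x, m, T) ::ₘ Γ) ↔ x ∉ Γ.dom ∧ Γ.Distinct := by
  rw [Ctx.Distinct, Ctx.dom_cons, Multiset.nodup_cons]; rfl

theorem Ctx.Distinct.unique {Γ : Ctx} (h : Γ.Distinct) {x m T m' T'} (h₁ : (x, m, T) ∈ Γ)
    (h₂ : (x, m', T') ∈ Γ) : m = m' ∧ T = T' := by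
  obtain ⟨Γ, rfl⟩ := Multiset.exists_cons_of_mem h₁
  rw [Ctx.distinct_cons] at h
  rcases Multiset.mem_cons.1 h₂ with h' | h'
  · cases h'; exact ⟨rfl, rfl⟩
  · exact absurd (Ctx.mem_dom_of_mem h') h.1

theorem Ctx.mem_rest {Γ : Ctx} {s : Finset Name} {x m T} :
    (x, m, T) ∈ Γ.rest s ↔ (x, m, T) ∈ Γ ∧ ¬ (m = .lin ∧ x ∈ s) := by
  simp [Ctx.rest]

theorem Ctx.rest_le (Γ : Ctx) (s : Finset Name) : Γ.rest s ≤ Γ := Multiset.filter_le _ _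

theorem Ctx.rest_rest (Γ : Ctx) (s t : Finset Name) : (Γ.rest s).rest t = Γ.rest (s ∪ t) := by
  rw [Ctx.rest, Ctx.rest, Multiset.filter_filter, Ctx.rest]
  refine Multiset.filter_congr fun b _ => ?_
  rw [Finset.mem_union]
  tauto

theorem Ctx.rest_congr {Γ : Ctx} {s t : Finset Name}
    (h : ∀ x T, (x, .lin, T) ∈ Γ → (x ∈ s ↔ x ∈ t)) : Γ.rest s = Γ.rest t := by
  refine Multiset.filter_congr ?_
  rintro ⟨x, m, T⟩ hb
  cases m with
  | lin => simp only [h x T hb]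
  | un => simp

theorem Ctx.rest_cons_lin {Γ : Ctx} {s : Finset Name} {x A} (hx : x ∈ s) :
    Ctx.rest ((x, .lin, A) ::ₘ Γ) s = Γ.rest s :=
  Multiset.filter_cons_of_neg _ (by simpa)

theorem Ctx.rest_cons_un {Γ : Ctx} {s : Finset Name} {x A} :
    Ctx.rest ((x, .un, A) ::ₘ Γ) s = (x, .un, A) ::ₘ Γ.rest s :=
  Multiset.filter_cons_of_pos _ (by simp)

theorem Ctx.rest_eq_self {Γ : Ctx} {s : Finset Name} :
    Γ.rest s = Γ ↔ ∀ x T, (x, .lin, T) ∈ Γ → x ∉ s := by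
  rw [Ctx.rest, Multiset.filter_eq_self]
  constructor
  · intro h x T hx hs; exact h _ hx ⟨rfl, hs⟩
  · rintro h ⟨x, m, T⟩ hb ⟨rfl, hs⟩; exact h x T hb hs

theorem Ctx.env_shift (Γ : Ctx) : Γ.shift.env = Γ.env.map Ty.shift := by
  funext w m T
  rcases w with x | i
  · simp only [Ctx.env, Env.map, Ctx.shift, Multiset.mem_map, eq_iff_iff]
    constructor
    · rintro ⟨⟨y, m', T'⟩, h, heq⟩
      simp only [Prod.mk.injEq] at heq
      obtain ⟨rfl, rfl, rfl⟩ := heq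
      exact ⟨T', h, rfl⟩
    · rintro ⟨T', h, rfl⟩; exact ⟨_, h, rfl⟩
  · simp [Ctx.env, Env.map]

theorem Ctx.shift_rest (Γ : Ctx) (s : Finset Name) : Γ.shift.rest s = (Γ.rest s).shift := by
  simp [Ctx.rest, Ctx.shift, Multiset.filter_map]

/-- Instantiating the new type variable undoes a shift. -/
theorem Ctx.shift_injective : Function.Injective Ctx.shift := by
  refine Multiset.map_injective ?_
  rintro ⟨x, m, T⟩ ⟨x', m', T'⟩ h
  simp only [Prod.mk.injEq] at h
  obtain ⟨rfl, rfl, h⟩ := h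
  rw [← shift_inst T .unit, h, shift_inst]

theorem Ctx.env_cons_self {Γ : Ctx} {x m A} (hx : x ∉ Γ.dom) :
    Ctx.env ((x, m, A) ::ₘ Γ) (.inl x) = fun m' T' => m' = m ∧ T' = A := by
  funext m' T'
  simp only [Ctx.env, Multiset.mem_cons, Prod.mk.injEq, true_and, eq_iff_iff]
  exact ⟨fun h => h.resolve_right fun h => hx (Ctx.mem_dom_of_mem h), .inl⟩

theorem Ctx.env_cons_of_ne {Γ : Ctx} {x m A} {w : Var} (hw : w ≠ .inl x) :
    Ctx.env ((x, m, A) ::ₘ Γ) w = Γ.env w := by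
  funext m' T'
  rcases w with y | i
  · have : y ≠ x := fun h => hw (by rw [h])
    simp [Ctx.env, this]
  · rfl

theorem Decl.lc {Δ e T} {Γ : Ctx} (h : Decl Sg Δ Γ.env e T) : e.LC := by
  intro i hi
  obtain ⟨_, _, h⟩ := h.dom _ hi
  exact h

theorem Decl.fv_subset {Δ e T} {Γ : Ctx} (h : Decl Sg Δ Γ.env e T) {x : Name}
    (hx : x ∈ e.fv) : x ∈ Γ.dom :=
  Ctx.mem_dom.2 (h.dom _ ((occ_inl e x).2 hx))

/-! ### Opening and closing binders -/

/-- `E` has for the index `k` the type that `G` has for the name `x`, and otherwise they agree. -/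
structure NameEnv (E G : Env) (k : ℕ) (x : Name) (m : Mult) (A : Ty) : Prop where
  agree : ∀ w, w ≠ .inr k → w ≠ .inl x → E w = G w
  at_index : E (.inr k) = fun m' T' => m' = m ∧ T' = A
  at_name : G (.inl x) = fun m' T' => m' = m ∧ T' = A

theorem NameEnv.cons {Γ : Ctx} {x m A} (hx : x ∉ Γ.dom) :
    NameEnv (Γ.env.push m A) (Ctx.env ((x, m, A) ::ₘ Γ)) 0 x m A := by
  refine ⟨?_, rfl, Ctx.env_cons_self hx⟩
  intro w hw hwx
  rw [Ctx.env_cons_of_ne hwx]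
  rcases w with y | i
  · rfl
  · cases i with
    | zero => exact absurd rfl hw
    | succ i => rfl

theorem NameEnv.push {E G k x m A} (h : NameEnv E G k x m A) (m' B) :
    NameEnv (E.push m' B) (G.push m' B) (k + 1) x m A := by
  refine ⟨?_, h.at_index, h.at_name⟩
  intro w hw hwx
  rcases Var.cases_up w with rfl | ⟨w, rfl⟩
  · rfl
  · rw [Env.push_up, Env.push_up]
    exact h.agree w (by simpa using hw) (by simpa using hwx)

/-- An instance of the substitution lemma, a name being a value; freshness makes the separation
condition hold. -/
theorem Decl.open_name (hSg : Sg.WF) {Δ E G e T k x m A} (h : Decl Sg Δ E e T)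
    (hE : NameEnv E G k x m A) (hx : x ∉ e.fv) (hA : Kinding Sg .check Δ A .T)
    (hn : nrm .pos A = A) : Decl Sg Δ G (e.openAt k (.fvar x)) T := by
  have hG : G (.inl x) m A := by rw [hE.at_name]; exact ⟨rfl, rfl⟩
  refine h.openAt hSg (m := m) ⟨.fvar, LC.fvar x, .fvar hG hA, hn, ?_, ?_⟩ ⟨?_, hE.at_index, ?_⟩
  · rintro w m' T' rfl h
    rw [hE.at_name] at h
    rw [h.2, hn]
  · rintro rfl w ⟨T', h⟩ rfl
    rw [hE.at_name] at h
    cases h.1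
  · intro w hw ho
    refine hE.agree w hw ?_
    rintro rfl
    exact hx ((occ_inl e x).1 ho)
  · rintro w _ rfl ho
    exact hx ((occ_inl e x).1 ho)

theorem Decl.close_name {Δ E G e T k x m A} (h : Decl Sg Δ G (e.openAt k (.fvar x)) T)
    (hE : NameEnv E G k x m A) (hx : x ∉ e.fv) : Decl Sg Δ E e T := by
  refine (Decl.bind e h hx).congr ?_
  intro w hw
  rw [Env.bind]
  split
  · subst_vars
    rw [hE.at_name, hE.at_index]
  · refine (hE.agree w ‹_› ?_).symm
    rintro rfl
    exact hx ((occ_inl e x).1 hw)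

theorem mem_fv_openAt {e : Expr} {k : ℕ} {x y : Name} :
    y ∈ (e.openAt k (.fvar x)).fv ↔ y ∈ e.fv ∨ y = x ∧ e.Occ (.inr k) := by
  rw [← occ_inl, occ_openAt _ _ _ (LC.fvar x), OpenOcc, occ_inl]
  simp only [Occ, Sum.inl.injEq]
  simp
  tauto

theorem occ_inr_openAt {e : Expr} {k i : ℕ} {x : Name} :
    (e.openAt k (.fvar x)).Occ (.inr i) ↔ i ≠ k ∧ e.Occ (.inr i) := by
  rw [occ_openAt _ _ _ (LC.fvar x), OpenOcc]
  simp [Occ]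

theorem Ctx.rest_openAt {Γ : Ctx} {e : Expr} {k : ℕ} {x : Name} (hx : x ∉ Γ.dom) :
    Γ.rest (e.openAt k (.fvar x)).fv = Γ.rest e.fv := by
  refine Ctx.rest_congr fun y T hy => ?_
  rw [mem_fv_openAt]
  refine ⟨fun h => h.resolve_right ?_, .inl⟩
  rintro ⟨rfl, _⟩
  exact hx (Ctx.mem_dom_of_mem hy)

/-- Variables that are still available after `s` has been consumed. -/
theorem Ctx.env_rest {Γ : Ctx} (hΓ : Γ.Distinct) {s : Finset Name} {P : Var → Prop}
    (h : ∀ w, P w → ∃ m T, (Γ.rest s).env w m T) (w : Var) (hw : P w) :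
    (Γ.rest s).env w = Γ.env w ∧ (Γ.env.Lin w → ∀ x, w = .inl x → x ∉ s) := by
  obtain ⟨m, T, hm⟩ := h w hw
  rcases w with x | i
  · have hm' := Ctx.mem_rest.1 hm
    refine ⟨?_, ?_⟩
    · funext m' T'
      refine propext (Ctx.mem_rest.trans ⟨And.left, fun h' => ⟨h', ?_⟩⟩)
      obtain ⟨rfl, rfl⟩ := hΓ.unique hm'.1 h'
      exact hm'.2
    · rintro ⟨T', h'⟩ y hy hs
      cases hy
      obtain ⟨rfl, rfl⟩ := hΓ.unique hm'.1 h'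
      exact hm'.2 ⟨rfl, hs⟩
  · exact hm.elim

theorem Ctx.env_rest_of_sep {Γ : Ctx} {e : Expr} {w : Var} (h : Γ.env.Lin w → ¬ e.Occ w) :
    Γ.env w = (Γ.rest e.fv).env w := by
  rcases w with x | i
  · funext m T
    refine propext (Iff.symm (Ctx.mem_rest.trans ⟨And.left, fun h' => ⟨h', ?_⟩⟩))
    rintro ⟨rfl, hx⟩
    exact h ⟨T, h'⟩ ((occ_inl _ _).2 hx)
  · rfl

/-- Being typed in what `e₁` leaves over means using none of the linear names of `e₁`: since names
are distinct, a consumed entry cannot be replaced by another one of the same name. -/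
theorem Decl.seq {Δ T} {e₁ e₂ : Expr} {Γ : Ctx} (hΓ : Γ.Distinct)
    (h : Decl Sg Δ (Γ.rest e₁.fv).env e₂ T) :
    Decl Sg Δ Γ.env e₂ T ∧ ∀ w, Γ.env.Lin w → e₁.Occ w → ¬ e₂.Occ w := by
  have := Ctx.env_rest hΓ (h.dom)
  refine ⟨h.congr fun w hw => (this w hw).1, ?_⟩
  intro w hl h₁ h₂
  rcases w with x | i
  · exact (this _ h₂).2 hl x rfl ((occ_inl _ _).1 h₁)
  · exact hl.elim fun _ h => h

/-- Algorithmic typing, in terms of declarative typing. -/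
theorem Typed.decl (hSg : Sg.WF) {m Δ Γ₁ e T Γ₂} (h : Typed Sg m Δ Γ₁ e T Γ₂) :
    Γ₁.Distinct → Decl Sg Δ Γ₁.env e T ∧ Γ₂ = Γ₁.rest e.fv := by
  induction h with
  | const h =>
    intro _
    exact ⟨.const h, (Ctx.rest_eq_self.2 (by simp [fv])).symm⟩
  | var hk =>
    intro hΓ
    rw [Ctx.distinct_cons] at hΓ
    refine ⟨.fvar (Multiset.mem_cons_self _ _) hk, ?_⟩
    rw [Ctx.rest_cons_lin (by simp [fv]), eq_comm, Ctx.rest_eq_self]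
    intro y T hy hyx
    rw [fv, Finset.mem_singleton] at hyx
    subst hyx
    exact hΓ.1 (Ctx.mem_dom_of_mem hy)
  | varStar hk =>
    intro hΓ
    rw [Ctx.distinct_cons] at hΓ
    refine ⟨.fvar (Multiset.mem_cons_self _ _) hk, ?_⟩
    rw [Ctx.rest_cons_un, eq_comm, Ctx.rest_eq_self.2]
    intro y T hy hyx
    rw [fv, Finset.mem_singleton] at hyx
    subst hyx
    exact hΓ.1 (Ctx.mem_dom_of_mem hy)
  | letu _ _ ih₁ ih₂ =>
    intro hΓ
    obtain ⟨h₁, rfl⟩ := ih₁ hΓ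
    obtain ⟨h₂, rfl⟩ := ih₂ (hΓ.mono (Ctx.rest_le _ _))
    obtain ⟨h₂, hs⟩ := h₂.seq hΓ
    exact ⟨.letu h₁ h₂ hs, Ctx.rest_rest _ _ _⟩
  | app _ _ ih₁ ih₂ =>
    intro hΓ
    obtain ⟨h₁, rfl⟩ := ih₁ hΓ
    obtain ⟨h₂, rfl⟩ := ih₂ (hΓ.mono (Ctx.rest_le _ _))
    obtain ⟨h₂, hs⟩ := h₂.seq hΓ
    exact ⟨.app h₁ h₂ hs, Ctx.rest_rest _ _ _⟩
  | pair _ _ ih₁ ih₂ =>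
    intro hΓ
    obtain ⟨h₁, rfl⟩ := ih₁ hΓ
    obtain ⟨h₂, rfl⟩ := ih₂ (hΓ.mono (Ctx.rest_le _ _))
    obtain ⟨h₂, hs⟩ := h₂.seq hΓ
    exact ⟨.pair h₁ h₂ hs, Ctx.rest_rest _ _ _⟩
  | @abs Δ Γ₁ Γ₂ T e U x hxe hxΓ hk _ hx ih =>
    intro hΓ
    obtain ⟨h, rfl⟩ := ih (Ctx.distinct_cons.2 ⟨hxΓ, hΓ⟩)
    -- A linear entry that is missing from the output was consumed, hence its name occurs.
    have hxo : x ∈ (e.open1 (.fvar x)).fv := by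
      by_contra hn
      exact hx (Ctx.mem_dom_of_mem (Ctx.mem_rest.2 ⟨Multiset.mem_cons_self _ _, by simp [hn]⟩))
    have h0 := ((mem_fv_openAt.1 hxo).resolve_left hxe).2
    refine ⟨.abs hk (h.close_name (NameEnv.cons hxΓ) hxe) h0, ?_⟩
    rw [Ctx.rest_cons_lin hxo]
    exact Ctx.rest_openAt hxΓ
  | recf x hxe hxΓ hv hk hV _ ih =>
    intro hΓ
    subst hV
    obtain ⟨h, hr⟩ := ih (Ctx.distinct_cons.2 ⟨hxΓ, hΓ⟩)
    -- The body has equal input and output contexts, so it consumes nothing; this becomes the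
    -- condition that no linear variable occurs in it.
    rw [Ctx.rest_cons_un, Multiset.cons_inj_right, Expr.open1, Ctx.rest_openAt hxΓ] at hr
    refine ⟨.recf hv hk (h.close_name (NameEnv.cons hxΓ) hxe) ?_, hr⟩
    rintro (y | i) hl ho
    · obtain ⟨T, hT⟩ := hl
      exact Ctx.rest_eq_self.1 hr.symm y T hT ((occ_inl _ _).1 ho)
    · exact hl.elim fun _ h => h
  | tabs hv _ ih =>
    intro hΓ
    obtain ⟨h, hr⟩ := ih (by rwa [Ctx.Distinct, Ctx.dom_shift])
    rw [Ctx.env_shift] at h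
    rw [Ctx.shift_rest] at hr
    exact ⟨.tabs hv h, Ctx.shift_injective hr⟩
  | tapp _ hk ih =>
    intro hΓ
    obtain ⟨h, rfl⟩ := ih hΓ
    exact ⟨.tapp h hk, rfl⟩
  | @letp Δ Γ₁ Γ₂ Γ₃ e₁ e₂ T U V x y hxy hxe hye hxΓ hyΓ _ _ hx hy ih₁ ih₂ =>
    intro hΓ
    obtain ⟨h₁, rfl⟩ := ih₁ hΓ
    have hd : Ctx.Distinct ((y, .lin, nrm .pos U) ::ₘ Γ₁.rest e₁.fv) :=
      Ctx.distinct_cons.2 ⟨hyΓ, hΓ.mono (Ctx.rest_le _ _)⟩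
    have hxΓ' : x ∉ Ctx.dom ((y, .lin, nrm .pos U) ::ₘ Γ₁.rest e₁.fv) := by simp [hxy, hxΓ]
    obtain ⟨h₂, rfl⟩ := ih₂ (Ctx.distinct_cons.2 ⟨hxΓ', hd⟩)
    have hye' : y ∉ (e₂.openAt 1 (.fvar x)).fv := by
      rw [mem_fv_openAt]; rintro (h | ⟨h, _⟩)
      · exact hye h
      · exact hxy h.symm
    have hxo : x ∈ (e₂.open2 (.fvar x) (.fvar y)).fv := by
      by_contra hn
      exact hx (Ctx.mem_dom_of_mem (Ctx.mem_rest.2 ⟨Multiset.mem_cons_self _ _, by simp [hn]⟩))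
    have hyo : y ∈ (e₂.open2 (.fvar x) (.fvar y)).fv := by
      by_contra hn
      exact hy (Ctx.mem_dom_of_mem (Ctx.mem_rest.2 ⟨Multiset.mem_cons_of_mem
        (Multiset.mem_cons_self _ _), by simp [hn]⟩))
    have h0 := (occ_inr_openAt.1 ((mem_fv_openAt.1 hyo).resolve_left hye').2).2
    have h1 := ((mem_fv_openAt.1
      ((mem_fv_openAt.1 hxo).resolve_right fun h => hxy h.1)).resolve_left hxe).2
    -- The name `y` stands for index 0 although `x` heads the context, hence the exchange of the two
    -- entries.
    have hN : NameEnv ((Ctx.env ((x, .lin, nrm .pos T) ::ₘ Γ₁.rest e₁.fv)).push .lin (nrm .pos U))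
        (Ctx.env ((x, .lin, nrm .pos T) ::ₘ (y, .lin, nrm .pos U) ::ₘ Γ₁.rest e₁.fv)) 0 y
        .lin (nrm .pos U) := by
      rw [Multiset.cons_swap]
      exact NameEnv.cons (by simp [hxy.symm, hyΓ])
    have h₂' := (h₂.close_name hN hye').close_name ((NameEnv.cons hxΓ).push _ _) hxe
    have hr := Ctx.env_rest hΓ (P := fun w => e₂.Occ w.up.up)
      (fun w hw => by simpa using h₂'.dom _ hw)
    refine ⟨.letp h₁ (h₂'.congr ?_) h0 h1 ?_, ?_⟩
    · exact Env.push_congr (Env.push_congr (P := fun w => Expr.Occ _ w.up)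
        fun w hw => (hr w hw).1)
    · rintro (z | i) hl ho₁ ho₂
      · exact (hr _ ho₂).2 hl z rfl ((occ_inl _ _).1 ho₁)
      · exact hl.elim fun _ h => h
    · rw [Ctx.rest_cons_lin hxo, Ctx.rest_cons_lin hyo, Expr.open2, Ctx.rest_openAt hyΓ,
        Ctx.rest_openAt hxΓ, Ctx.rest_rest, fv]
  | @mtch Δ Γ₁ Γ₂ Γ₃ ρ d U S V e n C b π x hρ hC _ hxe hxΓ _ hx ih ihb =>
    intro hΓ
    obtain ⟨h, rfl⟩ := ih hΓ
    have hd := hΓ.mono (Ctx.rest_le Γ₁ e.fv)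
    have hb := fun i => ihb i (Ctx.distinct_cons.2 ⟨hxΓ i, hd⟩)
    have hxo : ∀ i, x i ∈ ((b i).open1 (.fvar (x i))).fv := by
      intro i
      by_contra hn
      refine hx i (Ctx.mem_dom_of_mem (m := .lin) (T := contTy .neg d (π i) U S) ?_)
      rw [(hb i).2, Ctx.mem_rest]
      exact ⟨Multiset.mem_cons_self _ _, by simp [hn]⟩
    have h0 := fun i => ((mem_fv_openAt.1 (hxo i)).resolve_left (hxe i)).2
    have hb' := fun i => (hb i).1.close_name (NameEnv.cons (hxΓ i)) (hxe i)
    have hr := fun i => Ctx.env_rest hΓ (P := fun w => (b i).Occ w.up)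
      (fun w hw => by simpa using (hb' i).dom _ hw)
    have hΓ₃ : ∀ i, Γ₃ = (Γ₁.rest e.fv).rest (b i).fv := by
      intro i
      rw [(hb i).2, Ctx.rest_cons_lin (hxo i), Expr.open1, Ctx.rest_openAt (hxΓ i)]
    -- All branches share one output context, so a linear entry is consumed by all of them or by
    -- none.
    have hc : ∀ i j x T, (x, .lin, T) ∈ Γ₁.rest e.fv → x ∈ (b i).fv → x ∈ (b j).fv := by
      intro i j x T hT hxi
      by_contra hn
      have h₁ : (x, .lin, T) ∈ (Γ₁.rest e.fv).rest (b j).fv := Ctx.mem_rest.2 ⟨hT, by simp [hn]⟩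
      rw [← hΓ₃ j, hΓ₃ i, Ctx.mem_rest] at h₁
      exact h₁.2 ⟨rfl, hxi⟩
    refine ⟨.mtch π hρ hC h (fun i => (hb' i).congr (Env.push_congr fun w hw => (hr i w hw).1))
      h0 ?_ ?_, ?_⟩
    · rintro i j (y | k) hl ho
      · have hl' := (Env.lin_congr (hr i _ ho).1).2 hl
        obtain ⟨T, hT⟩ := hl'
        exact (occ_inl _ _).2 (hc i j y T hT ((occ_inl _ _).1 ho))
      · exact hl.elim fun _ h => h.elim
    · rintro i (z | k) hl ho₁ ho₂
      · exact (hr i _ ho₂).2 hl z rfl ((occ_inl _ _).1 ho₁)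
      · exact hl.elim fun _ h => h
    -- Some branch exists, and what it consumes is what the union of all branches consumes.
    · let i₀ := π.symm ⟨0, (hSg _ _ hρ).1⟩
      rw [fv, ← Ctx.rest_rest, hΓ₃ i₀]
      refine Ctx.rest_congr fun y T hy => ?_
      rw [Finset.mem_biUnion]
      exact ⟨fun h => ⟨i₀, Finset.mem_univ _, h⟩, fun ⟨i, _, h⟩ => hc i i₀ y T hy h⟩
  | check _ hTU ih => subst hTU; exact ih

/-! ### From declarative to algorithmic typing -/

/-- The size of an expression. -/
def Expr.size : Expr → ℕ
  | .const _ | .fvar _ | .bvar _ => 0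
  | .abs _ e | .recf _ e | .tabs _ e | .tapp e _ => e.size + 1
  | .pair e₁ e₂ | .app e₁ e₂ | .letu e₁ e₂ | .letp e₁ e₂ => e₁.size + e₂.size + 1
  | .mtch e n _ b => e.size + ∑ i : Fin n, (b i).size + 1

theorem Expr.size_openAt (x : Name) (e : Expr) : ∀ k, (e.openAt k (.fvar x)).size = e.size := by
  induction e with
  | bvar i => intro k; rw [Expr.openAt]; split <;> rfl
  | tabs κ e ih => intro k; exact congrArg (· + 1) (ih k)
  | _ => intro k; simp_all [Expr.openAt, Expr.size]

/-- The algorithmic rules open binders, and an opened body is not a subterm; the induction is on the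
size, which opening with a name preserves. -/
theorem Decl.typed_of_size (hSg : Sg.WF) (N : ℕ) : ∀ {e : Expr}, e.size < N → ∀ {Δ T} {Γ : Ctx},
    Γ.Distinct → Decl Sg Δ Γ.env e T → Typed Sg .synth Δ Γ e T (Γ.rest e.fv) := by
  induction N with
  | zero => intro e he; omega
  | succ N ih =>
    intro e he Δ T Γ hΓ h
    have fresh : ∀ s : Finset Name, ∃ x, x ∉ s ∧ x ∉ Γ.dom := by
      intro s
      obtain ⟨x, hx⟩ := Infinite.exists_notMem_finset (s ∪ Γ.dom.toFinset)
      simp only [Finset.mem_union, Multiset.mem_toFinset, not_or] at hx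
      exact ⟨x, hx⟩
    cases h with
    | const h =>
      rw [Ctx.rest_eq_self.2 (by simp [fv])]
      exact .const h
    | @fvar _ _ x m T h hk =>
      obtain ⟨Γ, rfl⟩ : ∃ Γ' : Ctx, Γ = (x, m, T) ::ₘ Γ' := Multiset.exists_cons_of_mem h
      rw [Ctx.distinct_cons] at hΓ
      have hr : Γ.rest (Expr.fvar x).fv = Γ := by
        rw [Ctx.rest_eq_self]
        intro y T hy hyx
        rw [fv, Finset.mem_singleton] at hyx
        subst hyx
        exact hΓ.1 (Ctx.mem_dom_of_mem hy)
      cases m with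
      | lin => rw [Ctx.rest_cons_lin (by simp [fv]), hr]; exact .var hk
      | un => rw [Ctx.rest_cons_un, hr]; exact .varStar hk
    | bvar h => exact h.elim
    | letu h₁ h₂ hs =>
      rw [Expr.size] at he
      rw [fv, ← Ctx.rest_rest]
      exact .letu (.check (ih (by omega) hΓ h₁) rfl) (ih (by omega) (hΓ.mono (Ctx.rest_le _ _))
        (h₂.congr fun w hw => Ctx.env_rest_of_sep fun hl h₁ => hs w hl h₁ hw))
    | app h₁ h₂ hs =>
      rw [Expr.size] at he
      rw [fv, ← Ctx.rest_rest]
      exact .app (ih (by omega) hΓ h₁) (.check (ih (by omega) (hΓ.mono (Ctx.rest_le _ _))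
        (h₂.congr fun w hw => Ctx.env_rest_of_sep fun hl h₁ => hs w hl h₁ hw)) rfl)
    | pair h₁ h₂ hs =>
      rw [Expr.size] at he
      rw [fv, ← Ctx.rest_rest]
      exact .pair (ih (by omega) hΓ h₁) (ih (by omega) (hΓ.mono (Ctx.rest_le _ _))
        (h₂.congr fun w hw => Ctx.env_rest_of_sep fun hl h₁ => hs w hl h₁ hw))
    | @abs _ _ T e U hk h h0 =>
      rw [Expr.size] at he
      obtain ⟨x, hxe, hxΓ⟩ := fresh e.fv
      have h' := h.open_name hSg (NameEnv.cons hxΓ) hxe hk.nrm_pos hk.nrm_idem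
      have h' := ih (by rw [Expr.size_openAt]; omega) (Ctx.distinct_cons.2 ⟨hxΓ, hΓ⟩) h'
      rw [Ctx.rest_cons_lin (mem_fv_openAt.2 (.inr ⟨rfl, h0⟩)), Ctx.rest_openAt hxΓ] at h'
      exact .abs x hxe hxΓ hk h' fun hx =>
        hxΓ (Multiset.mem_of_le (Ctx.dom_mono (Ctx.rest_le _ _)) hx)
    | @recf _ _ T U v hv hk h hn =>
      rw [Expr.size] at he
      obtain ⟨x, hxe, hxΓ⟩ := fresh v.fv
      have h' := h.open_name hSg (NameEnv.cons hxΓ) hxe hk.nrm_pos hk.nrm_idem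
      have h' := ih (by rw [Expr.size_openAt]; omega) (Ctx.distinct_cons.2 ⟨hxΓ, hΓ⟩) h'
      have hr : Γ.rest v.fv = Γ := by
        rw [Ctx.rest_eq_self]
        intro y T hy hyv
        exact hn (.inl y) ⟨T, hy⟩ ((occ_inl _ _).2 hyv)
      rw [Ctx.rest_cons_un, Ctx.rest_openAt hxΓ, hr] at h'
      rw [fv, hr]
      exact .recf x hxe hxΓ hv hk rfl (.check h' rfl)
    | tabs hv h =>
      rw [Expr.size] at he
      refine .tabs hv ?_
      rw [← Ctx.env_shift] at h
      have := ih (by omega) (by rwa [Ctx.Distinct, Ctx.dom_shift]) h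
      rwa [Ctx.shift_rest] at this
    | tapp h hk =>
      rw [Expr.size] at he
      exact .tapp (ih (by omega) hΓ h) hk
    | @letp _ _ e₁ e₂ T U V h₁ h₂ h0 h1 hs =>
      rw [Expr.size] at he
      obtain ⟨x, hxe, hxΓ⟩ := fresh e₂.fv
      obtain ⟨y, hye, hyΓ⟩ := fresh (e₂.fv ∪ {x})
      simp only [Finset.mem_union, Finset.mem_singleton, not_or] at hye
      obtain ⟨hye, hyx⟩ := hye
      have hle : Γ.rest e₁.fv ≤ Γ := Ctx.rest_le _ _
      have hxΓ' : x ∉ Ctx.dom (Γ.rest e₁.fv) :=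
        fun hx => hxΓ (Multiset.mem_of_le (Ctx.dom_mono hle) hx)
      have hyΓ' : y ∉ Ctx.dom (Γ.rest e₁.fv) :=
        fun hy => hyΓ (Multiset.mem_of_le (Ctx.dom_mono hle) hy)
      have hd : Ctx.Distinct ((x, .lin, nrm .pos T) ::ₘ (y, .lin, nrm .pos U) ::ₘ
          Γ.rest e₁.fv) := by
        refine Ctx.distinct_cons.2 ⟨?_, Ctx.distinct_cons.2 ⟨hyΓ', hΓ.mono hle⟩⟩
        simpa [Ne.symm hyx] using hxΓ'
      have hye' : y ∉ (e₂.openAt 1 (.fvar x)).fv := by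
        rw [mem_fv_openAt]; rintro (h | ⟨h, _⟩)
        · exact hye h
        · exact hyx h
      have hN : NameEnv ((Ctx.env ((x, .lin, nrm .pos T) ::ₘ Γ.rest e₁.fv)).push .lin
          (nrm .pos U)) (Ctx.env ((x, .lin, nrm .pos T) ::ₘ (y, .lin, nrm .pos U) ::ₘ
            Γ.rest e₁.fv)) 0 y .lin (nrm .pos U) := by
        rw [Multiset.cons_swap]
        exact NameEnv.cons (by simpa [hyx] using hyΓ')
      have hk := (h₁.kinding hSg).pair_inv
      have h₂' : Decl Sg Δ (((Γ.rest e₁.fv).env.push .lin (nrm .pos T)).push .lin (nrm .pos U))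
          e₂ _ := h₂.congr (Env.push_congr (Env.push_congr (P := fun w => Expr.Occ _ w.up)
        fun w hw => Ctx.env_rest_of_sep fun hl h₁ => hs w hl h₁ hw))
      have h₂' := (h₂'.open_name hSg ((NameEnv.cons hxΓ').push _ _) hxe hk.1.nrm_pos
        hk.1.nrm_idem).open_name hSg hN hye' hk.2.nrm_pos hk.2.nrm_idem
      have h₂' := ih (by rw [Expr.size_openAt, Expr.size_openAt]; omega) hd h₂'
      have hyo : y ∈ ((e₂.openAt 1 (.fvar x)).openAt 0 (.fvar y)).fv :=
        mem_fv_openAt.2 (.inr ⟨rfl, occ_inr_openAt.2 ⟨by simp, h0⟩⟩)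
      have hxo : x ∈ ((e₂.openAt 1 (.fvar x)).openAt 0 (.fvar y)).fv :=
        mem_fv_openAt.2 (.inl (mem_fv_openAt.2 (.inr ⟨rfl, h1⟩)))
      rw [Ctx.rest_cons_lin hxo, Ctx.rest_cons_lin hyo, Ctx.rest_openAt hyΓ',
        Ctx.rest_openAt hxΓ'] at h₂'
      rw [fv, ← Ctx.rest_rest]
      exact .letp x y (Ne.symm hyx) hxe hye hxΓ' hyΓ' (ih (by omega) hΓ h₁) h₂'
        (fun hx => hxΓ' (Multiset.mem_of_le (Ctx.dom_mono (Ctx.rest_le _ _)) hx))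
        (fun hy => hyΓ' (Multiset.mem_of_le (Ctx.dom_mono (Ctx.rest_le _ _)) hy))
    | @mtch _ _ ρ d U S V e n C b π hρ hC h hb h0 hc hs =>
      rw [Expr.size] at he
      have hsz : ∀ i, (b i).size ≤ ∑ i, (b i).size := fun i =>
        Finset.single_le_sum (f := fun i => (b i).size) (fun _ _ => Nat.zero_le _)
          (Finset.mem_univ i)
      choose x hxe hxΓ using fun i => fresh (b i).fv
      have hle : Γ.rest e.fv ≤ Γ := Ctx.rest_le _ _
      have hxΓ' : ∀ i, x i ∉ Ctx.dom (Γ.rest e.fv) :=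
        fun i hx => hxΓ i (Multiset.mem_of_le (Ctx.dom_mono hle) hx)
      have hk := (h.kinding hSg).inn_inv
      have hU := Kinding.proto_inv hρ hk.1
      -- Branches with the same linear variables leave the same context, which supplies the common
      -- output context of the rule.
      have hfv : ∀ i, (Γ.rest e.fv).rest (b i).fv =
          Γ.rest (e.fv ∪ (Finset.univ : Finset (Fin n)).biUnion fun i => (b i).fv) := by
        intro i
        rw [← Ctx.rest_rest]
        refine Ctx.rest_congr fun y T hy => ?_
        rw [Finset.mem_biUnion]
        refine ⟨fun h => ⟨i, Finset.mem_univ _, h⟩, fun ⟨j, _, h⟩ => ?_⟩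
        exact (occ_inl _ _).1 (hc j i (.inl y) ⟨T, (Ctx.mem_rest.1 hy).1⟩ ((occ_inl _ _).2 h))
      refine .mtch π x hρ hC (ih (by omega) hΓ h) hxe hxΓ' ?_ fun i hx =>
        hxΓ i (Multiset.mem_of_le (Ctx.dom_mono (Ctx.rest_le _ _)) hx)
      intro i
      have h' := (hb i).congr (Env.push_congr
        fun w hw => Ctx.env_rest_of_sep fun hl h₁ => hs i w hl h₁ hw)
      have hck := (contTy_kinding hSg hρ .neg (π i) hU hk.2).weaken (Kind.Sub.ofS .T)
      have h' := h'.open_name hSg (NameEnv.cons (hxΓ' i)) (hxe i) hck.nrm_pos hck.nrm_idem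
      have h' := ih (by rw [Expr.size_openAt]; have := hsz i; omega)
        (Ctx.distinct_cons.2 ⟨hxΓ' i, hΓ.mono hle⟩) h'
      rw [Ctx.rest_cons_lin (mem_fv_openAt.2 (.inr ⟨rfl, h0 i⟩)),
        Ctx.rest_openAt (hxΓ' i), hfv i] at h'
      exact h'

theorem Decl.typed (hSg : Sg.WF) {Δ e T} {Γ : Ctx} (hΓ : Γ.Distinct) (h : Decl Sg Δ Γ.env e T) :
    Typed Sg .synth Δ Γ e T (Γ.rest e.fv) :=
  Decl.typed_of_size hSg _ (Nat.lt_succ_self _) hΓ h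

end Algorithmic

end AlgST

namespace AlgST

open Ty AlgST.Expr

section Inversion

variable {Sg : Sig}

/-! ### Inversion of the typing of redexes -/

/-- Instantiation of a normalized universal type. -/
theorem nrm_all_inst {Δ₀ Δ κ κ' X U T σ} (hX : Kinding Sg .check (κ :: Δ₀) X .T)
    (hσ : KSubst Sg Δ₀ Δ σ) (h : Ty.all κ' U = nrm .pos ((Ty.all κ X).subst σ)) :
    κ' = κ ∧ nrm .pos (U.inst T) = nrm .pos (X.subst (scons T σ)) := by
  rw [Ty.subst, nrm_all, polDual, Ty.all.injEq] at h
  obtain ⟨rfl, rfl⟩ := h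
  exact ⟨rfl, by rw [Ty.inst, (hX.subst (hσ.ups _)).nrm_nrm_subst, ← Ty.inst, subst_ups_inst]⟩

/-- Follows a polymorphic constant through its type arguments: the arguments accumulate in a
substitution, and the type is always the normal form of the remaining body under it. -/
theorem Decl.tapp_inv {Δ₀ Δ E e κ X V T σ} (hX : Kinding Sg .check (κ :: Δ₀) X .T)
    (hσ : KSubst Sg Δ₀ Δ σ) (he : ∀ W, Decl Sg Δ E e W → W = nrm .pos ((Ty.all κ X).subst σ))
    (h : Decl Sg Δ E (.tapp e T) V) :
    KSubst Sg (κ :: Δ₀) Δ (scons T σ) ∧ V = nrm .pos (X.subst (scons T σ)) := by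
  cases h with
  | tapp h hk =>
    obtain ⟨rfl, hV⟩ := nrm_all_inst (T := T) hX hσ (he _ h)
    exact ⟨hσ.scons hk, hV⟩

theorem Decl.const_inv {Δ E c T} (h : Decl Sg Δ E (.const c) T) : TypeOf Sg c T := by
  cases h; assumption

theorem KSubst.nil (Δ : List Kind) (σ : ℕ → Ty) : KSubst Sg [] Δ σ := by
  intro i κ h; simp at h

/-- A payload of kind `T` has no sign, so normalization keeps the direction. -/
theorem nrm_inn_of_kinding {Δ T S} (hT : Kinding Sg .check Δ T .T) :
    nrm .pos (.inn T S) = .inn (nrm .pos T) (nrm .pos S) := by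
  rw [nrm_inn, Pol.flip_pos, dirOp_neg_of_nonNeg hT.nrm_pos.nonNeg, mat]

theorem nrm_out_of_kinding {Δ T S} (hT : Kinding Sg .check Δ T .T) :
    nrm .pos (.out T S) = .out (nrm .pos T) (nrm .pos S) := by
  rw [nrm_out, dirOp_pos hT.nrm_pos.nonNeg, mat_of_nonNeg hT.nrm_pos.nonNeg]

theorem Decl.tapp_tapp_inv (hSg : Sg.WF) {Δ E c X V T U κ} (hc : TypeOf Sg c (.all .T (.all κ X)))
    (hu : ∀ W, TypeOf Sg c W → W = .all .T (.all κ X))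
    (h : Decl Sg Δ E (.tapp (.tapp (.const c) T) U) V) :
    Kinding Sg .check Δ T .T ∧ V = nrm .pos (X.subst (scons U (scons T Ty.var))) := by
  have hK := hc.kinding hSg
  have h₁ : ∀ {W}, Decl Sg Δ E (.tapp (.const c) T) W → _ := fun {W} hW =>
    Decl.tapp_inv hK.all_inv (KSubst.nil Δ Ty.var) (fun W hW => by
      rw [subst_var, hc.normal hSg, hu W hW.const_inv]) hW
  cases h with
  | tapp h hk =>
    have hσ := (h₁ h).1
    exact ⟨hσ 0 _ rfl,
      (Decl.tapp_inv hK.all_inv.all_inv hσ (fun W hW => (h₁ hW).2) (.tapp h hk)).2⟩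

theorem Decl.receive_inv (hSg : Sg.WF) {Δ E T U u V}
    (h : Decl Sg Δ E (.app (.tapp (.tapp (.const .receive) T) U) u) V) :
    ∃ A S, Decl Sg Δ E u (.inn A S) ∧ V = .pair A S ∧ Kinding Sg .check Δ A .T ∧
      nrm .pos A = A := by
  cases h with
  | app h₁ h₂ _ =>
    obtain ⟨hT, hV⟩ := Decl.tapp_tapp_inv hSg TypeOf.receive (fun W hW => by cases hW; rfl) h₁
    change _ = nrm .pos (.arr (.inn T U) (.pair T U)) at hV
    rw [nrm_arr, nrm_inn_of_kinding hT, nrm_pair, polDual, polDual, Ty.arr.injEq] at hV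
    obtain ⟨rfl, rfl⟩ := hV
    exact ⟨_, _, h₂, rfl, hT.nrm_pos, hT.nrm_idem⟩

theorem Decl.send_inv (hSg : Sg.WF) {Δ E T U v u V}
    (h : Decl Sg Δ E (.app (.app (.tapp (.tapp (.const .send) T) U) v) u) V) :
    ∃ A, Decl Sg Δ E v A ∧ Decl Sg Δ E u (.out A V) ∧ Kinding Sg .check Δ A .T ∧
      nrm .pos A = A ∧ ∀ w, E.Lin w → v.Occ w → ¬ u.Occ w := by
  cases h with
  | app h₁ h₂ hs =>
    cases h₁ with
    | app h₁ h₃ _ =>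
      obtain ⟨hT, hV⟩ := Decl.tapp_tapp_inv hSg TypeOf.send (fun W hW => by cases hW; rfl) h₁
      change _ = nrm .pos (.arr T (.arr (.out T U) U)) at hV
      rw [nrm_arr, nrm_arr, nrm_out_of_kinding hT, polDual, polDual, Ty.arr.injEq,
        Ty.arr.injEq] at hV
      obtain ⟨rfl, rfl, rfl⟩ := hV
      exact ⟨_, h₃, h₂, hT.nrm_pos, hT.nrm_idem, fun w hl hw => hs w hl (.inr hw)⟩

theorem Decl.new_inv {Δ E T V} (h : Decl Sg Δ E (.tapp (.const .new) T) V) :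
    Kinding Sg .check Δ T .S ∧ V = .pair (nrm .pos T) (nrm .neg T) := by
  cases h with
  | tapp h hk =>
    cases h.const_inv
    refine ⟨hk, ?_⟩
    change nrm .pos (.pair T (.dual T)) = _
    rw [nrm_pair, nrm_dual, polDual, Pol.flip_pos]

theorem selectType_kinding (hSg : Sg.WF) {ρ d} (hρ : Sg ρ = some d) (k : Fin d.numCons) {j : ℕ}
    (hj : j ≤ d.arity) : Kinding Sg .check (List.replicate (d.arity - j) .P)
      (allP j (.all .S (selectBody ρ d k))) .T := by
  refine Kinding.allP ?_
  rw [List.replicate_append_replicate, Nat.add_sub_cancel' hj]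
  exact (Kinding.all (selectBody_kinding hSg hρ k)).toCheck

/-- The invariant for a partly instantiated `select`: either j parameters and the continuation
variable are still quantified, or all type arguments have been supplied. -/
theorem Decl.isSelect_inv (hSg : Sg.WF) {C e} (he : IsSelect C e) : ∀ {Δ E V}, Decl Sg Δ E e V →
    ∃ ρ d, ∃ k : Fin d.numCons, Sg ρ = some d ∧ d.con k = C ∧
      ((∃ j ≤ d.arity, ∃ σ, KSubst Sg (List.replicate (d.arity - j) .P) Δ σ ∧
          V = nrm .pos ((allP j (.all .S (selectBody ρ d k))).subst σ)) ∨
        ∃ σ, KSubst Sg (.S :: List.replicate d.arity .P) Δ σ ∧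
          V = nrm .pos ((selectBody ρ d k).subst σ)) := by
  induction he with
  | base =>
    intro Δ E V h
    generalize hc : Const.select C = c at h
    have hT := h.const_inv
    cases hT with
    | @select ρ d hρ k =>
      cases hc
      refine ⟨ρ, d, k, hρ, rfl, .inl ⟨d.arity, le_rfl, Ty.var, ?_, ?_⟩⟩
      · rw [Nat.sub_self]; exact KSubst.nil _ _
      · rw [subst_var]; rfl
    | _ => cases hc
  | tapp _ ih =>
    intro Δ E V h
    cases h with
    | tapp h hk =>
      obtain ⟨ρ, d, k, hρ, hC, ⟨j, hj, σ, hσ, hV⟩ | ⟨σ, hσ, hV⟩⟩ := ih h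
      · refine ⟨ρ, d, k, hρ, hC, ?_⟩
        cases j with
        | zero =>
          obtain ⟨rfl, hV⟩ := nrm_all_inst (selectBody_kinding hSg hρ k) hσ hV
          exact .inr ⟨_, hσ.scons hk, hV⟩
        | succ j =>
          have hX := selectType_kinding hSg hρ k (j := j) (by omega)
          have hn : d.arity - j = (d.arity - (j + 1)) + 1 := by omega
          rw [hn, List.replicate_succ] at hX
          obtain ⟨rfl, hV⟩ := nrm_all_inst hX hσ hV
          refine .inl ⟨j, by omega, _, ?_, hV⟩
          rw [hn, List.replicate_succ]
          exact hσ.scons hk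
      -- With all arguments supplied the type is an arrow, so no further type application is
      -- possible.
      · rw [selectBody, Ty.subst, nrm_arr] at hV
        cases hV

theorem Decl.select_inv (hSg : Sg.WF) {C e} (he : IsSelect C e) {Δ E u V}
    (h : Decl Sg Δ E (.app e u) V) : ∃ ρ d, ∃ (k : Fin d.numCons) (U : Fin d.arity → Ty) (S : Ty),
      Sg ρ = some d ∧ d.con k = C ∧ Decl Sg Δ E u (.out (.proto ρ d.arity U) S) ∧
        V = contTy .pos d k U S := by
  cases h with
  | app h₁ h₂ _ =>
    obtain ⟨ρ, d, k, hρ, hC, ⟨j, hj, σ, hσ, hV⟩ | ⟨σ, hσ, hV⟩⟩ := Decl.isSelect_inv hSg he h₁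
    -- While a quantifier remains, the expression cannot be applied to a channel.
    · exfalso
      cases j with
      | zero => rw [AlgST.allP, Ty.subst, nrm_all] at hV; cases hV
      | succ j => rw [AlgST.allP, Ty.subst, nrm_all] at hV; cases hV
    · rw [selectBody, Ty.subst, nrm_arr, polDual, Ty.arr.injEq, Ty.subst, nrm_out, Ty.subst, Ty.subst,
        nrm_proto, polDual, dirOp_pos (by trivial), mat_of_nonNeg (by trivial)] at hV
      obtain ⟨rfl, rfl⟩ := hV
      refine ⟨ρ, d, k, _, _, hρ, hC, h₂, ?_⟩
      have hS : Kinding Sg .check Δ (σ 0) .S := hσ 0 _ rfl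
      simp only [Ty.subst]
      rw [nrm_matSeq_subst, contTy_eq, List.foldr_map, Ty.subst, hS.nrm_idem, Pol.pos_mul,
        ← foldr_args_congr hSg hρ .pos k (σ := fun j => σ (d.arity - j)), List.foldr_map]
      · simp only [subst_subst, Ty.subst]
      · intro i hi
        rw [params, dif_pos hi, Kinding.nrm_idem (hσ (d.arity - i) .P ?_)]
        -- The index of a parameter is positive because index 0 is the continuation variable.
        obtain ⟨i', hi'⟩ : ∃ i', d.arity - i = i' + 1 := ⟨d.arity - i - 1, by omega⟩
        rw [hi', List.getElem?_cons_succ, List.getElem?_replicate, if_pos (by omega)]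

end Inversion

end AlgST

namespace AlgST

open Ty AlgST.Expr

section Preservation

variable {Sg : Sig}

/-! ### Contexts and their transitions -/

/-- An empty output context leaves no room for unrestricted entries or for unused linear ones. -/
theorem Typed.consumed (hSg : Sg.WF) {m Δ v T} {Γ : Ctx} (h : Typed Sg m Δ Γ v T 0)
    (hΓ : Γ.Distinct) : Decl Sg Δ Γ.env v T ∧ ∀ x m T, (x, m, T) ∈ Γ → m = .lin ∧ x ∈ v.fv := by
  obtain ⟨hd, hr⟩ := h.decl hSg hΓ
  refine ⟨hd, fun x m T hx => ?_⟩
  by_contra hn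
  have := Ctx.mem_rest.2 ⟨hx, hn⟩
  rw [← hr] at this
  exact Multiset.notMem_zero _ this

theorem Ctx.Distinct.env_eq {Γ Γ' : Ctx} (hΓ : Γ'.Distinct) (hle : Γ ≤ Γ') {x : Name}
    (hx : x ∈ Γ.dom) : Γ.env (.inl x) = Γ'.env (.inl x) := by
  obtain ⟨m, T, hm⟩ := Ctx.mem_dom.1 hx
  funext m' T'
  refine propext ⟨fun h => Multiset.mem_of_le hle h, fun h => ?_⟩
  obtain ⟨rfl, rfl⟩ := hΓ.unique (Multiset.mem_of_le hle hm) h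
  exact hm

theorem Decl.mono {Δ e T} {Γ Γ' : Ctx} (h : Decl Sg Δ Γ.env e T) (hle : Γ ≤ Γ')
    (hΓ : Γ'.Distinct) : Decl Sg Δ Γ'.env e T := by
  refine h.congr ?_
  rintro (x | i) hw
  · exact hΓ.env_eq hle (h.fv_subset ((occ_inl _ _).1 hw))
  · rfl

theorem Ctx.Distinct.disjoint {Γ Γ' : Ctx} (h : (Γ + Γ').Distinct) {x : Name} (hx : x ∈ Γ.dom) :
    x ∉ Γ'.dom := by
  rw [Ctx.Distinct, Ctx.dom_add, Multiset.nodup_add] at h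
  exact fun hx' => Multiset.disjoint_left.1 h.2.2 hx hx'

theorem Ctx.env_add_left {Γ Γ' : Ctx} {x : Name} (hx : x ∉ Γ'.dom) :
    (Γ + Γ').env (.inl x) = Γ.env (.inl x) := by
  funext m T
  simp only [Ctx.env, Multiset.mem_add, eq_iff_iff]
  exact ⟨fun h => h.resolve_right fun h => hx (Ctx.mem_dom_of_mem h), .inl⟩

@[simp] theorem Ctx.dom_singleton (b : Name × Mult × Ty) : Ctx.dom {b} = {b.1} := rfl

@[simp] theorem Ctx.dom_zero : Ctx.dom 0 = 0 := rfl

/-- The payload in a label is typed with empty output, so the entries that travel with it are linear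
too. -/
theorem CtxSStep.lin_left (hSg : Sg.WF) {Γ σ Γ' x m T} (h : CtxSStep Sg Γ σ Γ') (hΓ : Γ.Distinct)
    (hx : (x, m, T) ∈ Γ) : m = .lin := by
  cases h with
  | snd h =>
    rcases Multiset.mem_add.1 hx with hx | hx
    · exact ((h.consumed hSg (hΓ.mono (Multiset.le_add_right _ _))).2 _ _ _ hx).1
    · cases Multiset.mem_singleton.1 hx; rfl
  | _ => cases Multiset.mem_singleton.1 hx; rfl

theorem CtxSStep.lin_right (hSg : Sg.WF) {Γ σ Γ' x m T} (h : CtxSStep Sg Γ σ Γ')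
    (hΓ : Γ'.Distinct) (hx : (x, m, T) ∈ Γ') : m = .lin := by
  cases h with
  | rcv h =>
    rcases Multiset.mem_add.1 hx with hx | hx
    · exact ((h.consumed hSg (hΓ.mono (Multiset.le_add_right _ _))).2 _ _ _ hx).1
    · cases Multiset.mem_singleton.1 hx; rfl
  | _ => first | (cases Multiset.mem_singleton.1 hx; rfl) | cases Multiset.notMem_zero _ hx

theorem CtxEStep.lin_left (hSg : Sg.WF) {Γ l Γ' x m T} (h : CtxEStep Sg Γ l Γ') (hΓ : Γ.Distinct)
    (hx : (x, m, T) ∈ Γ) : m = .lin := by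
  cases h with
  | sess h => exact h.lin_left hSg hΓ hx
  | fork h => exact ((h.consumed hSg hΓ).2 _ _ _ hx).1
  | _ => cases Multiset.notMem_zero _ hx

theorem CtxEStep.lin_right (hSg : Sg.WF) {Γ l Γ' x m T} (h : CtxEStep Sg Γ l Γ')
    (hΓ : Γ'.Distinct) (hx : (x, m, T) ∈ Γ') : m = .lin := by
  cases h with
  | sess h => exact h.lin_right hSg hΓ hx
  | new =>
    rcases Multiset.mem_cons.1 hx with hx | hx
    · cases hx; rfl
    · cases Multiset.mem_singleton.1 hx; rfl
  | _ => cases Multiset.notMem_zero _ hx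

/-- The names that a process must own in order to perform a session operation. -/
def SLabel.need : SLabel → Finset Name
  | rcv x _ => {x}
  | snd x v => {x} ∪ v.fv
  | rcvC x _ => {x}
  | sndC x _ => {x}
  | wait x => {x}
  | term x => {x}

theorem CtxSStep.dom_subset (hSg : Sg.WF) {Γ σ Γ' x} (h : CtxSStep Sg Γ σ Γ') (hΓ : Γ.Distinct)
    (hx : x ∈ Γ.dom) : x ∈ σ.need := by
  cases h with
  | snd h =>
    simp only [Ctx.dom_add, Ctx.dom_singleton, Multiset.mem_add, Multiset.mem_singleton] at hx
    simp only [SLabel.need, Finset.mem_union, Finset.mem_singleton]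
    rcases hx with hx | hx
    · obtain ⟨m, T, hx⟩ := Ctx.mem_dom.1 hx
      exact .inr ((h.consumed hSg (hΓ.mono (Multiset.le_add_right _ _))).2 _ _ _ hx).2
    · exact .inl hx
  | _ => simpa [SLabel.need] using hx

theorem EStep.need_subset {e e' σ x} (h : EStep e (.sess σ) e') (hx : x ∈ σ.need) : x ∈ e.fv := by
  generalize hl : ELabel.sess σ = l at h
  induction h with
  | rcv | send | mtch | sel | wait | term =>
    cases hl
    simp only [SLabel.need, Finset.mem_union, Finset.mem_singleton] at hx
    simp only [fv, Finset.mem_union, Finset.mem_singleton]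
    tauto
  | appL _ ih | pairL _ ih | mtchE _ ih | letpE _ ih | letuE _ ih =>
    exact Finset.mem_union_left _ (ih hl)
  | appR _ _ ih | pairR _ _ ih => exact Finset.mem_union_right _ (ih hl)
  | tappE _ ih => exact ih hl
  | _ => cases hl

theorem EStep.fork_subset {e e' v x} (h : EStep e (.fork v) e') (hx : x ∈ v.fv) : x ∈ e.fv := by
  generalize hl : ELabel.fork v = l at h
  induction h with
  | fork => cases hl; exact Finset.mem_union_right _ hx
  | appL _ ih | pairL _ ih | mtchE _ ih | letpE _ ih | letuE _ ih =>
    exact Finset.mem_union_left _ (ih hl)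
  | appR _ _ ih | pairR _ _ ih => exact Finset.mem_union_right _ (ih hl)
  | tappE _ ih => exact ih hl
  | _ => cases hl

/-- Whatever a context transition takes away is named in the label, and these names come from the
redex. Separation then keeps them out of the rest of the expression. -/
theorem EStep.dom_subset (hSg : Sg.WF) {e l e' Γ Γ' x} (h : EStep e l e')
    (hc : CtxEStep Sg Γ l Γ') (hΓ : Γ.Distinct) (hx : x ∈ Γ.dom) : x ∈ e.fv := by
  cases hc with
  | sess hc => exact h.need_subset (hc.dom_subset hSg hΓ hx)
  | fork hv =>
    obtain ⟨m, T, hx⟩ := Ctx.mem_dom.1 hx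
    exact h.fork_subset ((hv.consumed hSg hΓ).2 _ _ _ hx).2
  | _ => cases Multiset.notMem_zero _ hx

/-! ### Preservation for expressions -/

/-- A transition of the part `Γ₂` of the context `Γ + Γ₂` to `Γ₂'`. -/
structure Change (Sg : Sig) (Δ : List Kind) (Γ Γ₂ Γ₂' : Ctx) (l : ELabel) : Prop where
  step : CtxEStep Sg Γ₂ l Γ₂'
  left : (Γ + Γ₂).Distinct
  right : (Γ + Γ₂').Distinct
  wf : ∀ b ∈ Γ + Γ₂, Kinding Sg .check Δ b.2.2 .T ∧ nrm .pos b.2.2 = b.2.2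

/-- The expressions `e₁` in the context `Γ + Γ₂` and `e₂` in `Γ + Γ₂'` have the same type and leave
the same part of `Γ` unused. -/
structure Preserved (Sg : Sig) (Δ : List Kind) (Γ Γ₂ Γ₂' : Ctx) (e₁ e₂ : Expr) (T : Ty) :
    Prop where
  decl : Decl Sg Δ (Γ + Γ₂').env e₂ T
  occ : ∀ x, (Γ + Γ₂').env.Lin (.inl x) →
    (e₂.Occ (.inl x) ↔ x ∈ Γ₂'.dom ∨ e₁.Occ (.inl x) ∧ x ∉ Γ₂.dom)

variable {Δ : List Kind} {Γ Γ₂ Γ₂' : Ctx} {l : ELabel}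

theorem Change.normalOn (hc : Change Sg Δ Γ Γ₂ Γ₂' l) (P : Var → Prop) :
    NormalOn (Γ + Γ₂).env P := by
  rintro (x | i) m T _ h
  · exact (hc.wf _ h).2
  · exact h.elim

/-- The part of an expression that is not involved in a transition. -/
theorem Change.frame (hSg : Sg.WF) (hc : Change Sg Δ Γ Γ₂ Γ₂' l) {e₁ e₂ : Expr} {T : Ty}
    {P : Var → Prop} (h : EStep e₁ l e₂) (hp : Preserved Sg Δ Γ Γ₂ Γ₂' e₁ e₂ T)
    (hs : ∀ w, (Γ + Γ₂).env.Lin w → e₁.Occ w → ¬ P w)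
    (hd : ∀ w, P w → ∃ m T, (Γ + Γ₂).env w m T) :
    (∀ w, P w → (Γ + Γ₂).env w = (Γ + Γ₂').env w) ∧
      (∀ w, (Γ + Γ₂').env.Lin w → e₂.Occ w → ¬ P w) ∧
      (∀ x, (Γ + Γ₂').env.Lin (.inl x) → (e₂.Occ (.inl x) ∨ P (.inl x) ↔
        x ∈ Γ₂'.dom ∨ (e₁.Occ (.inl x) ∨ P (.inl x)) ∧ x ∉ Γ₂.dom)) ∧
      ∀ w, P w → ((Γ + Γ₂').env.Lin w ↔ (Γ + Γ₂).env.Lin w) := by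
  have hΓ₂ : Γ₂.Distinct := hc.left.mono (Multiset.le_add_left _ _)
  -- Entries of `Γ₂` are linear and occur in the part that moves, so the frame cannot mention them.
  have h₂ : ∀ x, P (.inl x) → x ∉ Γ₂.dom := by
    intro x hP hx
    obtain ⟨m, T, hm⟩ := Ctx.mem_dom.1 hx
    cases hc.step.lin_left hSg hΓ₂ hm
    exact hs (.inl x) ⟨T, Multiset.mem_add.2 (.inr hm)⟩
      ((occ_inl _ _).2 (h.dom_subset hSg hc.step hΓ₂ hx)) hP
  -- The names of the frame are therefore in `Γ`, which is disjoint from the entries that the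
  -- transition creates.
  have h₂' : ∀ x, P (.inl x) → x ∉ Γ₂'.dom := by
    intro x hP
    obtain ⟨m, T, hm⟩ := hd _ hP
    have hx := Ctx.mem_dom_of_mem hm
    rw [Ctx.dom_add, Multiset.mem_add] at hx
    exact hc.right.disjoint (hx.resolve_right (h₂ x hP))
  have heq : ∀ w, P w → (Γ + Γ₂).env w = (Γ + Γ₂').env w := by
    rintro (x | i) hP
    · rw [Ctx.env_add_left (h₂ x hP), Ctx.env_add_left (h₂' x hP)]
    · rfl
  refine ⟨heq, ?_, ?_, fun w hP => (Env.lin_congr (heq w hP)).symm⟩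
  · rintro (x | i) hl ho hP
    · have := ((hp.occ x hl).1 ho).resolve_left (h₂' x hP)
      exact hs _ ((Env.lin_congr (heq _ hP)).2 hl) this.1 hP
    · exact hl.elim fun _ h => h
  · intro x hl
    rw [hp.occ x hl]
    have := h₂ x
    tauto

theorem Ctx.push_env {Γ : Ctx} {m A} {w : Var} (hw : w ≠ .inr 0) :
    Γ.env.push m A w = Γ.env w := by
  rcases w with x | i
  · rfl
  · cases i with
    | zero => exact absurd rfl hw
    | succ i => rfl

theorem OpenEnv.of_ctx {Γ : Ctx} {m A u} {P : Var → Prop}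
    (hs : ∀ w, Γ.env.Lin w → u.Occ w → ¬ P w) :
    OpenEnv (Γ.env.push m A) Γ.env 0 m A u P :=
  ⟨fun _ hw _ => Ctx.push_env hw, rfl, hs⟩

theorem Change.subst (hSg : Sg.WF) (hc : Change Sg Δ Γ Γ₂ Γ₂' l) {u A} (m : Mult)
    (hu : Decl Sg Δ (Γ + Γ₂).env u A) (hv : IsValue u)
    (hm : m = .un → ∀ w, (Γ + Γ₂).env.Lin w → ¬ u.Occ w) : Subst Sg Δ (Γ + Γ₂).env m A u :=
  ⟨hv, hu.lc, hu, hu.normal hSg (hc.normalOn _), hc.normalOn _, hm⟩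

theorem Change.beta (hc : Change Sg Δ Γ Γ₂ Γ₂' .beta) : Γ₂ = 0 ∧ Γ₂' = 0 := by
  cases hc.step; exact ⟨rfl, rfl⟩

/-- Transitions without an effect on the context. -/
theorem Change.preserved_beta (hc : Change Sg Δ Γ Γ₂ Γ₂' .beta) {e₁ e₂ : Expr} {T : Ty}
    (h : Decl Sg Δ (Γ + Γ₂).env e₂ T)
    (ho : ∀ w, (Γ + Γ₂).env.Lin w → (e₂.Occ w ↔ e₁.Occ w)) :
    Preserved Sg Δ Γ Γ₂ Γ₂' e₁ e₂ T := by
  obtain ⟨rfl, rfl⟩ := hc.beta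
  exact ⟨h, fun x hl => by simp [ho _ hl]⟩

theorem lin_ctx_cases {Γ : Ctx} {p : Var → Prop} (h : ∀ x, Γ.env.Lin (.inl x) → p (.inl x)) (w : Var)
    (hw : Γ.env.Lin w) : p w := by
  rcases w with x | i
  · exact h x hw
  · exact hw.elim fun _ h => h.elim

/-- The bound variable occurs in the body, so the linear variables of the argument survive and the
redex and its contractum have the same linear names. -/
theorem preserved_app_abs (hSg : Sg.WF) (hc : Change Sg Δ Γ Γ₂ Γ₂' .beta) {T e v V}
    (hv : IsValue v) (h : Decl Sg Δ (Γ + Γ₂).env (.app (.abs T e) v) V) :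
    Preserved Sg Δ Γ Γ₂ Γ₂' (.app (.abs T e) v) (e.open1 v) V := by
  cases h with
  | app h₁ h₂ hs =>
    cases h₁ with
    | abs hk h h0 =>
      have hu := hc.subst hSg .lin h₂ hv (fun h => by cases h)
      refine hc.preserved_beta (h.openAt hSg hu (OpenEnv.of_ctx (lin_ctx_cases fun x hl ho hP =>
        hs (.inl x) hl hP ho))) (lin_ctx_cases fun x hl => ?_)
      rw [Expr.open1, occ_openAt _ _ _ hu.lc]
      simp [OpenOcc, Occ, h0]

/-- The body is typed over the shifted context. Instantiation undoes the shift, and the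
normalization is void since the context is in normal form. -/
theorem preserved_tapp_tabs (hSg : Sg.WF) (hc : Change Sg Δ Γ Γ₂ Γ₂' .beta) {κ v T V}
    (h : Decl Sg Δ (Γ + Γ₂).env (.tapp (.tabs κ v) T) V) :
    Preserved Sg Δ Γ Γ₂ Γ₂' (.tapp (.tabs κ v) T) (v.tinst T) V := by
  cases h with
  | tapp h hk =>
    cases h with
    | tabs hv h =>
      have hT : ∀ T₀ : Ty, T₀.shift.subst (single T) = T₀ := fun T₀ => shift_inst T₀ T
      refine hc.preserved_beta ?_ fun w _ => occ_tsubst _ _ _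
      refine (h.tsubst hSg (KSubst.single hk)).congr fun w hw => ?_
      rw [Env.map_map]
      funext m T'
      refine propext ⟨?_, fun h => ⟨T', h, ?_⟩⟩
      · rintro ⟨T₀, h, rfl⟩
        simp only [hT]
        rw [hc.normalOn (fun _ => True) w m T₀ trivial h]
        exact h
      · simp only [hT]
        rw [hc.normalOn (fun _ => True) w m T' trivial h]

theorem preserved_letp (hSg : Sg.WF) (hc : Change Sg Δ Γ Γ₂ Γ₂' .beta) {u v e V}
    (hu : IsValue u) (hv : IsValue v) (h : Decl Sg Δ (Γ + Γ₂).env (.letp (.pair u v) e) V) :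
    Preserved Sg Δ Γ Γ₂ Γ₂' (.letp (.pair u v) e) (e.open2 u v) V := by
  cases h with
  | letp h₁ h h0 h1 hs =>
    cases h₁ with
    | pair h₁ h₂ hs' =>
      have hu' := hc.subst hSg .lin h₁ hu (fun h => by cases h)
      have hv' := hc.subst hSg .lin h₂ hv (fun h => by cases h)
      rw [hu'.normal, hv'.normal] at h
      have h' := h.openAt hSg (hu'.push .lin _) (OpenEnv.push (P := e.Occ) (OpenEnv.of_ctx
        (lin_ctx_cases fun x hl ho hP => hs (.inl x) hl (.inl ho) hP)) hu'.lc _ _)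
      have h'' := h'.openAt hSg hv' (OpenEnv.of_ctx (lin_ctx_cases ?_))
      · refine hc.preserved_beta h'' (lin_ctx_cases fun x hl => ?_)
        rw [Expr.open2, occ_openAt _ _ _ hv'.lc]
        simp only [OpenOcc, occ_openAt _ _ _ hu'.lc, Occ]
        simp [h0, h1]
        tauto
      · intro x hl ho hP
        rw [occ_openAt _ _ _ hu'.lc] at hP
        rcases hP with ⟨_, hP⟩ | ⟨_, hP⟩
        · exact hs (.inl x) hl (.inr ho) hP
        · exact hs' _ hl hP ho

/-- Unfolding may copy or drop the recursive value; neither matters because it contains no linear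
variable. -/
theorem preserved_recf (hSg : Sg.WF) (hc : Change Sg Δ Γ Γ₂ Γ₂' .beta) {T v u V}
    (h : Decl Sg Δ (Γ + Γ₂).env (.app (.recf T v) u) V) :
    Preserved Sg Δ Γ Γ₂ Γ₂' (.app (.recf T v) u) (.app (v.open1 (.recf T v)) u) V := by
  cases h with
  | app h₁ h₂ hs =>
    have h₁' := h₁
    generalize hA : Ty.arr _ V = A at h₁
    cases h₁ with
    | @recf _ _ T U _ hv hk h hn =>
      have hlc : (Expr.recf (.arr T U) v).LC := h₁'.lc
      have hu := hc.subst hSg .un (hA ▸ h₁') (.recf hv) fun _ w hl ho => hn w hl ho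
      have h' := h.openAt hSg hu (OpenEnv.of_ctx fun w hl ho => absurd ho (hn w hl))
      rw [← hA] at h'
      have hno : ∀ w, (Γ + Γ₂).env.Lin w → ¬ (v.openAt 0 (.recf (.arr T U) v)).Occ w := by
        refine lin_ctx_cases fun x hl ho => ?_
        rw [occ_openAt _ _ _ hlc] at ho
        exact hn (.inl x) hl (ho.elim And.right And.right)
      refine hc.preserved_beta (.app h' h₂ fun w hl ho => absurd ho (hno w hl)) ?_
      intro w hl
      have h₁ := hno w hl
      have h₂ := hn w hl
      simp only [Occ, Expr.open1]
      tauto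

theorem Decl.fvar_inv {Δ e T x} {Γ : Ctx} (h : Decl Sg Δ Γ.env e T) (he : e = .fvar x) :
    ∃ m, (x, m, T) ∈ Γ := by
  subst he
  cases h with | fvar h _ => exact ⟨_, h⟩

/-- By distinctness of names, the type that the redex gives to its channel is the one that the
context transition rewrites. -/
theorem Change.mem_unique (hc : Change Sg Δ Γ Γ₂ Γ₂' l) {x m T T'} (hx : (x, m, T) ∈ Γ₂)
    (h : Decl Sg Δ (Γ + Γ₂).env (.fvar x) T') : T' = T := by
  obtain ⟨m', h'⟩ := h.fvar_inv rfl
  exact ((hc.left.unique (Multiset.mem_add.2 (.inr hx)) h').2).symm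

/-- The continuation of a channel. -/
theorem Decl.fvar_right {x m T} (hx : (x, m, T) ∈ Γ₂')
    (hT : Kinding Sg .check Δ T .S) : Decl Sg Δ (Γ + Γ₂').env (.fvar x) T :=
  .fvar (m := m) (Multiset.mem_add.2 (.inr hx)) (hT.weaken (Kind.Sub.ofS _))

theorem Change.kinding (hc : Change Sg Δ Γ Γ₂ Γ₂' l) {x m T} (hx : (x, m, T) ∈ Γ₂) :
    Kinding Sg .check Δ T .T :=
  (hc.wf _ (Multiset.mem_add.2 (.inr hx))).1

theorem occ_iff_of_consumed (hSg : Sg.WF) {m Δ v T} {Γ : Ctx} (h : Typed Sg m Δ Γ v T 0)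
    (hΓ : Γ.Distinct) (x : Name) : v.Occ (.inl x) ↔ x ∈ Γ.dom := by
  obtain ⟨hd, hl⟩ := h.consumed hSg hΓ
  refine ⟨fun ho => hd.fv_subset ((occ_inl _ _).1 ho), fun hx => ?_⟩
  obtain ⟨m, T, hx⟩ := Ctx.mem_dom.1 hx
  exact (occ_inl _ _).2 (hl _ _ _ hx).2

theorem CtxEStep.sess_inv {σ} (h : CtxEStep Sg Γ₂ (.sess σ) Γ₂') : CtxSStep Sg Γ₂ σ Γ₂' := by
  cases h; assumption

theorem CtxSStep.rcvC_inv {x c} (h : CtxSStep Sg Γ₂ (.rcvC x c) Γ₂') :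
    ∃ ρ d S, ∃ (U : Fin d.arity → Ty) (k : Fin d.numCons), Sg ρ = some d ∧ d.con k = c ∧
      Γ₂ = {(x, .lin, .inn (.proto ρ d.arity U) S)} ∧ Γ₂' = {(x, .lin, contTy .neg d k U S)} := by
  cases h with | rcvC hρ k => exact ⟨_, _, _, _, k, hρ, rfl, rfl, rfl⟩

theorem CtxSStep.sndC_inv {x c} (h : CtxSStep Sg Γ₂ (.sndC x c) Γ₂') :
    ∃ ρ d S, ∃ (U : Fin d.arity → Ty) (k : Fin d.numCons), Sg ρ = some d ∧ d.con k = c ∧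
      Γ₂ = {(x, .lin, .out (.proto ρ d.arity U) S)} ∧ Γ₂' = {(x, .lin, contTy .pos d k U S)} := by
  cases h with | sndC hρ k => exact ⟨_, _, _, _, k, hρ, rfl, rfl, rfl⟩

theorem proto_inj_of_decl {ρ ρ' d d'} {U : Fin d.arity → Ty} {U' : Fin d'.arity → Ty}
    (hρ : Sg ρ = some d) (hρ' : Sg ρ' = some d')
    (h : Ty.proto ρ d.arity U = Ty.proto ρ' d'.arity U') :
    ρ = ρ' ∧ ∃ hd : d = d', U = hd ▸ U' := by
  obtain ⟨rfl, _, hU⟩ := Ty.proto.inj h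
  cases hρ.symm.trans hρ'
  exact ⟨rfl, rfl, eq_of_heq hU⟩

/-- The channel is linear and occurs in the scrutinee, so it is fresh for the chosen branch; opening
the branch with it is therefore opening with a fresh name, now at the continuation type. -/
theorem preserved_mtch (hSg : Sg.WF) {x n} {C : Fin n → Name} {b : Fin n → Expr} {k : Fin n} {V}
    (hc : Change Sg Δ Γ Γ₂ Γ₂' (.sess (.rcvC x (C k))))
    (h : Decl Sg Δ (Γ + Γ₂).env (.mtch (.fvar x) n C b) V) :
    Preserved Sg Δ Γ Γ₂ Γ₂' (.mtch (.fvar x) n C b) ((b k).open1 (.fvar x)) V := by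
  obtain ⟨ρ, d, S, U, k', hρ, hk', rfl, rfl⟩ := hc.step.sess_inv.rcvC_inv
  cases h with
  | @mtch _ _ ρ' d' U' S' _ _ _ _ _ π hρ' hC he hb h0 hcons hs =>
    have hT := hc.mem_unique (Multiset.mem_singleton_self _) he
    obtain ⟨hP, rfl⟩ := Ty.inn.inj hT
    obtain ⟨rfl, rfl, rfl⟩ := proto_inj_of_decl hρ' hρ hP
    -- Constructor names are distinct within a declaration, so the label determines the branch.
    have hkk : k' = π k := (hSg _ _ hρ).2.1 (by rw [← hC, hk'])
    subst hkk
    have hx : x ∉ (b k).fv := fun hx =>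
      hs k (.inl x) ⟨_, Multiset.mem_add.2 (.inr (Multiset.mem_singleton_self _))⟩ rfl
        ((occ_inl _ _).2 hx)
    have hk := (hc.kinding (Multiset.mem_singleton_self _)).inn_inv
    have hck := (contTy_kinding hSg hρ .neg (π k) (Kinding.proto_inv hρ hk.1) hk.2).weaken
      (Kind.Sub.ofS .T)
    have hΓx : x ∉ Γ.dom := fun hx => hc.left.disjoint hx (by simp)
    have hN := NameEnv.cons (m := .lin) (A := contTy .neg d' (π k) U' S') hΓx
    rw [← Multiset.singleton_add, add_comm] at hN
    refine ⟨((hb k).congr (E' := Γ.env.push .lin (contTy .neg d' (π k) U' S'))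
      (Env.push_congr fun w hw => ?_)).open_name hSg hN hx hck.nrm_pos hck.nrm_idem, ?_⟩
    · rcases w with y | i
      · refine Ctx.env_add_left ?_
        rw [Ctx.dom_singleton, Multiset.mem_singleton]
        rintro rfl
        exact hx ((occ_inl _ _).1 hw)
      · rfl
    · intro y hy
      rw [Expr.open1, occ_openAt _ _ _ (LC.fvar x)]
      by_cases hyx : y = x
      · subst hyx
        simp [OpenOcc, Occ, h0]
      · have hz : ∀ T, y ∉ Ctx.dom {(x, Mult.lin, T)} := fun T => by simpa using hyx
        -- Away from the channel the context is unchanged, so the agreement of the branches on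
        -- linear variables applies.
        have hy' := (Env.lin_congr ((Ctx.env_add_left (Γ := Γ) (hz _)).trans
          (Ctx.env_add_left (hz (.inn (.proto ρ' d'.arity U') S'))).symm)).1 hy
        simp only [OpenOcc, Occ, Ctx.dom_singleton, Multiset.mem_singleton, hyx,
          Sum.inl.injEq, not_false_eq_true, and_true, and_false, or_false, false_or, ne_eq,
          reduceCtorEq, true_and, Var.up_inl]
        exact ⟨fun h => ⟨k, h⟩, fun ⟨i, h⟩ => hcons i k (.inl y) hy' h⟩

/-- The received value comes with its own context and without type variables, and is moved into the
ambient judgement by `Decl.extend` and `Decl.mono`. -/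
theorem preserved_rcv (hSg : Sg.WF) {T U x v V} (hc : Change Sg Δ Γ Γ₂ Γ₂' (.sess (.rcv x v)))
    (h : Decl Sg Δ (Γ + Γ₂).env (.app (.tapp (.tapp (.const .receive) T) U) (.fvar x)) V) :
    Preserved Sg Δ Γ Γ₂ Γ₂' (.app (.tapp (.tapp (.const .receive) T) U) (.fvar x))
      (.pair v (.fvar x)) V := by
  obtain ⟨A, S, hu, rfl, hA, _⟩ := h.receive_inv hSg
  cases hc.step.sess_inv with
  | @rcv Γv _ _ T' S' hv =>
    obtain ⟨rfl, rfl⟩ := Ty.inn.inj (hc.mem_unique (Multiset.mem_singleton_self _) hu)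
    have hle : Γv ≤ Γ + (Γv + {(x, .lin, S)}) :=
      (Multiset.le_add_right _ _).trans (Multiset.le_add_left _ _)
    have hd := hc.right.mono hle
    have hk := (hc.kinding (Multiset.mem_singleton_self _)).inn_inv
    have hx : x ∉ Γv.dom := fun hx =>
      (hc.right.mono (Multiset.le_add_left _ _)).disjoint hx (by simp)
    refine ⟨.pair (((hv.consumed hSg hd).1.extend Δ).mono hle hc.right)
      (.fvar_right (m := .lin) (by simp) hk.2) ?_, ?_⟩
    · rintro w _ ho rfl
      exact hx ((occ_iff_of_consumed hSg hv hd x).1 ho)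
    · intro y _
      simp [Occ, occ_iff_of_consumed hSg hv hd]

theorem preserved_send (hSg : Sg.WF) {T U x v V} (hc : Change Sg Δ Γ Γ₂ Γ₂' (.sess (.snd x v)))
    (h : Decl Sg Δ (Γ + Γ₂).env (.app (.app (.tapp (.tapp (.const .send) T) U) v) (.fvar x)) V) :
    Preserved Sg Δ Γ Γ₂ Γ₂' (.app (.app (.tapp (.tapp (.const .send) T) U) v) (.fvar x))
      (.fvar x) V := by
  obtain ⟨A, _, hu, _⟩ := h.send_inv hSg
  cases hc.step.sess_inv with
  | @snd Γv _ _ T' S' hv =>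
    obtain ⟨rfl, rfl⟩ := Ty.out.inj (hc.mem_unique (m := .lin) (T := .out T' S') (by simp) hu)
    have hd : Γv.Distinct :=
      hc.left.mono ((Multiset.le_add_right _ _).trans (Multiset.le_add_left _ _))
    have hk := (hc.kinding (m := .lin) (T := .out A V) (x := x) (by simp)).out_inv
    refine ⟨.fvar_right (m := .lin) (by simp) hk.2, fun y _ => ?_⟩
    simp only [Occ, occ_iff_of_consumed hSg hv hd, Sum.inl.injEq, Ctx.dom_singleton,
      Multiset.mem_singleton, Ctx.dom_add, Multiset.mem_add]
    tauto

theorem preserved_select (hSg : Sg.WF) {C e x V} (he : IsSelect C e)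
    (hc : Change Sg Δ Γ Γ₂ Γ₂' (.sess (.sndC x C)))
    (h : Decl Sg Δ (Γ + Γ₂).env (.app e (.fvar x)) V) :
    Preserved Sg Δ Γ Γ₂ Γ₂' (.app e (.fvar x)) (.fvar x) V := by
  obtain ⟨ρ, d, k, U, S, hρ, hk, hu, rfl⟩ := h.select_inv hSg he
  obtain ⟨ρ', d', S', U', k', hρ', hk', rfl, rfl⟩ := hc.step.sess_inv.sndC_inv
  obtain ⟨hP, rfl⟩ := Ty.out.inj (hc.mem_unique (Multiset.mem_singleton_self _) hu)
  obtain ⟨rfl, rfl, rfl⟩ := proto_inj_of_decl hρ hρ' hP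
  obtain rfl : k = k' := (hSg _ _ hρ).2.1 (hk.trans hk'.symm)
  have hkd := (hc.kinding (Multiset.mem_singleton_self _)).out_inv
  have hck := contTy_kinding hSg hρ .pos k (Kinding.proto_inv hρ hkd.1) hkd.2
  refine ⟨.fvar_right (Multiset.mem_singleton_self _) hck.nrm_pos, fun y _ => ?_⟩
  have : ¬ e.Occ (.inl y) := by
    clear * - he
    induction he with
    | base => exact id
    | tapp _ ih => exact ih
  simp [Occ, this]

/-- Transitions preserve types. -/
theorem EStep.preserved (hSg : Sg.WF) {e₁ e₂ : Expr} (hstep : EStep e₁ l e₂)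
    (hc : Change Sg Δ Γ Γ₂ Γ₂' l) : ∀ {T}, Decl Sg Δ (Γ + Γ₂).env e₁ T →
    Preserved Sg Δ Γ Γ₂ Γ₂' e₁ e₂ T := by
  have flip : ∀ {P Q : Var → Prop}, (∀ w, (Γ + Γ₂).env.Lin w → P w → ¬ Q w) →
    ∀ w, (Γ + Γ₂).env.Lin w → Q w → ¬ P w := fun h w hl hq hp => h w hl hp hq
  induction hstep with
  | app hv => intro T h; exact preserved_app_abs hSg hc hv h
  | tapp _ => intro T h; exact preserved_tapp_tabs hSg hc h
  | letp hu hv => intro T h; exact preserved_letp hSg hc hu hv h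
  | letu =>
    intro T h
    cases h with | letu _ h _ => exact hc.preserved_beta h fun w _ => by simp [Occ]
  | recf _ _ => intro T h; exact preserved_recf hSg hc h
  | fork hv =>
    intro T h
    cases h with
    | app h₁ h₂ _ =>
      cases h₁.const_inv
      cases hc.step with
      | fork hv =>
        refine ⟨.const .unit, fun x _ => ?_⟩
        simp [Occ, occ_iff_of_consumed hSg hv (hc.left.mono (Multiset.le_add_left _ _))]
  | new x y =>
    intro T h
    obtain ⟨hk, rfl⟩ := h.new_inv
    cases hc.step
    have hxy : x ≠ y := by
      have := hc.right.mono (Multiset.le_add_left _ _)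
      rintro rfl
      exact (Ctx.distinct_cons.1 this).1 (by simp)
    refine ⟨.pair (.fvar_right (m := .lin) (by simp) hk.nrm_pos)
      (.fvar_right (m := .lin) (by simp) (hk.nrm _ (.inr rfl))) ?_, ?_⟩
    · rintro w _ rfl h
      exact hxy (Sum.inl.inj h)
    · intro z _; simp [Occ]
  | rcv hv => intro T h; exact preserved_rcv hSg hc h
  | send hv => intro T h; exact preserved_send hSg hc h
  | mtch k => intro T h; exact preserved_mtch hSg hc h
  | sel he => intro T h; exact preserved_select hSg he hc h
  | wait =>
    intro T h
    cases h with
    | app h₁ h₂ _ =>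
      cases h₁.const_inv
      cases hc.step.sess_inv
      exact ⟨.const .unit, fun x _ => by simp [Occ]⟩
  | term =>
    intro T h
    cases h with
    | app h₁ h₂ _ =>
      cases h₁.const_inv
      cases hc.step.sess_inv
      exact ⟨.const .unit, fun x _ => by simp [Occ]⟩
  -- From here on the redex lies deeper: `Change.frame` retypes the siblings and supplies the
  -- separation and the occurrence invariant.
  | appL hst ih =>
    intro T h
    cases h with
    | app h₁ h₂ hs =>
      have hp := ih hc h₁
      obtain ⟨heq, hs', ho, _⟩ := hc.frame hSg hst hp hs h₂.dom
      exact ⟨.app hp.decl (h₂.congr heq) hs', ho⟩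
  | appR hv hst ih =>
    intro T h
    cases h with
    | app h₁ h₂ hs =>
      have hp := ih hc h₂
      obtain ⟨heq, hs', ho, _⟩ := hc.frame hSg hst hp (flip hs) h₁.dom
      refine ⟨.app (h₁.congr heq) hp.decl (fun w hl h₁ h₂ => hs' w hl h₂ h₁), fun x hl => ?_⟩
      simpa only [Occ, or_comm] using ho x hl
  | tappE hst ih =>
    intro T h
    cases h with
    | tapp h hk =>
      have hp := ih hc h
      exact ⟨.tapp hp.decl hk, hp.occ⟩
  | pairL hst ih =>
    intro T h
    cases h with
    | pair h₁ h₂ hs =>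
      have hp := ih hc h₁
      obtain ⟨heq, hs', ho, _⟩ := hc.frame hSg hst hp hs h₂.dom
      exact ⟨.pair hp.decl (h₂.congr heq) hs', ho⟩
  | pairR hv hst ih =>
    intro T h
    cases h with
    | pair h₁ h₂ hs =>
      have hp := ih hc h₂
      obtain ⟨heq, hs', ho, _⟩ := hc.frame hSg hst hp (flip hs) h₁.dom
      refine ⟨.pair (h₁.congr heq) hp.decl (fun w hl h₁ h₂ => hs' w hl h₂ h₁), fun x hl => ?_⟩
      simpa only [Occ, or_comm] using ho x hl
  | letuE hst ih =>
    intro T h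
    cases h with
    | letu h₁ h₂ hs =>
      have hp := ih hc h₁
      obtain ⟨heq, hs', ho, _⟩ := hc.frame hSg hst hp hs h₂.dom
      exact ⟨.letu hp.decl (h₂.congr heq) hs', ho⟩
  | @letpE _ _ _ e₃ hst ih =>
    intro T h
    cases h with
    | letp h₁ h₂ h0 h1 hs =>
      have hp := ih hc h₁
      obtain ⟨heq, hs', ho, _⟩ := hc.frame hSg (P := fun w => e₃.Occ w.up.up) hst hp hs
        fun w hw => by simpa using h₂.dom _ hw
      exact ⟨.letp hp.decl (h₂.congr (Env.push_congr (Env.push_congr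
        (P := fun w => e₃.Occ w.up) heq))) h0 h1 hs', ho⟩
  | @mtchE _ _ _ n C b hst ih =>
    intro T h
    cases h with
    | mtch π hρ hC h hb h0 hcons hs =>
      have hp := ih hc h
      obtain ⟨heq, hs', ho, hl'⟩ := hc.frame hSg (P := fun w => ∃ i, (b i).Occ w.up) hst hp
        (fun w hl ho ⟨i, hi⟩ => hs i w hl ho hi)
        fun w ⟨i, hi⟩ => by simpa using (hb i).dom _ hi
      exact ⟨.mtch π hρ hC hp.decl (fun i => (hb i).congr (Env.push_congr
        fun w hw => heq w ⟨i, hw⟩)) h0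
        (fun i j w hl hi => hcons i j w ((hl' w ⟨i, hi⟩).1 hl) hi)
        (fun i w hl ho hi => hs' w hl ho ⟨i, hi⟩), ho⟩

/-- Transitions preserve algorithmic typing. -/
theorem EStep.typed (hSg : Sg.WF) {Γ₁ Γ₃ : Ctx} {e₁ e₂ : Expr} {m T} (hstep : EStep e₁ l e₂)
    (h : Typed Sg m Δ (Γ₁ + Γ₂ + Γ₃) e₁ T Γ₃) (hc : CtxEStep Sg Γ₂ l Γ₂')
    (hwf : Ctx.WF Sg Δ (Γ₁ + Γ₂ + Γ₃)) (hd : (Γ₁ + Γ₂' + Γ₃).Distinct) :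
    Typed Sg .synth Δ (Γ₁ + Γ₂' + Γ₃) e₂ T Γ₃ := by
  obtain ⟨h, hr⟩ := h.decl hSg hwf.1
  have hcomm : ∀ G : Ctx, Γ₁ + G + Γ₃ = Γ₁ + Γ₃ + G := fun G => add_right_comm _ _ _
  have hch : Change Sg Δ (Γ₁ + Γ₃) Γ₂ Γ₂' l :=
    ⟨hc, by rw [← hcomm]; exact hwf.1, by rw [← hcomm]; exact hd, by rw [← hcomm]; exact hwf.2⟩
  rw [hcomm] at h
  have hp := hstep.preserved hSg hch h
  have ht := hp.decl
  rw [← hcomm] at ht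
  have ht := ht.typed hSg hd
  have hocc : ∀ x T, (x, .lin, T) ∈ Γ₁ + Γ₂' + Γ₃ →
      (x ∈ e₂.fv ↔ x ∈ Γ₂'.dom ∨ x ∈ e₁.fv ∧ x ∉ Γ₂.dom) := by
    intro x T hx
    rw [← occ_inl, ← occ_inl]
    exact hp.occ x ⟨T, by rw [← hcomm]; exact hx⟩
  -- The output is computed on the three parts separately: `Γ₃` was not used by `e₁` and stays so,
  -- every name of `Γ₂'` occurs in `e₂`, and every entry of `Γ₁` was consumed by `e₁` and still is.
  have hr₃ : Γ₃.rest e₂.fv = Γ₃ := by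
    rw [Ctx.rest_eq_self]
    intro x T hx he
    rcases (hocc x T (Multiset.mem_add.2 (.inr hx))).1 he with h₂' | ⟨h₁, _⟩
    · exact hd.disjoint (x := x) (by simp [h₂']) (Ctx.mem_dom_of_mem hx)
    · rw [hr] at hx
      exact (Ctx.mem_rest.1 hx).2 ⟨rfl, h₁⟩
  have hr₂ : Γ₂'.rest e₂.fv = 0 := by
    refine Multiset.eq_zero_of_forall_notMem ?_
    rintro ⟨x, m, T⟩ hx
    obtain ⟨hx, hn⟩ := Ctx.mem_rest.1 hx
    obtain rfl := hc.lin_right hSg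
      (hd.mono ((Multiset.le_add_left _ _).trans (Multiset.le_add_right _ _))) hx
    exact hn ⟨rfl, (hocc x T (by simp [hx])).2 (.inl (Ctx.mem_dom_of_mem hx))⟩
  have hr₁ : Γ₁.rest e₂.fv = 0 := by
    refine Multiset.eq_zero_of_forall_notMem ?_
    rintro ⟨x, m, T⟩ hx
    obtain ⟨hx, hn⟩ := Ctx.mem_rest.1 hx
    have hx₃ : x ∉ Γ₃.dom := hd.disjoint (by simp [Ctx.mem_dom_of_mem hx])
    have hx₂ : x ∉ Γ₂.dom :=
      (hwf.1.mono (Multiset.le_add_right _ _)).disjoint (Ctx.mem_dom_of_mem hx)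
    have : m = .lin ∧ x ∈ e₁.fv := by
      by_contra hn'
      refine hx₃ (Ctx.mem_dom_of_mem (m := m) (T := T) ?_)
      rw [hr, Ctx.mem_rest]
      exact ⟨by simp [hx], hn'⟩
    obtain ⟨rfl, he⟩ := this
    exact hn ⟨rfl, (hocc x T (by simp [hx])).2 (.inr ⟨he, hx₂⟩)⟩
  have : (Γ₁ + Γ₂' + Γ₃).rest e₂.fv = Γ₃ := by
    have hadd : ∀ G G' : Ctx, (G + G').rest e₂.fv = G.rest e₂.fv + G'.rest e₂.fv :=
      fun G G' => Multiset.filter_add _ _ _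
    rw [hadd, hadd, hr₁, hr₂, hr₃, zero_add, zero_add]
  rwa [this] at ht

end Preservation

end AlgST

namespace AlgST

open Ty AlgST.Expr

/-! ### Opening and closing -/

theorem Expr.openAt_closeAt (x : Name) (e : Expr) : ∀ k, ¬ e.Occ (.inr k) →
    (e.closeAt k x).openAt k (.fvar x) = e := by
  induction e with
  | const => intros; rfl
  | fvar y =>
    intro k _
    simp only [closeAt]
    split
    · simp [openAt, *]
    · rfl
  | bvar i =>
    intro k h
    have : i ≠ k := fun hik => h (by rw [hik]; rfl)
    simp [closeAt, openAt, this]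
  | abs T e ih | recf T e ih =>
    intro k h; simp only [closeAt, openAt]; rw [ih _ h]
  | tabs κ e ih =>
    intro k h; simp only [closeAt, openAt]; exact congrArg _ (ih _ h)
  | tapp e T ih =>
    intro k h; simp only [closeAt, openAt]; rw [ih _ h]
  | pair e₁ e₂ ih₁ ih₂ | app e₁ e₂ ih₁ ih₂ | letu e₁ e₂ ih₁ ih₂ | letp e₁ e₂ ih₁ ih₂ =>
    intro k h
    simp only [closeAt, openAt]
    rw [ih₁ _ fun h' => h (.inl h'), ih₂ _ fun h' => h (.inr h')]
  | mtch e n C b ih ihb =>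
    intro k h
    simp only [closeAt, openAt]
    rw [ih _ fun h' => h (.inl h')]
    congr 1
    funext i
    exact ihb i _ fun h' => h (.inr ⟨i, h'⟩)

theorem Expr.closeAt_openAt_comm {x y : Name} (hxy : x ≠ y) (e : Expr) : ∀ j k, j ≠ k →
    (e.closeAt j y).openAt k (.fvar x) = (e.openAt k (.fvar x)).closeAt j y := by
  induction e with
  | const => intros; rfl
  | fvar z =>
    intro j k hjk
    by_cases hzy : z = y <;> simp [closeAt, openAt, hzy, hjk]
  | bvar i =>
    intro j k hjk
    by_cases hik : i = k <;> simp [closeAt, openAt, hik, hxy]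
  | abs T e ih | recf T e ih =>
    intro j k hjk; simp only [closeAt, openAt]; rw [ih _ _ (by simpa)]
  | tabs κ e ih =>
    intro j k hjk; simp only [closeAt, openAt]; exact congrArg _ (ih _ _ hjk)
  | tapp e T ih =>
    intro j k hjk; simp only [closeAt, openAt]; rw [ih _ _ hjk]
  | pair e₁ e₂ ih₁ ih₂ | app e₁ e₂ ih₁ ih₂ | letu e₁ e₂ ih₁ ih₂ | letp e₁ e₂ ih₁ ih₂ =>
    intro j k hjk
    simp only [closeAt, openAt]
    rw [ih₁ _ _ hjk, ih₂ _ _ (by simpa)]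
  | mtch e n C b ih ihb =>
    intro j k hjk
    simp only [closeAt, openAt]
    rw [ih _ _ hjk]
    congr 1
    funext i
    exact ihb i _ _ (by simpa)

theorem Expr.fv_closeAt (x : Name) (e : Expr) : ∀ k, (e.closeAt k x).fv = e.fv \ {x} := by
  induction e with
  | fvar y => intro k; simp only [closeAt]; split <;> ext z <;> simp_all [fv]
  | pair _ _ ih₁ ih₂ | app _ _ ih₁ ih₂ | letu _ _ ih₁ ih₂ | letp _ _ ih₁ ih₂ =>
    intro k; simp only [closeAt, fv, ih₁, ih₂, Finset.union_sdiff_distrib]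
  | mtch e n C b ih ihb =>
    intro k
    simp only [closeAt, fv, ih, ihb]
    ext z
    simp only [Finset.mem_union, Finset.mem_biUnion, Finset.mem_sdiff, Finset.mem_univ, true_and]
    tauto
  | _ => intro k; simp_all [closeAt, fv]

/-! ### Occurrences, opening and closing in processes. -/

namespace Proc

/-- `p.Occ w`: the variable `w` occurs free in `p`. -/
def Occ : Proc → Var → Prop
  | exp e, w => e.Occ w
  | par p q, w => p.Occ w ∨ q.Occ w
  | nu p, w => p.Occ w.up.up

theorem occ_inl (p : Proc) (x : Name) : p.Occ (.inl x) ↔ x ∈ p.fv := by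
  induction p with
  | exp e => exact Expr.occ_inl e x
  | par p q ih₁ ih₂ => simp only [Occ, fv, Finset.mem_union, ih₁, ih₂]
  | nu p ih => exact ih

theorem occ_openAt (x : Name) (p : Proc) : ∀ k w,
    (p.openAt k (.fvar x)).Occ w ↔ OpenOcc k (.fvar x) p.Occ w := by
  induction p with
  | exp e => intro k w; exact Expr.occ_openAt e k _ (LC.fvar x) w
  | par p q ih₁ ih₂ => intro k w; simp only [openAt, Occ, ih₁, ih₂, OpenOcc]; tauto
  | nu p ih =>
    intro k w
    simp only [openAt, Occ, ih, OpenOcc, (LC.fvar x).occ_up, Var.up_inr, ne_eq,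
      Var.up_eq_inr_succ]

theorem openAt_closeAt (x : Name) (p : Proc) : ∀ k, ¬ p.Occ (.inr k) →
    (p.closeAt k x).openAt k (.fvar x) = p := by
  induction p with
  | exp e => intro k h; exact congrArg _ (Expr.openAt_closeAt x e k h)
  | par p q ih₁ ih₂ =>
    intro k h
    simp only [closeAt, openAt]
    rw [ih₁ _ fun h' => h (.inl h'), ih₂ _ fun h' => h (.inr h')]
  | nu p ih => intro k h; exact congrArg _ (ih _ h)

theorem closeAt_openAt_comm {x y : Name} (hxy : x ≠ y) (p : Proc) : ∀ j k, j ≠ k →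
    (p.closeAt j y).openAt k (.fvar x) = (p.openAt k (.fvar x)).closeAt j y := by
  induction p with
  | exp e => intro j k h; exact congrArg _ (Expr.closeAt_openAt_comm hxy e j k h)
  | par p q ih₁ ih₂ =>
    intro j k h; simp only [closeAt, openAt]; rw [ih₁ _ _ h, ih₂ _ _ h]
  | nu p ih => intro j k h; exact congrArg _ (ih _ _ (by simpa))

theorem fv_closeAt (x : Name) (p : Proc) : ∀ k, (p.closeAt k x).fv = p.fv \ {x} := by
  induction p with
  | exp e => intro k; exact Expr.fv_closeAt x e k
  | par p q ih₁ ih₂ => intro k; simp only [closeAt, fv, ih₁, ih₂, Finset.union_sdiff_distrib]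
  | nu p ih => intro k; exact ih _

theorem mem_fv_openAt {p : Proc} {k : ℕ} {x y : Name} :
    y ∈ (p.openAt k (.fvar x)).fv ↔ y ∈ p.fv ∨ y = x ∧ p.Occ (.inr k) := by
  rw [← occ_inl, occ_openAt, OpenOcc, occ_inl]
  simp [Expr.Occ]
  tauto

theorem occ_inr_openAt {p : Proc} {k i : ℕ} {x : Name} :
    (p.openAt k (.fvar x)).Occ (.inr i) ↔ i ≠ k ∧ p.Occ (.inr i) := by
  rw [occ_openAt, OpenOcc]
  simp [Expr.Occ]

theorem fv_subset_openAt {p : Proc} {k : ℕ} {x : Name} : p.fv ⊆ (p.openAt k (.fvar x)).fv :=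
  fun _ h => mem_fv_openAt.2 (.inl h)

theorem fv_subset_opened {p : Proc} {x y : Name} : p.fv ⊆ (p.opened x y).fv :=
  fv_subset_openAt.trans fv_subset_openAt

/-- The size of a process. -/
def size : Proc → ℕ
  | exp _ => 0
  | par p q => p.size + q.size + 1
  | nu p => p.size + 1

theorem size_openAt (p : Proc) : ∀ k u, (p.openAt k u).size = p.size := by
  induction p with
  | exp e => intros; rfl
  | par p q ih₁ ih₂ => intro k u; simp only [openAt, size, ih₁, ih₂]
  | nu p ih => intro k u; simp only [openAt, size, ih]

end Proc

section Proc

variable {Sg : Sig}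

/-! ### Declarative typing of processes -/

/-- Typing of processes, with environments. -/
inductive PDecl (Sg : Sig) : Env → Proc → Prop
  | exp {E e} : Decl Sg [] E e .unit → PDecl Sg E (.exp e)
  | par {E p q} : PDecl Sg E p → PDecl Sg E q → (∀ w, E.Lin w → p.Occ w → ¬ q.Occ w) →
      PDecl Sg E (.par p q)
  | nu {E p T} : Kinding Sg .check [] T .S →
      PDecl Sg ((E.push .lin (nrm .pos T)).push .lin (nrm .neg T)) p →
      p.Occ (.inr 0) → p.Occ (.inr 1) → PDecl Sg E (.nu p)

theorem PDecl.congr {E p} (h : PDecl Sg E p) : ∀ {E' : Env}, (∀ w, p.Occ w → E w = E' w) →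
    PDecl Sg E' p := by
  induction h with
  | exp h => intro E' h'; exact .exp (h.congr h')
  | par _ _ hs ih₁ ih₂ =>
    intro E' h
    exact .par (ih₁ fun w hw => h w (.inl hw)) (ih₂ fun w hw => h w (.inr hw))
      fun w hl h₁ => hs w ((Env.lin_congr (h w (.inl h₁))).2 hl) h₁
  | nu hT _ h0 h1 ih =>
    intro E' h
    exact .nu hT (ih (Env.push_congr (Env.push_congr (P := fun w => Proc.Occ _ w.up) h))) h0 h1

theorem PDecl.dom {E p} (h : PDecl Sg E p) : ∀ w, p.Occ w → ∃ m T, E w m T := by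
  induction h with
  | exp h => exact h.dom
  | par _ _ _ ih₁ ih₂ => intro w hw; exact hw.elim (ih₁ w) (ih₂ w)
  | nu _ _ _ _ ih => intro w hw; simpa using ih _ hw

theorem PDecl.open_name (hSg : Sg.WF) {E p} (h : PDecl Sg E p) : ∀ {G : Env} {k x A},
    NameEnv E G k x .lin A → x ∉ p.fv → Kinding Sg .check [] A .T → nrm .pos A = A →
    PDecl Sg G (p.openAt k (.fvar x)) := by
  induction h with
  | exp h => intro G k x A hE hx hA hn; exact .exp (h.open_name hSg hE hx hA hn)
  | @par E p q _ _ hs ih₁ ih₂ =>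
    intro G k x A hE hx hA hn
    rw [Proc.fv, Finset.mem_union, not_or] at hx
    refine .par (ih₁ hE hx.1 hA hn) (ih₂ hE hx.2 hA hn) ?_
    intro w hl hp hq
    rw [Proc.occ_openAt] at hp hq
    have hwx : ∀ r : Proc, x ∉ r.fv → r.Occ w → w ≠ .inl x := by
      rintro r hr ho rfl
      exact hr ((Proc.occ_inl _ _).1 ho)
    rcases hp with ⟨hwk, hp⟩ | ⟨hp, hpx⟩ <;> rcases hq with ⟨_, hq⟩ | ⟨hq, hqx⟩
    · exact hs w ((Env.lin_congr (hE.agree w hwk (hwx _ hx.1 hp))).2 hl) hp hq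
    · exact hwx _ hx.1 hp hqx
    · exact hwx _ hx.2 hq hpx
    · exact hs (.inr k) ⟨A, by rw [hE.at_index]; exact ⟨rfl, rfl⟩⟩ hp hq
  | nu hT _ h0 h1 ih =>
    intro G k x A hE hx hA hn
    exact .nu hT (ih ((hE.push _ _).push _ _) hx hA hn)
      (Proc.occ_inr_openAt.2 ⟨by simp, h0⟩) (Proc.occ_inr_openAt.2 ⟨by simp, h1⟩)

theorem PDecl.close_name {x A} (p : Proc) : ∀ {E G : Env} {k},
    PDecl Sg G (p.openAt k (.fvar x)) → NameEnv E G k x .lin A → x ∉ p.fv → PDecl Sg E p := by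
  induction p with
  | exp e =>
    intro E G k h hE hx
    cases h with | exp h => exact .exp (h.close_name hE hx)
  | par p q ih₁ ih₂ =>
    intro E G k h hE hx
    rw [Proc.fv, Finset.mem_union, not_or] at hx
    cases h with
    | par h₁ h₂ hs =>
      refine .par (ih₁ h₁ hE hx.1) (ih₂ h₂ hE hx.2) ?_
      intro w hl hp hq
      by_cases hw : w = .inr k
      · subst hw
        refine hs (.inl x) ⟨A, by rw [hE.at_name]; exact ⟨rfl, rfl⟩⟩ ?_ ?_ <;>
          rw [Proc.occ_openAt]
        · exact .inr ⟨hp, rfl⟩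
        · exact .inr ⟨hq, rfl⟩
      · have hwx : w ≠ .inl x := by
          rintro rfl
          exact hx.1 ((Proc.occ_inl _ _).1 hp)
        refine hs w ((Env.lin_congr (hE.agree w hw hwx)).1 hl) ?_ ?_ <;> rw [Proc.occ_openAt]
        · exact .inl ⟨hw, hp⟩
        · exact .inl ⟨hw, hq⟩
  | nu p ih =>
    intro E G k h hE hx
    cases h with
    | nu hT h h0 h1 =>
      exact .nu hT (ih h ((hE.push _ _).push _ _) hx) (Proc.occ_inr_openAt.1 h0).2
        (Proc.occ_inr_openAt.1 h1).2

/-- All entries are linear and occur in `s`. -/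
def Ctx.Used (Γ : Ctx) (s : Finset Name) : Prop := ∀ x m T, (x, m, T) ∈ Γ → m = .lin ∧ x ∈ s

theorem PDecl.mono {p} {Γ Γ' : Ctx} (h : PDecl Sg Γ.env p) (hle : Γ ≤ Γ')
    (hΓ : Γ'.Distinct) : PDecl Sg Γ'.env p := by
  refine h.congr ?_
  rintro (x | i) hw
  · obtain ⟨m, T, hm⟩ := h.dom _ hw
    exact hΓ.env_eq hle (Ctx.mem_dom_of_mem hm)
  · rfl

theorem NameEnv.cons₂ {Γ : Ctx} {x y A B} (hxy : x ≠ y) (hx : x ∉ Γ.dom) (hy : y ∉ Γ.dom) :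
    NameEnv ((Γ.env.push .lin A).push .lin B) ((Ctx.env ((x, .lin, A) ::ₘ Γ)).push .lin B) 1 x
        .lin A ∧
      NameEnv ((Ctx.env ((x, .lin, A) ::ₘ Γ)).push .lin B)
        (Ctx.env ((x, .lin, A) ::ₘ (y, .lin, B) ::ₘ Γ)) 0 y .lin B := by
  refine ⟨(NameEnv.cons hx).push _ _, ?_⟩
  rw [Multiset.cons_swap]
  exact NameEnv.cons (by simp [hxy.symm, hy])

theorem notMem_fv_openAt {p : Proc} {k : ℕ} {x y : Name} (hxy : x ≠ y) (hy : y ∉ p.fv) :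
    y ∉ (p.openAt k (.fvar x)).fv := by
  rw [Proc.mem_fv_openAt]
  rintro (h | ⟨h, _⟩)
  · exact hy h
  · exact hxy h.symm

/-- Splitting a context between parallel processes becomes disjointness of their linear names;
`Ctx.Used` records that nothing is left over. -/
theorem ProcTyped.decl (hSg : Sg.WF) {Γ p} (h : ProcTyped Sg Γ p) :
    Γ.Distinct → PDecl Sg Γ.env p ∧ Γ.Used p.fv := by
  induction h with
  | exp h =>
    intro hΓ
    obtain ⟨hd, hu⟩ := h.consumed hSg hΓ
    exact ⟨.exp hd, hu⟩
  | @par Γ₁ Γ₂ p₁ p₂ _ _ ih₁ ih₂ =>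
    intro hΓ
    obtain ⟨h₁, hu₁⟩ := ih₁ (hΓ.mono (Multiset.le_add_right _ _))
    obtain ⟨h₂, hu₂⟩ := ih₂ (hΓ.mono (Multiset.le_add_left _ _))
    refine ⟨.par (h₁.mono (Multiset.le_add_right _ _) hΓ) (h₂.mono (Multiset.le_add_left _ _) hΓ)
      ?_, ?_⟩
    · rintro (x | i) hl ho₁ ho₂
      · obtain ⟨_, _, hm₁⟩ := h₁.dom _ ho₁
        obtain ⟨_, _, hm₂⟩ := h₂.dom _ ho₂
        exact hΓ.disjoint (Ctx.mem_dom_of_mem hm₁) (Ctx.mem_dom_of_mem hm₂)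
      · exact hl.elim fun _ h => h
    · intro x m T hx
      rw [Proc.fv, Finset.mem_union]
      rcases Multiset.mem_add.1 hx with hx | hx
      · exact (hu₁ x m T hx).imp_right .inl
      · exact (hu₂ x m T hx).imp_right .inr
  | @new Γ p T x y hxy hxp hyp hxΓ hyΓ hT _ ih =>
    intro hΓ
    have hd : Ctx.Distinct ((x, .lin, nrm .pos T) ::ₘ (y, .lin, nrm .neg T) ::ₘ Γ) :=
      Ctx.distinct_cons.2 ⟨by simp [hxy, hxΓ], Ctx.distinct_cons.2 ⟨hyΓ, hΓ⟩⟩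
    obtain ⟨h, hu⟩ := ih hd
    obtain ⟨hN₁, hN₂⟩ := NameEnv.cons₂ (A := nrm .pos T) (B := nrm .neg T) hxy hxΓ hyΓ
    have hyp' := notMem_fv_openAt (k := 1) hxy hyp
    have hxo := (hu x _ _ (Multiset.mem_cons_self _ _)).2
    have hyo := (hu y _ _ (Multiset.mem_cons_of_mem (Multiset.mem_cons_self _ _))).2
    have h0 := (Proc.occ_inr_openAt.1 ((Proc.mem_fv_openAt.1 hyo).resolve_left hyp').2).2
    have h1 := ((Proc.mem_fv_openAt.1
      ((Proc.mem_fv_openAt.1 hxo).resolve_right fun h => hxy h.1)).resolve_left hxp).2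
    refine ⟨.nu hT (((h.close_name _ hN₂ hyp').close_name _ hN₁ hxp)) h0 h1, ?_⟩
    intro z m A hz
    have hzx : z ≠ x := by rintro rfl; exact hxΓ (Ctx.mem_dom_of_mem hz)
    have hzy : z ≠ y := by rintro rfl; exact hyΓ (Ctx.mem_dom_of_mem hz)
    obtain ⟨hm, hz⟩ := hu z m A (by simp [hz])
    refine ⟨hm, ?_⟩
    have := (Proc.mem_fv_openAt.1 hz).resolve_right fun h => hzy h.1
    exact (Proc.mem_fv_openAt.1 this).resolve_right fun h => hzx h.1

theorem ProcTyped.used (hSg : Sg.WF) {Γ p} (h : ProcTyped Sg Γ p) (hΓ : Γ.Distinct) :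
    Γ.Used p.fv :=
  (h.decl hSg hΓ).2

theorem ProcTyped.dom_subset (hSg : Sg.WF) {Γ p} (h : ProcTyped Sg Γ p) (hΓ : Γ.Distinct)
    {x : Name} (hx : x ∈ Γ.dom) : x ∈ p.fv := by
  obtain ⟨m, T, hx⟩ := Ctx.mem_dom.1 hx
  exact (h.used hSg hΓ x m T hx).2

/-! ### Splitting contexts by names, and the way back to the typing rules of processes. -/

/-- The entries for the names in `s`. -/
def Ctx.only (Γ : Ctx) (s : Finset Name) : Ctx := Γ.filter fun b => b.1 ∈ s

/-- The entries for the names outside `s`. -/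
def Ctx.except (Γ : Ctx) (s : Finset Name) : Ctx := Γ.filter fun b => ¬ b.1 ∈ s

theorem Ctx.only_add_except (Γ : Ctx) (s : Finset Name) : Γ.only s + Γ.except s = Γ :=
  Multiset.filter_add_not _ _

theorem Ctx.only_le (Γ : Ctx) (s : Finset Name) : Γ.only s ≤ Γ := Multiset.filter_le _ _

theorem Ctx.except_le (Γ : Ctx) (s : Finset Name) : Γ.except s ≤ Γ := Multiset.filter_le _ _

theorem Ctx.env_only {Γ : Ctx} {s : Finset Name} {x : Name} (hx : x ∈ s) :
    (Γ.only s).env (.inl x) = Γ.env (.inl x) := by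
  funext m T
  simp [Ctx.env, Ctx.only, hx]

theorem Ctx.env_except {Γ : Ctx} {s : Finset Name} {x : Name} (hx : x ∉ s) :
    (Γ.except s).env (.inl x) = Γ.env (.inl x) := by
  funext m T
  simp [Ctx.env, Ctx.except, hx]

theorem Decl.typed_zero (hSg : Sg.WF) {Δ e T} {Γ : Ctx} (hΓ : Γ.Distinct)
    (h : Decl Sg Δ Γ.env e T) (hu : Γ.Used e.fv) : Typed Sg .check Δ Γ e T 0 := by
  have hr : Γ.rest e.fv = 0 := by
    refine Multiset.eq_zero_of_forall_notMem ?_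
    rintro ⟨x, m, T⟩ hx
    obtain ⟨hx, hn⟩ := Ctx.mem_rest.1 hx
    exact hn (hu x m T hx)
  have := h.typed hSg hΓ
  rw [hr] at this
  exact .check this rfl

/-- An expression is typed by the entries for its names. -/
theorem Decl.typed_only (hSg : Sg.WF) {Δ e T} {Γ : Ctx} (hΓ : Γ.Distinct)
    (h : Decl Sg Δ Γ.env e T) (hl : ∀ x m T, (x, m, T) ∈ Γ → m = .lin) :
    Typed Sg .check Δ (Γ.only e.fv) e T 0 := by
  refine (h.congr ?_).typed_zero hSg (hΓ.mono (Ctx.only_le _ _)) ?_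
  · rintro (x | i) hw
    · exact (Ctx.env_only ((occ_inl _ _).1 hw)).symm
    · rfl
  · intro x m T hx
    obtain ⟨hx, hs⟩ := Multiset.mem_filter.1 hx
    exact ⟨hl x m T hx, hs⟩

theorem PDecl.typed_of_size (hSg : Sg.WF) (N : ℕ) : ∀ {p : Proc}, p.size < N → ∀ {Γ : Ctx},
    Γ.Distinct → PDecl Sg Γ.env p → Γ.Used p.fv → ProcTyped Sg Γ p := by
  induction N with
  | zero => intro p hp; omega
  | succ N ih =>
    intro p hp Γ hΓ h hu
    cases h with
    | exp h => exact .exp (h.typed_zero hSg hΓ hu)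
    | @par _ p q h₁ h₂ hs =>
      rw [Proc.size] at hp
      -- The first process gets the entries that it mentions. The others are mentioned by the
      -- second, as every entry is used.
      rw [← Ctx.only_add_except Γ p.fv]
      refine .par (ih (by omega) (hΓ.mono (Ctx.only_le _ _)) (h₁.congr ?_) ?_)
        (ih (by omega) (hΓ.mono (Ctx.except_le _ _)) (h₂.congr ?_) ?_)
      · rintro (x | i) hw
        · exact (Ctx.env_only ((Proc.occ_inl _ _).1 hw)).symm
        · rfl
      · intro x m T hx
        obtain ⟨hx, hs⟩ := Multiset.mem_filter.1 hx
        exact ⟨(hu x m T hx).1, hs⟩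
      · rintro (x | i) hw
        · refine (Ctx.env_except fun hx => ?_).symm
          obtain ⟨m, T, hm⟩ := h₂.dom _ hw
          obtain ⟨rfl, _⟩ := hu x m T hm
          exact hs _ ⟨T, hm⟩ ((Proc.occ_inl _ _).2 hx) hw
        · rfl
      · intro x m T hx
        obtain ⟨hx, hs⟩ := Multiset.mem_filter.1 hx
        obtain ⟨hm, hx⟩ := hu x m T hx
        exact ⟨hm, (Finset.mem_union.1 hx).resolve_left hs⟩
    | @nu _ p T hT h h0 h1 =>
      rw [Proc.size] at hp
      obtain ⟨x, hx⟩ := Infinite.exists_notMem_finset (p.fv ∪ Γ.dom.toFinset)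
      obtain ⟨y, hy⟩ := Infinite.exists_notMem_finset (p.fv ∪ Γ.dom.toFinset ∪ {x})
      simp only [Finset.mem_union, Multiset.mem_toFinset, Finset.mem_singleton, not_or] at hx hy
      obtain ⟨hxp, hxΓ⟩ := hx
      obtain ⟨⟨hyp, hyΓ⟩, hyx⟩ := hy
      have hxy := Ne.symm hyx
      have hd : Ctx.Distinct ((x, .lin, nrm .pos T) ::ₘ (y, .lin, nrm .neg T) ::ₘ Γ) :=
        Ctx.distinct_cons.2 ⟨by simp [hxy, hxΓ], Ctx.distinct_cons.2 ⟨hyΓ, hΓ⟩⟩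
      obtain ⟨hN₁, hN₂⟩ := NameEnv.cons₂ (A := nrm .pos T) (B := nrm .neg T) hxy hxΓ hyΓ
      have hTT := hT.weaken (Kind.Sub.ofS .T)
      have h' := (h.open_name hSg hN₁ hxp hTT.nrm_pos hTT.nrm_idem).open_name hSg hN₂
        (notMem_fv_openAt hxy hyp) ((hT.nrm _ (.inr rfl)).weaken (Kind.Sub.ofS .T))
        (hT.nrm_nrm .pos .neg)
      refine .new x y hxy hxp hyp hxΓ hyΓ hT (ih ?_ hd h' ?_)
      · rw [Proc.opened, Proc.size_openAt, Proc.size_openAt]; omega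
      · intro z m A hz
        rcases Multiset.mem_cons.1 hz with hz | hz
        · cases hz
          exact ⟨rfl, Proc.mem_fv_openAt.2 (.inl (Proc.mem_fv_openAt.2 (.inr ⟨rfl, h1⟩)))⟩
        · rcases Multiset.mem_cons.1 hz with hz | hz
          · cases hz
            exact ⟨rfl, Proc.mem_fv_openAt.2 (.inr ⟨rfl, Proc.occ_inr_openAt.2 ⟨by simp, h0⟩⟩)⟩
          · exact (hu z m A hz).imp_right fun h => Proc.fv_subset_opened h

/-- The names of a restriction can be chosen freely. -/
theorem ProcTyped.nu_inv (hSg : Sg.WF) {Γ p} (h : ProcTyped Sg Γ (.nu p)) (hΓ : Γ.Distinct)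
    {x y : Name} (hxy : x ≠ y) (hxp : x ∉ p.fv) (hyp : y ∉ p.fv) :
    ∃ T, Kinding Sg .check [] T .S ∧
      Ctx.Distinct ((x, .lin, nrm .pos T) ::ₘ (y, .lin, nrm .neg T) ::ₘ Γ) ∧
      ProcTyped Sg ((x, .lin, nrm .pos T) ::ₘ (y, .lin, nrm .neg T) ::ₘ Γ) (p.opened x y) := by
  have hxΓ : x ∉ Γ.dom := fun hx => hxp (h.dom_subset hSg hΓ hx)
  have hyΓ : y ∉ Γ.dom := fun hy => hyp (h.dom_subset hSg hΓ hy)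
  obtain ⟨h, hu⟩ := h.decl hSg hΓ
  cases h with
  | @nu _ _ T hT h h0 h1 =>
    have hd : Ctx.Distinct ((x, .lin, nrm .pos T) ::ₘ (y, .lin, nrm .neg T) ::ₘ Γ) :=
      Ctx.distinct_cons.2 ⟨by simp [hxy, hxΓ], Ctx.distinct_cons.2 ⟨hyΓ, hΓ⟩⟩
    obtain ⟨hN₁, hN₂⟩ := NameEnv.cons₂ (A := nrm .pos T) (B := nrm .neg T) hxy hxΓ hyΓ
    have hTT := hT.weaken (Kind.Sub.ofS .T)
    have h' := (h.open_name hSg hN₁ hxp hTT.nrm_pos hTT.nrm_idem).open_name hSg hN₂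
      (notMem_fv_openAt hxy hyp) ((hT.nrm _ (.inr rfl)).weaken (Kind.Sub.ofS .T))
      (hT.nrm_nrm .pos .neg)
    refine ⟨T, hT, hd, PDecl.typed_of_size hSg _ (Nat.lt_succ_self _) hd h' ?_⟩
    intro z m A hz
    rcases Multiset.mem_cons.1 hz with hz | hz
    · cases hz
      exact ⟨rfl, Proc.mem_fv_openAt.2 (.inl (Proc.mem_fv_openAt.2 (.inr ⟨rfl, h1⟩)))⟩
    · rcases Multiset.mem_cons.1 hz with hz | hz
      · cases hz
        exact ⟨rfl, Proc.mem_fv_openAt.2 (.inr ⟨rfl, Proc.occ_inr_openAt.2 ⟨by simp, h0⟩⟩)⟩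
      · exact (hu z m A hz).imp_right fun h => Proc.fv_subset_opened h

/-- A typed process has no dangling indices, so opening with the same names undoes the closing. -/
theorem ProcTyped.res (hSg : Sg.WF) {Γ q T x y} (hT : Kinding Sg .check [] T .S)
    (hd : Ctx.Distinct ((x, .lin, nrm .pos T) ::ₘ (y, .lin, nrm .neg T) ::ₘ Γ))
    (h : ProcTyped Sg ((x, .lin, nrm .pos T) ::ₘ (y, .lin, nrm .neg T) ::ₘ Γ) q) :
    ProcTyped Sg Γ (.res x y q) := by
  have hlc : ∀ i, ¬ q.Occ (.inr i) := fun i hi => by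
    obtain ⟨_, _, hf⟩ := (h.decl hSg hd).1.dom _ hi
    exact hf
  obtain ⟨hx, hd'⟩ := Ctx.distinct_cons.1 hd
  obtain ⟨hy, _⟩ := Ctx.distinct_cons.1 hd'
  simp only [Ctx.dom_cons, Multiset.mem_cons, not_or] at hx
  have ho : Proc.opened ((q.closeAt 1 x).closeAt 0 y) x y = q := by
    rw [Proc.opened, Proc.closeAt_openAt_comm hx.1 _ _ _ (by simp),
      Proc.openAt_closeAt _ _ _ (hlc 1), Proc.openAt_closeAt _ _ _ (hlc 0)]
  refine .new x y hx.1 ?_ ?_ hx.2 hy hT (by rwa [ho])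
  · simp [Proc.fv_closeAt]
  · simp [Proc.fv_closeAt]

end Proc

end AlgST

namespace AlgST

open Ty AlgST.Expr

section Capabilities

variable {Sg : Sig}

/-! ### What typing says about the labels of transitions -/

/-- A context that provides the channel and the payload of a session operation. -/
def SCap (Sg : Sig) (Γ : Ctx) : SLabel → Prop
  | .rcv x _ => ∃ A S, (x, .lin, .inn A S) ∈ Γ ∧ Kinding Sg .check [] A .T ∧ nrm .pos A = A
  | .snd x v => ∃ A S, (x, .lin, .out A S) ∈ Γ ∧ Decl Sg [] Γ.env v A ∧ x ∉ v.fv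
  | .rcvC x c => ∃ ρ d S, ∃ (U : Fin d.arity → Ty) (k : Fin d.numCons), Sg ρ = some d ∧
      d.con k = c ∧ (x, .lin, .inn (.proto ρ d.arity U) S) ∈ Γ
  | .sndC x _ => x ∈ Γ.dom
  | .wait x => (x, .lin, .endW) ∈ Γ
  | .term x => (x, .lin, .endT) ∈ Γ

/-- The information that typing must provide when a context transition is not given but has to be
constructed; the value to be received comes from the communication partner instead. -/
def ECap (Sg : Sig) (Γ : Ctx) : ELabel → Prop
  | .sess σ => SCap Sg Γ σ
  | .beta => True
  | .fork v => Decl Sg [] Γ.env v (.arr .unit .unit)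
  | .new _ _ T => Kinding Sg .check [] T .S

/-- Evaluation contexts bind nothing, so the redex is typed in the same environment and inverting
its typing suffices. -/
theorem EStep.cap (hSg : Sg.WF) {e₁ l e₂} {Γ : Ctx} (hl : ∀ x m T, (x, m, T) ∈ Γ → m = .lin)
    (h : EStep e₁ l e₂) : ∀ {T}, Decl Sg [] Γ.env e₁ T → ECap Sg Γ l := by
  induction h with
  | app | tapp | letp | letu | recf => intros; trivial
  | fork => intro T h; cases h with | app h₁ h₂ _ => cases h₁.const_inv; exact h₂
  | new => intro T h; exact h.new_inv.1
  | rcv =>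
    intro T h
    obtain ⟨A, S, hx, _, hA, hn⟩ := h.receive_inv hSg
    obtain ⟨m, hx⟩ := hx.fvar_inv rfl
    cases hl _ _ _ hx
    exact ⟨A, S, hx, hA, hn⟩
  | send =>
    intro T h
    obtain ⟨A, hv, hx, _, _, hs⟩ := h.send_inv hSg
    obtain ⟨m, hx⟩ := hx.fvar_inv rfl
    cases hl _ _ _ hx
    exact ⟨A, T, hx, hv, fun h => hs (.inl _) ⟨_, hx⟩ ((occ_inl _ _).2 h) rfl⟩
  | mtch k =>
    intro T h
    cases h with
    | @mtch _ _ ρ d U S _ _ _ _ _ π hρ hC h =>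
      obtain ⟨m, hx⟩ := h.fvar_inv rfl
      cases hl _ _ _ hx
      exact ⟨ρ, d, S, U, π k, hρ, (hC k).symm, hx⟩
  | sel he =>
    intro T h
    obtain ⟨_, _, _, _, _, _, _, hx, _⟩ := Decl.select_inv hSg he h
    obtain ⟨m, hx⟩ := hx.fvar_inv rfl
    exact Ctx.mem_dom_of_mem hx
  | wait | term =>
    intro T h
    cases h with
    | app h₁ h₂ _ =>
      cases h₁.const_inv
      obtain ⟨m, hx⟩ := h₂.fvar_inv rfl
      cases hl _ _ _ hx
      exact hx
  | appL _ ih => intro T h; cases h with | app h _ _ => exact ih h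
  | appR _ _ ih => intro T h; cases h with | app _ h _ => exact ih h
  | tappE _ ih => intro T h; cases h with | tapp h _ => exact ih h
  | pairL _ ih => intro T h; cases h with | pair h _ _ => exact ih h
  | pairR _ _ ih => intro T h; cases h with | pair _ h _ => exact ih h
  | mtchE _ ih => intro T h; cases h with | mtch _ _ _ h => exact ih h
  | letpE _ ih => intro T h; cases h with | letp h _ _ _ _ => exact ih h
  | letuE _ ih => intro T h; cases h with | letu h _ _ => exact ih h

theorem SCap.mono {Γ Γ' : Ctx} {σ} (h : SCap Sg Γ σ) (hle : Γ ≤ Γ') (hΓ : Γ'.Distinct) :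
    SCap Sg Γ' σ := by
  have hs : ∀ b ∈ Γ, b ∈ Γ' := fun b => Multiset.mem_of_le hle
  cases σ with
  | rcv => obtain ⟨A, S, h, h'⟩ := h; exact ⟨A, S, hs _ h, h'⟩
  | snd => obtain ⟨A, S, h, hv, h'⟩ := h; exact ⟨A, S, hs _ h, hv.mono hle hΓ, h'⟩
  | rcvC => obtain ⟨ρ, d, S, U, k, hρ, hk, h⟩ := h; exact ⟨ρ, d, S, U, k, hρ, hk, hs _ h⟩
  | sndC => exact Multiset.mem_of_le (Ctx.dom_mono hle) h
  | wait => exact hs _ h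
  | term => exact hs _ h

theorem SCap.need_subset {Γ : Ctx} {σ x} (h : SCap Sg Γ σ) (hx : x ∈ σ.need) : x ∈ Γ.dom := by
  cases σ <;> simp only [SLabel.need, Finset.mem_union, Finset.mem_singleton] at hx
  case rcv => obtain ⟨A, S, h, _⟩ := h; subst hx; exact Ctx.mem_dom_of_mem h
  case snd =>
    obtain ⟨A, S, h, hv, _⟩ := h
    rcases hx with rfl | hx
    · exact Ctx.mem_dom_of_mem h
    · exact hv.fv_subset hx
  case rcvC => obtain ⟨_, _, _, _, _, _, _, h⟩ := h; subst hx; exact Ctx.mem_dom_of_mem h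
  case sndC => subst hx; exact h
  case wait => subst hx; exact Ctx.mem_dom_of_mem h
  case term => subst hx; exact Ctx.mem_dom_of_mem h

theorem Ctx.mem_of_mem_cons {b : Name × Mult × Ty} {Γ : Ctx} {x m T} (h : (x, m, T) ∈ b ::ₘ Γ)
    (hx : x ≠ b.1) : (x, m, T) ∈ Γ := by
  rcases Multiset.mem_cons.1 h with rfl | h
  · exact absurd rfl hx
  · exact h

theorem Decl.drop {Δ e T} {Γ : Ctx} {b : Name × Mult × Ty} (h : Decl Sg Δ (Ctx.env (b ::ₘ Γ)) e T)
    (hb : b.1 ∉ e.fv) : Decl Sg Δ Γ.env e T := by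
  refine h.congr fun w hw => Ctx.env_cons_of_ne ?_
  rintro rfl
  exact hb ((occ_inl _ _).1 hw)

theorem SCap.drop {Γ : Ctx} {b : Name × Mult × Ty} {σ} (h : SCap Sg (b ::ₘ Γ) σ)
    (hb : b.1 ∉ σ.fv) : SCap Sg Γ σ := by
  cases σ <;> simp only [SLabel.fv, Finset.mem_union, Finset.mem_singleton, not_or] at hb
  case rcv => obtain ⟨A, S, h, h'⟩ := h; exact ⟨A, S, Ctx.mem_of_mem_cons h (Ne.symm hb.1), h'⟩
  case snd =>
    obtain ⟨A, S, h, hv, h'⟩ := h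
    exact ⟨A, S, Ctx.mem_of_mem_cons h (Ne.symm hb.1), hv.drop hb.2, h'⟩
  case rcvC =>
    obtain ⟨ρ, d, S, U, k, hρ, hk, h⟩ := h
    exact ⟨ρ, d, S, U, k, hρ, hk, Ctx.mem_of_mem_cons h (Ne.symm hb)⟩
  case sndC =>
    simp only [SCap, Ctx.dom_cons, Multiset.mem_cons] at h
    exact h.resolve_left (Ne.symm hb)
  case wait => exact Ctx.mem_of_mem_cons h (Ne.symm hb)
  case term => exact Ctx.mem_of_mem_cons h (Ne.symm hb)

/-- The names that a process must own in order to perform a transition. -/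
def PLabel.need : PLabel → Finset Name
  | sess σ => σ.need
  | tau => ∅
  | scope _ _ x _ => {x}
  | par π π' => π.need ∪ π'.need

/-- A context that provides the channels and payloads of a transition. -/
def PCap (Sg : Sig) (Γ : Ctx) : PLabel → Prop
  | .sess σ => SCap Sg Γ σ
  | .tau => True
  | .scope a b x _ => a ≠ b ∧ ∃ A S, (x, .lin, .out A S) ∈ Γ ∧ Kinding Sg .check [] A .S
  | .par π π' => PCap Sg Γ π ∧ PCap Sg Γ π' ∧ Disjoint π.need π'.need

theorem PCap.mono {Γ Γ' : Ctx} {π} (h : PCap Sg Γ π) (hle : Γ ≤ Γ') (hΓ : Γ'.Distinct) :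
    PCap Sg Γ' π := by
  induction π with
  | sess σ => exact SCap.mono h hle hΓ
  | tau => trivial
  | scope => obtain ⟨hab, A, S, h, h'⟩ := h; exact ⟨hab, A, S, Multiset.mem_of_le hle h, h'⟩
  | par _ _ ih₁ ih₂ => exact ⟨ih₁ h.1, ih₂ h.2.1, h.2.2⟩

theorem PCap.need_subset {Γ : Ctx} {π x} (h : PCap Sg Γ π) (hx : x ∈ π.need) : x ∈ Γ.dom := by
  induction π with
  | sess σ => exact SCap.need_subset h hx
  | tau => simp [PLabel.need] at hx
  | scope =>
    obtain ⟨_, A, S, h, _⟩ := h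
    rw [PLabel.need, Finset.mem_singleton] at hx
    subst hx
    exact Ctx.mem_dom_of_mem h
  | par _ _ ih₁ ih₂ =>
    rw [PLabel.need, Finset.mem_union] at hx
    exact hx.elim (ih₁ h.1) (ih₂ h.2.1)

theorem PCap.drop {Γ : Ctx} {b : Name × Mult × Ty} {π} (h : PCap Sg (b ::ₘ Γ) π)
    (hb : b.1 ∉ π.fv ∪ π.bn) : PCap Sg Γ π := by
  induction π with
  | sess σ => exact SCap.drop h fun h => hb (Finset.mem_union_left _ h)
  | tau => trivial
  | scope a c x =>
    obtain ⟨hab, A, S, h, h'⟩ := h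
    refine ⟨hab, A, S, Ctx.mem_of_mem_cons h ?_, h'⟩
    rintro rfl
    simp only [PLabel.fv, PLabel.bn, Finset.mem_union, Finset.mem_sdiff, Finset.mem_insert,
      Finset.mem_singleton] at hb
    tauto
  | par _ _ ih₁ ih₂ =>
    simp only [PLabel.fv, PLabel.bn, Finset.mem_union, not_or] at hb ih₁ ih₂
    exact ⟨ih₁ h.1 ⟨hb.1.1, hb.2.1⟩, ih₂ h.2.1 ⟨hb.1.2, hb.2.2⟩, h.2.2⟩

theorem PStep.cap (hSg : Sg.WF) {p π q} (h : PStep p π q) :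
    ∀ {Γ : Ctx}, ProcTyped Sg Γ p → Γ.Distinct → PCap Sg Γ π := by
  have hpar : ∀ {G₁ G₂ : Ctx} {π₁ π₂}, (G₁ + G₂).Distinct → PCap Sg G₁ π₁ → PCap Sg G₂ π₂ →
      PCap Sg (G₁ + G₂) π₁ ∧ PCap Sg (G₁ + G₂) π₂ ∧ Disjoint π₁.need π₂.need :=
    fun hd h₁ h₂ => ⟨h₁.mono (Multiset.le_add_right _ _) hd, h₂.mono (Multiset.le_add_left _ _) hd,
      Finset.disjoint_left.2 fun x hx₁ hx₂ =>
        hd.disjoint (h₁.need_subset hx₁) (h₂.need_subset hx₂)⟩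
  -- An end that is sent out of its own restriction has type N⁺T or N⁻T for a session type T, so the
  -- payload type has kind `S`.
  have hopen : ∀ {A S x : _} {a b c : Name} {m T} {Γ : Ctx}, a ≠ b → x ≠ a → x ≠ b →
      Ctx.Distinct ((a, .lin, nrm .pos T) ::ₘ (b, .lin, nrm .neg T) ::ₘ Γ) →
      Kinding Sg .check [] T .S →
      (x, .lin, .out A S) ∈ ((a, .lin, nrm .pos T) ::ₘ (b, .lin, nrm .neg T) ::ₘ Γ : Ctx) →
      (c, m, A) ∈ ((a, .lin, nrm .pos T) ::ₘ (b, .lin, nrm .neg T) ::ₘ Γ : Ctx) →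
      c = a ∨ c = b → PCap Sg Γ (.scope a b x c) := by
    intro A S x a b c m T Γ hab hxa hxb hd hT hx hc hcab
    refine ⟨hab, A, S, Ctx.mem_of_mem_cons (Ctx.mem_of_mem_cons hx hxa) hxb, ?_⟩
    rcases hcab with rfl | rfl
    · obtain ⟨_, rfl⟩ := hd.unique hc (Multiset.mem_cons_self _ _)
      exact hT.nrm_pos
    · obtain ⟨_, rfl⟩ := hd.unique hc (Multiset.mem_cons_of_mem (Multiset.mem_cons_self _ _))
      exact hT.nrm _ (.inr rfl)
  induction h with
  | session hs =>
    intro Γ h hΓ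
    cases h with
    | exp h =>
      obtain ⟨hd, hu⟩ := h.consumed hSg hΓ
      exact hs.cap hSg (fun x m T hx => (hu x m T hx).1) hd
  | beta | fork | new | msg | bra | wait | closeL | closeR => intros; trivial
  | joinL _ _ _ _ ih₁ ih₂ =>
    intro Γ h hΓ
    cases h with
    | par h₁ h₂ =>
      exact hpar hΓ (ih₁ h₁ (hΓ.mono (Multiset.le_add_right _ _)))
        (ih₂ h₂ (hΓ.mono (Multiset.le_add_left _ _)))
  | joinR _ _ _ _ ih₁ ih₂ =>
    intro Γ h hΓ
    cases h with
    | par h₁ h₂ =>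
      obtain ⟨h, h', hd⟩ := hpar hΓ (ih₁ h₁ (hΓ.mono (Multiset.le_add_right _ _)))
        (ih₂ h₂ (hΓ.mono (Multiset.le_add_left _ _)))
      exact ⟨h', h, hd.symm⟩
  | parL _ _ ih =>
    intro Γ h hΓ
    cases h with
    | par h _ =>
      exact (ih h (hΓ.mono (Multiset.le_add_right _ _))).mono (Multiset.le_add_right _ _) hΓ
  | parR _ _ ih =>
    intro Γ h hΓ
    cases h with
    | par _ h =>
      exact (ih h (hΓ.mono (Multiset.le_add_left _ _))).mono (Multiset.le_add_left _ _) hΓ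
  | res x y hxy hx hy _ hxπ hyπ ih =>
    intro Γ h hΓ
    obtain ⟨T, _, hd, h⟩ := h.nu_inv hSg hΓ hxy hx hy
    exact ((ih h hd).drop hxπ).drop hyπ
  | openL a b hab ha hb _ hxa hxb ih =>
    intro Γ h hΓ
    obtain ⟨T, hT, hd, h⟩ := h.nu_inv hSg hΓ hab ha hb
    obtain ⟨A, S, hx, hc, _⟩ := ih h hd
    obtain ⟨m, hc⟩ := hc.fvar_inv rfl
    exact hopen hab hxa hxb hd hT hx hc (.inl rfl)
  | openR a b hab ha hb _ hxa hxb ih =>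
    intro Γ h hΓ
    obtain ⟨T, hT, hd, h⟩ := h.nu_inv hSg hΓ hab ha hb
    obtain ⟨A, S, hx, hc, _⟩ := ih h hd
    obtain ⟨m, hc⟩ := hc.fvar_inv rfl
    exact hopen hab hxa hxb hd hT hx hc (.inr rfl)

theorem CtxPStep.dom_subset (hSg : Sg.WF) {Γ π Γ' x} (h : CtxPStep Sg Γ π Γ') (hΓ : Γ.Distinct)
    (hx : x ∈ Γ.dom) : x ∈ π.need := by
  induction h with
  | sess h => exact h.dom_subset hSg hΓ hx
  | tau => cases Multiset.notMem_zero _ hx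
  | openL | openR => simpa [PLabel.need] using hx
  | par _ _ ih₁ ih₂ =>
    rw [Ctx.dom_add, Multiset.mem_add] at hx
    rw [PLabel.need, Finset.mem_union]
    exact hx.imp (ih₁ (hΓ.mono (Multiset.le_add_right _ _)))
      (ih₂ (hΓ.mono (Multiset.le_add_left _ _)))

theorem CtxSStep.dom_right (hSg : Sg.WF) {Γ σ Γ' x} (h : CtxSStep Sg Γ σ Γ') (hΓ : Γ'.Distinct)
    (hx : x ∈ Γ'.dom) : x ∈ σ.fv := by
  cases h with
  | rcv h =>
    simp only [Ctx.dom_add, Ctx.dom_singleton, Multiset.mem_add, Multiset.mem_singleton] at hx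
    simp only [SLabel.fv, Finset.mem_union, Finset.mem_singleton]
    rcases hx with hx | hx
    · obtain ⟨m, T, hx⟩ := Ctx.mem_dom.1 hx
      exact .inr ((h.consumed hSg (hΓ.mono (Multiset.le_add_right _ _))).2 _ _ _ hx).2
    · exact .inl hx
  | wait | term => cases Multiset.notMem_zero _ hx
  | _ => simp only [Ctx.dom_singleton, Multiset.mem_singleton] at hx; simp [SLabel.fv, hx]

/-- Every name in the resulting context appears in the label, so a restriction whose names avoid the
label cannot clash with it. -/
theorem CtxPStep.dom_right (hSg : Sg.WF) {Γ π Γ' x} (h : CtxPStep Sg Γ π Γ') (hΓ : Γ'.Distinct)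
    (hx : x ∈ Γ'.dom) : x ∈ π.fv ∪ π.bn := by
  induction h with
  | sess h => exact Finset.mem_union_left _ (h.dom_right hSg hΓ hx)
  | tau => cases Multiset.notMem_zero _ hx
  | openL | openR =>
    simp only [Multiset.insert_eq_cons, Ctx.dom_cons, Ctx.dom_singleton, Multiset.mem_cons,
      Multiset.mem_singleton] at hx
    simp only [PLabel.fv, PLabel.bn, Finset.mem_union, Finset.mem_sdiff, Finset.mem_insert,
      Finset.mem_singleton]
    tauto
  | par _ _ ih₁ ih₂ =>
    rw [Ctx.dom_add, Multiset.mem_add] at hx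
    have h₁ := ih₁ (hΓ.mono (Multiset.le_add_right _ _))
    have h₂ := ih₂ (hΓ.mono (Multiset.le_add_left _ _))
    simp only [PLabel.fv, PLabel.bn, Finset.mem_union] at h₁ h₂ ⊢
    tauto

/-- The freshness conditions of the opening and parallel rules accumulate along the derivation. When
a scope is closed again, they guarantee that the extruded names are new. -/
theorem PStep.bn_disjoint {p π q} (h : PStep p π q) : ∀ {x}, x ∈ π.bn → x ∉ p.fv := by
  induction h with
  | joinL _ _ hd₁ hd₂ ih₁ ih₂ | joinR _ _ hd₁ hd₂ ih₁ ih₂ =>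
    intro x hx
    have h₁ := @ih₁ x
    have h₂ := @ih₂ x
    have h₃ := @Finset.disjoint_left.1 hd₁ x
    have h₄ := @Finset.disjoint_left.1 hd₂ x
    simp only [PLabel.bn, Proc.fv, Finset.mem_union] at hx ⊢
    tauto
  | parL _ hd ih | parR _ hd ih =>
    intro x hx
    have h₁ := ih hx
    have h₂ := Finset.disjoint_left.1 hd hx
    simp only [Proc.fv, Finset.mem_union]
    tauto
  | res x y _ _ _ _ _ _ ih => intro z hz h; exact ih hz (Proc.fv_subset_opened h)
  | openL a b _ ha hb | openR a b _ ha hb =>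
    intro x hx
    simp only [PLabel.bn, Finset.mem_insert, Finset.mem_singleton] at hx
    rcases hx with rfl | rfl <;> assumption
  | _ => intro x hx; simp [PLabel.bn] at hx

end Capabilities

end AlgST

namespace AlgST

open Ty AlgST.Expr

section ProcPreservation

variable {Sg : Sig}

/-! ### Splitting of contexts -/

theorem Ctx.WF.mono {Δ} {Γ Γ' : Ctx} (h : Ctx.WF Sg Δ Γ') (hle : Γ ≤ Γ') : Ctx.WF Sg Δ Γ :=
  ⟨h.1.mono hle, fun b hb => h.2 b (Multiset.mem_of_le hle hb)⟩

theorem Ctx.Distinct.of_dom {Γ Γ' : Ctx} (h : Γ.Distinct) (hd : Γ'.dom = Γ.dom) :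
    Γ'.Distinct := by
  rwa [Ctx.Distinct, hd]

theorem Ctx.Distinct.le_left {Γ G₁ G₂ : Ctx} (hd : (G₁ + G₂).Distinct) (hle : Γ ≤ G₁ + G₂)
    (hdom : ∀ x ∈ Γ.dom, x ∈ G₁.dom) : Γ ≤ G₁ := by
  refine (Multiset.le_iff_subset (Multiset.Nodup.of_map _ (hd.mono hle))).2 ?_
  rintro ⟨x, m, T⟩ hb
  refine (Multiset.mem_add.1 (Multiset.mem_of_le hle hb)).resolve_right fun h => ?_
  exact hd.disjoint (hdom x (Ctx.mem_dom_of_mem hb)) (Ctx.mem_dom_of_mem h)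

/-- Each component of a joint transition must sit on the side that owns its names, and distinctness
leaves only one way to do this. -/
theorem Ctx.Distinct.split {Γ Γa Γb G₁ G₂ : Ctx} (h : Γ + (Γa + Γb) = G₁ + G₂)
    (hd : (G₁ + G₂).Distinct) (ha : ∀ x ∈ Γa.dom, x ∈ G₁.dom) (hb : ∀ x ∈ Γb.dom, x ∈ G₂.dom) :
    ∃ R₁ R₂, G₁ = R₁ + Γa ∧ G₂ = R₂ + Γb ∧ Γ = R₁ + R₂ := by
  have hla : Γa ≤ G₁ := hd.le_left (h ▸ (Multiset.le_add_right _ _).trans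
    (Multiset.le_add_left _ _)) ha
  have hlb : Γb ≤ G₂ := by
    rw [add_comm G₁] at hd h
    exact hd.le_left (h ▸ (Multiset.le_add_left _ _).trans (Multiset.le_add_left _ _)) hb
  obtain ⟨R₁, rfl⟩ := Multiset.le_iff_exists_add.1 hla
  obtain ⟨R₂, rfl⟩ := Multiset.le_iff_exists_add.1 hlb
  refine ⟨R₁, R₂, add_comm _ _, add_comm _ _, ?_⟩
  refine add_right_cancel (b := Γa + Γb) (h.trans ?_)
  abel

/-- An expression consumes a part of a linear context. -/
theorem Decl.split (hSg : Sg.WF) {Δ e T} {Γ : Ctx} (hΓ : Γ.Distinct) (h : Decl Sg Δ Γ.env e T)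
    (hl : ∀ x m T, (x, m, T) ∈ Γ → m = .lin) :
    ∃ G G' : Ctx, Γ = G + G' ∧ Typed Sg .check Δ G e T 0 :=
  ⟨_, _, (Ctx.only_add_except Γ e.fv).symm, h.typed_only hSg hΓ hl⟩

/-! ### The types of the two ends of a channel -/

/-- Expand N⁺N⁺T = N⁺T and N⁻N⁺T = N⁻T at ?A.S: as A has no sign after normalization, the direction
is kept in the first and reversed in the second, and comparing components gives the claims. -/
theorem Kinding.dual_inn {Δ T A S} (hT : Kinding Sg .check Δ T .S) (hA : (AlgST.nrm .pos A).NonNeg)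
    (h : AlgST.nrm .pos T = .inn A S) :
    AlgST.nrm .neg T = .out A (AlgST.nrm .neg S) ∧ AlgST.nrm .pos S = S ∧ Kinding Sg .check Δ S .S := by
  have hk := hT.nrm_pos
  have h₁ := hT.nrm_nrm .pos .pos
  have h₂ := hT.nrm_nrm .neg .pos
  rw [h] at hk
  rw [Pol.mul_pos, h, nrm_inn, Pol.flip_pos, dirOp_neg_of_nonNeg hA, AlgST.mat, Ty.inn.injEq] at h₁
  rw [Pol.mul_pos, h, nrm_inn, Pol.flip_neg, dirOp_pos hA, mat_of_nonNeg hA, h₁.1] at h₂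
  exact ⟨h₂.symm, h₁.2, hk.inn_inv.2⟩

/-- The types of a channel after the choice of a constructor are dual to each other. -/
theorem nrm_neg_cont {Δ S} {d : ProtoDecl} {k : Fin d.numCons} {U : Fin d.arity → Ty}
    (hS : Kinding Sg .check Δ S .S) :
    nrm .neg (matSeq .neg ((d.args k).map (fun T => T.subst (Ty.params U))) S) =
      contTy .pos d k U (nrm .neg S) := by
  rw [contTy, nrm_matSeq, nrm_matSeq, hS.nrm_nrm]
  rfl

theorem Ctx.WF.cons₂ {T x y} {Γ : Ctx} (hΓ : Ctx.WF Sg [] Γ) (hT : Kinding Sg .check [] T .S)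
    (hd : Ctx.Distinct ((x, .lin, nrm .pos T) ::ₘ (y, .lin, nrm .neg T) ::ₘ Γ)) :
    Ctx.WF Sg [] ((x, .lin, nrm .pos T) ::ₘ (y, .lin, nrm .neg T) ::ₘ Γ) := by
  refine ⟨hd, fun b hb => ?_⟩
  have hp : ∀ p, Kinding Sg .check [] (nrm p T) .T ∧ nrm .pos (nrm p T) = nrm p T := fun p =>
    ⟨(hT.nrm p (.inr rfl)).weaken (Kind.Sub.ofS .T), by rw [hT.nrm_nrm]; cases p <;> rfl⟩
  rcases Multiset.mem_cons.1 hb with rfl | hb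
  · exact hp _
  rcases Multiset.mem_cons.1 hb with rfl | hb
  · exact hp _
  · exact hΓ.2 b hb

theorem Typed.fvar_singleton {Δ x A} (hA : Kinding Sg .check Δ A .T) :
    Typed Sg .check Δ {(x, .lin, A)} (.fvar x) A 0 :=
  .check (.var hA) rfl

/-! ### Preservation for processes -/

/-- Transitions of the context that match those of `p` preserve typing. -/
def PPreserved (Sg : Sig) (p : Proc) (π : PLabel) (q : Proc) : Prop :=
  ∀ Γ₁ Γ₂ Γ₂' : Ctx, ProcTyped Sg (Γ₁ + Γ₂) p → CtxPStep Sg Γ₂ π Γ₂' →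
    Ctx.WF Sg [] (Γ₁ + Γ₂) → (Γ₁ + Γ₂').Distinct → ProcTyped Sg (Γ₁ + Γ₂') q

variable {p q p₁ p₂ q₁ q₂ : Proc} {π π₁ π₂ : PLabel}

theorem CtxPStep.tau_inv {Γ Γ' : Ctx} (h : CtxPStep Sg Γ .tau Γ') : Γ = 0 ∧ Γ' = 0 := by
  cases h; exact ⟨rfl, rfl⟩

theorem PPreserved.of_tau
    (h : ∀ {Γ : Ctx}, ProcTyped Sg Γ p → Ctx.WF Sg [] Γ → ProcTyped Sg Γ q) :
    PPreserved Sg p .tau q := by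
  intro Γ₁ Γ₂ Γ₂' ht hc hwf _
  obtain ⟨rfl, rfl⟩ := hc.tau_inv
  rw [add_zero] at *
  exact h ht hwf

theorem PPreserved.fork (hSg : Sg.WF) {e₁ v e₂} (h : EStep e₁ (.fork v) e₂) :
    PPreserved Sg (.exp e₁) .tau (.par (.exp e₂) (.exp (.app v (.const .unit)))) := by
  refine PPreserved.of_tau fun {Γ} ht hwf => ?_
  cases ht with
  | exp ht =>
    obtain ⟨hd, hu⟩ := ht.consumed hSg hwf.1
    have hl := fun x m T hx => (hu x m T hx).1
    -- The entries used by the forked value move to the new thread, and the remaining ones stay with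
    -- the old.
    obtain ⟨G, G', rfl, hv⟩ := Decl.split hSg hwf.1 (h.cap hSg hl hd) hl
    rw [add_comm] at ht hwf ⊢
    refine .par (.exp ?_) (.exp ?_)
    · have := h.typed hSg (Γ₁ := G') (Γ₃ := 0) (by rwa [add_zero]) (.fork hv)
        (by rwa [add_zero]) (by simpa using hwf.1.mono (Multiset.le_add_right _ _))
      simpa using Typed.check this rfl
    · cases hv with
      | check hv hV => exact .check (.app (hV ▸ hv) (.check (.const .unit) rfl)) rfl

/-- The whole context is used, so names fresh for the expression are fresh for the context as well.
-/
theorem PPreserved.new (hSg : Sg.WF) {e₁ e₂ T} {x y : Name} (hxy : x ≠ y) (hx : x ∉ e₁.fv)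
    (hy : y ∉ e₁.fv) (h : EStep e₁ (.new x y T) e₂) :
    PPreserved Sg (.exp e₁) .tau (.res x y (.exp e₂)) := by
  refine PPreserved.of_tau fun {Γ} ht hwf => ?_
  have hx' : x ∉ Γ.dom := fun h => hx (ht.dom_subset hSg hwf.1 h)
  have hy' : y ∉ Γ.dom := fun h => hy (ht.dom_subset hSg hwf.1 h)
  cases ht with
  | exp ht =>
    obtain ⟨hd, hu⟩ := ht.consumed hSg hwf.1
    have hT : Kinding Sg .check [] T .S := h.cap hSg (fun x m T hx => (hu x m T hx).1) hd
    have hd' : Ctx.Distinct ((x, .lin, nrm .pos T) ::ₘ (y, .lin, nrm .neg T) ::ₘ Γ) :=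
      Ctx.distinct_cons.2 ⟨by simp [hxy, hx'], Ctx.distinct_cons.2 ⟨hy', hwf.1⟩⟩
    have hE : Γ + {(x, .lin, nrm .pos T), (y, .lin, nrm .neg T)} + 0 =
        ((x, .lin, nrm .pos T) ::ₘ (y, .lin, nrm .neg T) ::ₘ Γ : Ctx) := by
      simp only [Multiset.insert_eq_cons, ← Multiset.singleton_add]; abel
    refine ProcTyped.res hSg hT hd' (.exp ?_)
    have := h.typed hSg (Γ₁ := Γ) (Γ₃ := 0) (by simpa using ht) .new (by simpa using hwf)
      (by rwa [hE])
    rw [hE] at this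
    exact .check this rfl

theorem PPreserved.par (hSg : Sg.WF) (hs₁ : PStep p₁ π₁ q₁) (hs₂ : PStep p₂ π₂ q₂)
    (h₁ : PPreserved Sg p₁ π₁ q₁) (h₂ : PPreserved Sg p₂ π₂ q₂) {Γ Γa Γb Γa' Γb' : Ctx}
    (ht : ProcTyped Sg (Γ + (Γa + Γb)) (.par p₁ p₂)) (ha : CtxPStep Sg Γa π₁ Γa')
    (hb : CtxPStep Sg Γb π₂ Γb') (hwf : Ctx.WF Sg [] (Γ + (Γa + Γb)))
    (hd : (Γ + (Γa' + Γb')).Distinct) : ProcTyped Sg (Γ + (Γa' + Γb')) (.par q₁ q₂) := by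
  have hda : Γa.Distinct :=
    hwf.1.mono ((Multiset.le_add_right _ _).trans (Multiset.le_add_left _ _))
  have hdb : Γb.Distinct :=
    hwf.1.mono ((Multiset.le_add_left _ _).trans (Multiset.le_add_left _ _))
  generalize hG : Γ + (Γa + Γb) = G at ht hwf
  cases ht with
  | @par G₁ G₂ _ _ ht₁ ht₂ =>
    have hwf₁ := hwf.mono (Multiset.le_add_right G₁ G₂)
    have hwf₂ := hwf.mono (Multiset.le_add_left G₂ G₁)
    obtain ⟨R₁, R₂, rfl, rfl, rfl⟩ := Ctx.Distinct.split hG hwf.1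
      (fun x hx => (hs₁.cap hSg ht₁ hwf₁.1).need_subset (ha.dom_subset hSg hda hx))
      (fun x hx => (hs₂.cap hSg ht₂ hwf₂.1).need_subset (hb.dom_subset hSg hdb hx))
    have hE : R₁ + R₂ + (Γa' + Γb') = R₁ + Γa' + (R₂ + Γb') := by abel
    rw [hE] at hd ⊢
    exact .par (h₁ _ _ _ ht₁ ha hwf₁ (hd.mono (Multiset.le_add_right _ _)))
      (h₂ _ _ _ ht₂ hb hwf₂ (hd.mono (Multiset.le_add_left _ _)))

/-- Transitions of one of two parallel processes. -/
theorem PPreserved.parL (hSg : Sg.WF) (hs : PStep p₁ π q₁) (h : PPreserved Sg p₁ π q₁) (p₂ : Proc)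
    {Γ Γ₂ Γ₂' : Ctx} (ht : ProcTyped Sg (Γ + Γ₂) (.par p₁ p₂)) (hc : CtxPStep Sg Γ₂ π Γ₂')
    (hwf : Ctx.WF Sg [] (Γ + Γ₂)) (hd : (Γ + Γ₂').Distinct) :
    ProcTyped Sg (Γ + Γ₂') (.par q₁ p₂) := by
  have hd₂ : Γ₂.Distinct := hwf.1.mono (Multiset.le_add_left _ _)
  generalize hG : Γ + Γ₂ = G at ht hwf
  cases ht with
  | @par G₁ G₂ _ _ ht₁ ht₂ =>
    have hwf₁ := hwf.mono (Multiset.le_add_right G₁ G₂)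
    obtain ⟨R₁, R₂, rfl, rfl, rfl⟩ := Ctx.Distinct.split (Γb := 0) (by rwa [add_zero]) hwf.1
      (fun x hx => (hs.cap hSg ht₁ hwf₁.1).need_subset (hc.dom_subset hSg hd₂ hx))
      (fun x hx => absurd hx (Multiset.notMem_zero _))
    rw [add_zero] at *
    rw [add_right_comm] at hd ⊢
    exact .par (h _ _ _ ht₁ hc hwf₁ (hd.mono (Multiset.le_add_right _ _))) ht₂

theorem ProcTyped.par_comm {Γ : Ctx} (h : ProcTyped Sg Γ (.par p q)) :
    ProcTyped Sg Γ (.par q p) := by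
  cases h with
  | par h₁ h₂ => rw [add_comm]; exact .par h₂ h₁

/-- The part of the context that types the payload leaves with the output and returns with the
input, so under the restriction only the types of the two ends change, to N⁺S and N⁻S. -/
theorem PPreserved.msg (hSg : Sg.WF) {v} {x y : Name} (hxy : x ≠ y) (hx : x ∉ p.fv)
    (hy : y ∉ p.fv)
    (hs : PStep (p.opened x y) (.par (.sess (.rcv x v)) (.sess (.snd y v))) q)
    (h : PPreserved Sg (p.opened x y) (.par (.sess (.rcv x v)) (.sess (.snd y v))) q) :
    PPreserved Sg (.nu p) .tau (.res x y q) := by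
  refine PPreserved.of_tau fun {Γ} ht hwf => ?_
  have hl := fun x m T hx => (ht.used hSg hwf.1 x m T hx).1
  obtain ⟨T, hT, hd, ht⟩ := ht.nu_inv hSg hwf.1 hxy hx hy
  have hwf' := hwf.cons₂ hT hd
  obtain ⟨⟨A, S, hxA, hA, hn⟩, ⟨B, S', hyB, hv, hyv⟩, hdj⟩ := hs.cap hSg ht hd
  have hTx := (hd.unique hxA (Multiset.mem_cons_self _ _)).2.symm
  have hTy := (hd.unique hyB (Multiset.mem_cons_of_mem (Multiset.mem_cons_self _ _))).2.symm
  obtain ⟨hTn, hSn, hS⟩ := hT.dual_inn hA.nrm_pos.nonNeg hTx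
  obtain ⟨rfl, rfl⟩ := Ty.out.inj (hTy.symm.trans hTn)
  -- Receiver and sender own disjoint sets of names, so the receiving end is not part of the
  -- payload.
  have hxv : x ∉ v.fv := fun h => Finset.disjoint_left.1 hdj (Finset.mem_singleton_self x)
    (Finset.mem_union_right _ h)
  obtain ⟨G, G', rfl, hvG⟩ := Decl.split hSg hwf.1 ((hv.drop hxv).drop hyv) hl
  rw [hTx, hTn] at ht hd hwf'
  have hE : ∀ X Y : Ty, G' + (({(x, .lin, X)} : Ctx) + (G + {(y, .lin, Y)})) =
      (x, .lin, X) ::ₘ (y, .lin, Y) ::ₘ (G + G') := fun X Y => by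
    simp only [← Multiset.singleton_add]; abel
  have hE' : ∀ X Y : Ty, G' + (G + ({(x, .lin, X)} : Ctx) + {(y, .lin, Y)}) =
      (x, .lin, X) ::ₘ (y, .lin, Y) ::ₘ (G + G') := fun X Y => by
    simp only [← Multiset.singleton_add]; abel
  have hd' : Ctx.Distinct ((x, .lin, S) ::ₘ (y, .lin, nrm .neg S) ::ₘ (G + G')) :=
    hd.of_dom (by simp)
  rw [← hE] at ht hwf'
  have := h _ _ _ ht (.par (.sess (.rcv hvG)) (.sess (.snd hvG))) hwf' (by rwa [hE'])
  rw [hE'] at this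
  exact ProcTyped.res hSg hS (by rwa [hSn]) (by rwa [hSn])

/-- Only the type of the receiving end is read off from the transition; that of the selecting end
follows by duality. -/
theorem PPreserved.bra (hSg : Sg.WF) {c} {x y : Name} (hxy : x ≠ y) (hx : x ∉ p.fv)
    (hy : y ∉ p.fv)
    (hs : PStep (p.opened x y) (.par (.sess (.rcvC x c)) (.sess (.sndC y c))) q)
    (h : PPreserved Sg (p.opened x y) (.par (.sess (.rcvC x c)) (.sess (.sndC y c))) q) :
    PPreserved Sg (.nu p) .tau (.res x y q) := by
  refine PPreserved.of_tau fun {Γ} ht hwf => ?_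
  obtain ⟨T, hT, hd, ht⟩ := ht.nu_inv hSg hwf.1 hxy hx hy
  have hwf' := hwf.cons₂ hT hd
  obtain ⟨⟨ρ, d, S, U, k, hρ, rfl, hxA⟩, _⟩ := hs.cap hSg ht hd
  have hTx := (hd.unique hxA (Multiset.mem_cons_self _ _)).2.symm
  obtain ⟨hTn, hSn, hS⟩ := hT.dual_inn (by rw [nrm_proto]; trivial) hTx
  have hU := (hTx ▸ hT.nrm_pos).inn_inv.1.proto_inv hρ
  rw [hTx, hTn] at ht hd hwf'
  have hE : ∀ X Y : Ty, Γ + (({(x, .lin, X)} : Ctx) + {(y, .lin, Y)}) =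
      (x, .lin, X) ::ₘ (y, .lin, Y) ::ₘ Γ := fun X Y => by
    simp only [← Multiset.singleton_add]; abel
  have hd' : Ctx.Distinct ((x, .lin, contTy .neg d k U S) ::ₘ
      (y, .lin, contTy .pos d k U (nrm .neg S)) ::ₘ Γ) := hd.of_dom (by simp)
  rw [← hE] at ht hwf'
  have := h _ _ _ ht (.par (.sess (.rcvC hρ k)) (.sess (.sndC hρ k))) hwf' (by rwa [hE])
  rw [hE] at this
  -- The unnormalized continuation serves as the session type of the restriction: its N⁺ is the
  -- receiver's type by definition, its N⁻ the sender's by this rewriting.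
  rw [← nrm_neg_cont hS] at hd' this
  exact ProcTyped.res hSg (contTy_kinding hSg hρ .neg k hU hS) hd' this

theorem PPreserved.wait (hSg : Sg.WF) {x y : Name} (hxy : x ≠ y) (hx : x ∉ p.fv)
    (hy : y ∉ p.fv)
    (hs : PStep (p.opened x y) (.par (.sess (.wait x)) (.sess (.term y))) q)
    (h : PPreserved Sg (p.opened x y) (.par (.sess (.wait x)) (.sess (.term y))) q) :
    PPreserved Sg (.nu p) .tau q := by
  refine PPreserved.of_tau fun {Γ} ht hwf => ?_
  obtain ⟨T, hT, hd, ht⟩ := ht.nu_inv hSg hwf.1 hxy hx hy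
  have hwf' := hwf.cons₂ hT hd
  obtain ⟨hx, hy, _⟩ := hs.cap hSg ht hd
  have hTx := (hd.unique hx (Multiset.mem_cons_self _ _)).2.symm
  have hTy := (hd.unique hy (Multiset.mem_cons_of_mem (Multiset.mem_cons_self _ _))).2.symm
  have hE : Γ + (({(x, .lin, .endW)} : Ctx) + {(y, .lin, .endT)}) =
      (x, .lin, .endW) ::ₘ (y, .lin, .endT) ::ₘ Γ := by
    simp only [← Multiset.singleton_add]; abel
  rw [hTx, hTy, ← hE] at ht hwf'
  simpa using h _ _ _ ht (.par (.sess .wait) (.sess .term)) hwf' (by simpa using hwf.1)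

theorem PPreserved.res (hSg : Sg.WF) {x y : Name} (hxy : x ≠ y) (hx : x ∉ p.fv) (hy : y ∉ p.fv)
    (h : PPreserved Sg (p.opened x y) π q) (hxπ : x ∉ π.fv ∪ π.bn) (hyπ : y ∉ π.fv ∪ π.bn) :
    PPreserved Sg (.nu p) π (.res x y q) := by
  intro Γ₁ Γ₂ Γ₂' ht hc hwf hd
  obtain ⟨T, hT, hd', ht⟩ := ht.nu_inv hSg hwf.1 hxy hx hy
  have hwf' := hwf.cons₂ hT hd'
  have hd₂ : Γ₂'.Distinct := hd.mono (Multiset.le_add_left _ _)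
  have hx₂ : x ∉ Γ₂'.dom := fun h => hxπ (hc.dom_right hSg hd₂ h)
  have hy₂ : y ∉ Γ₂'.dom := fun h => hyπ (hc.dom_right hSg hd₂ h)
  have hdd : Ctx.Distinct ((x, .lin, nrm .pos T) ::ₘ (y, .lin, nrm .neg T) ::ₘ (Γ₁ + Γ₂')) := by
    simp only [Ctx.distinct_cons, Ctx.dom_cons, Ctx.dom_add, Multiset.mem_cons, Multiset.mem_add,
      not_or] at hd' ⊢
    exact ⟨⟨hxy, hd'.1.2.1, hx₂⟩, ⟨hd'.2.1.1, hy₂⟩, hd⟩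
  refine ProcTyped.res hSg hT hdd ?_
  rw [← Multiset.cons_add, ← Multiset.cons_add] at ht hwf' hdd ⊢
  exact h _ _ _ ht hc hwf' hdd

/-- The payload `a` has type N⁺T and is given away, while `b` becomes visible at type N⁻T. The
context rule announces N⁻N⁺T, which is the same. -/
theorem PPreserved.openL (hSg : Sg.WF) {x a b : Name} (hab : a ≠ b) (ha : a ∉ p.fv)
    (hb : b ∉ p.fv) (hs : PStep (p.opened a b) (.sess (.snd x (.fvar a))) q)
    (h : PPreserved Sg (p.opened a b) (.sess (.snd x (.fvar a))) q) (hxa : x ≠ a) (hxb : x ≠ b) :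
    PPreserved Sg (.nu p) (.scope a b x a) q := by
  intro Γ₁ Γ₂ Γ₂' ht hc hwf hd
  cases hc with
  | openR => exact absurd rfl hab
  | @openL _ _ _ A S =>
    obtain ⟨T, hT, hd', ht⟩ := ht.nu_inv hSg hwf.1 hab ha hb
    have hwf' := hwf.cons₂ hT hd'
    obtain ⟨A', S', hx', hA, _⟩ := hs.cap hSg ht hd'
    have hx' := Ctx.mem_of_mem_cons (Ctx.mem_of_mem_cons hx' hxa) hxb
    obtain ⟨rfl, _⟩ := Ty.out.inj (hwf.1.unique hx'
      (Multiset.mem_add.2 (.inr (Multiset.mem_singleton_self _)))).2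
    obtain ⟨m, hA⟩ := hA.fvar_inv rfl
    obtain ⟨_, rfl⟩ := hd'.unique hA (Multiset.mem_cons_self _ _)
    have hE : ∀ X Y : Ty, ((a, .lin, X) ::ₘ (b, .lin, Y) ::ₘ
        (Γ₁ + {(x, .lin, .out (nrm .pos T) S)}) : Ctx) =
        Γ₁ + {(b, .lin, Y)} + ({(a, .lin, X)} + {(x, .lin, .out (nrm .pos T) S)}) :=
      fun X Y => by simp only [← Multiset.singleton_add]; abel
    have hE' : ∀ Y : Ty, Γ₁ + ({(b, .lin, Y), (x, .lin, S)} : Ctx) =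
        Γ₁ + {(b, .lin, Y)} + {(x, .lin, S)} := fun Y => by
      simp only [Multiset.insert_eq_cons, ← Multiset.singleton_add]; abel
    rw [hT.nrm_nrm, Pol.mul_pos, hE'] at hd ⊢
    rw [hE] at ht hwf'
    exact h _ _ _ ht (.sess (.snd (Typed.fvar_singleton (hT.nrm_pos.weaken (Kind.Sub.ofS .T))))) hwf' hd

/-- Here the payload has type N⁻T, and the remaining end N⁻N⁻T = N⁺T. -/
theorem PPreserved.openR (hSg : Sg.WF) {x a b : Name} (hab : a ≠ b) (ha : a ∉ p.fv)
    (hb : b ∉ p.fv) (hs : PStep (p.opened a b) (.sess (.snd x (.fvar b))) q)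
    (h : PPreserved Sg (p.opened a b) (.sess (.snd x (.fvar b))) q) (hxa : x ≠ a) (hxb : x ≠ b) :
    PPreserved Sg (.nu p) (.scope a b x b) q := by
  intro Γ₁ Γ₂ Γ₂' ht hc hwf hd
  cases hc with
  | openL => exact absurd rfl hab
  | @openR _ _ _ A S =>
    obtain ⟨T, hT, hd', ht⟩ := ht.nu_inv hSg hwf.1 hab ha hb
    have hwf' := hwf.cons₂ hT hd'
    obtain ⟨A', S', hx', hA, _⟩ := hs.cap hSg ht hd'
    have hx' := Ctx.mem_of_mem_cons (Ctx.mem_of_mem_cons hx' hxa) hxb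
    obtain ⟨rfl, _⟩ := Ty.out.inj (hwf.1.unique hx'
      (Multiset.mem_add.2 (.inr (Multiset.mem_singleton_self _)))).2
    obtain ⟨m, hA⟩ := hA.fvar_inv rfl
    obtain ⟨_, rfl⟩ := hd'.unique hA (Multiset.mem_cons_of_mem (Multiset.mem_cons_self _ _))
    have hE : ∀ X Y : Ty, ((a, .lin, X) ::ₘ (b, .lin, Y) ::ₘ
        (Γ₁ + {(x, .lin, .out (nrm .neg T) S)}) : Ctx) =
        Γ₁ + {(a, .lin, X)} + ({(b, .lin, Y)} + {(x, .lin, .out (nrm .neg T) S)}) :=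
      fun X Y => by simp only [← Multiset.singleton_add]; abel
    have hE' : ∀ Y : Ty, Γ₁ + ({(a, .lin, Y), (x, .lin, S)} : Ctx) =
        Γ₁ + {(a, .lin, Y)} + {(x, .lin, S)} := fun Y => by
      simp only [Multiset.insert_eq_cons, ← Multiset.singleton_add]; abel
    rw [hT.nrm_nrm, Pol.mul_neg, Pol.flip_neg, hE'] at hd ⊢
    rw [hE] at ht hwf'
    exact h _ _ _ ht (.sess (.snd (Typed.fvar_singleton
      ((hT.nrm _ (.inr rfl)).weaken (Kind.Sub.ofS .T))))) hwf' hd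

/-- A channel end `c` of type `A` moves out of the scope of the restriction of `a` and `b`. -/
theorem PPreserved.close (hSg : Sg.WF) {x y a b c : Name} (hxy : x ≠ y) (hx : x ∉ p.fv)
    (hy : y ∉ p.fv)
    (hs : PStep (p.opened x y) (.par (.sess (.rcv x (.fvar c))) (.scope a b y c)) q)
    (h : PPreserved Sg (p.opened x y) (.par (.sess (.rcv x (.fvar c))) (.scope a b y c)) q)
    (hc : ∀ A S : Ty, Kinding Sg .check [] A .S → nrm .pos A = A → ∃ B, Kinding Sg .check [] B .S ∧
      ∃ Γ : Ctx, CtxPStep Sg {(y, .lin, .out A S)} (.scope a b y c) Γ ∧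
        ({(c, .lin, A)} : Ctx) + Γ =
          {(a, .lin, nrm .pos B)} + {(b, .lin, nrm .neg B)} + {(y, .lin, S)}) :
    PPreserved Sg (.nu p) .tau (.res x y (.res a b q)) := by
  refine PPreserved.of_tau fun {Γ} ht hwf => ?_
  obtain ⟨T, hT, hd, ht⟩ := ht.nu_inv hSg hwf.1 hxy hx hy
  have hwf' := hwf.cons₂ hT hd
  obtain ⟨⟨A, S, hxA, hA, hn⟩, ⟨hab, B, S', hyB, hAS⟩, _⟩ := hs.cap hSg ht hd
  have hTx := (hd.unique hxA (Multiset.mem_cons_self _ _)).2.symm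
  have hTy := (hd.unique hyB (Multiset.mem_cons_of_mem (Multiset.mem_cons_self _ _))).2.symm
  obtain ⟨hTn, hSn, hS⟩ := hT.dual_inn hA.nrm_pos.nonNeg hTx
  obtain ⟨rfl, rfl⟩ := Ty.out.inj (hTy.symm.trans hTn)
  obtain ⟨B', hB, G, hG, hGE⟩ := hc B (nrm .neg S) hAS hn
  rw [hTx, hTn] at ht hd hwf'
  -- The extruded names are bound in the label, hence not free in the process, and the process uses
  -- its whole context.
  have hfresh : ∀ z, z = a ∨ z = b →
      z ∉ Ctx.dom ((x, .lin, S) ::ₘ (y, .lin, nrm .neg S) ::ₘ Γ) := by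
    intro z hz hz'
    refine hs.bn_disjoint (x := z) ?_ (ht.dom_subset hSg hd (by simpa using hz'))
    simpa [PLabel.bn] using hz
  have hd₁ : Ctx.Distinct ((x, .lin, S) ::ₘ (y, .lin, nrm .neg S) ::ₘ Γ) := hd.of_dom (by simp)
  have hd₂ : Ctx.Distinct ((a, .lin, nrm .pos B') ::ₘ (b, .lin, nrm .neg B') ::ₘ
      (x, .lin, S) ::ₘ (y, .lin, nrm .neg S) ::ₘ Γ) := by
    refine Ctx.distinct_cons.2 ⟨?_, Ctx.distinct_cons.2 ⟨hfresh b (.inr rfl), hd₁⟩⟩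
    rw [Ctx.dom_cons, Multiset.mem_cons, not_or]
    exact ⟨hab, hfresh a (.inl rfl)⟩
  have hE : ((x, .lin, .inn B S) ::ₘ (y, .lin, .out B (nrm .neg S)) ::ₘ Γ : Ctx) =
      Γ + ({(x, .lin, .inn B S)} + {(y, .lin, .out B (nrm .neg S))}) := by
    simp only [← Multiset.singleton_add]; abel
  have hE' : Γ + (({(c, .lin, B)} : Ctx) + {(x, .lin, S)} + G) =
      (a, .lin, nrm .pos B') ::ₘ (b, .lin, nrm .neg B') ::ₘ
        (x, .lin, S) ::ₘ (y, .lin, nrm .neg S) ::ₘ Γ := by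
    rw [add_right_comm, hGE]
    simp only [← Multiset.singleton_add]; abel
  rw [hE] at ht hwf'
  have := h _ _ _ ht (.par (.sess (.rcv (Typed.fvar_singleton hA))) hG) hwf' (by rwa [hE'])
  rw [hE'] at this
  have := ProcTyped.res hSg hB hd₂ this
  exact ProcTyped.res hSg hS (by rwa [hSn]) (by rwa [hSn])

theorem PStep.preserved (hSg : Sg.WF) (h : PStep p π q) : PPreserved Sg p π q := by
  have hexp : ∀ {e₁ l e₂ π}, EStep e₁ l e₂ →
      (∀ {Γ Γ'}, CtxPStep Sg Γ π Γ' → CtxEStep Sg Γ l Γ') →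
      PPreserved Sg (.exp e₁) π (.exp e₂) := by
    intro e₁ l e₂ π h hl Γ₁ Γ₂ Γ₂' ht hc hwf hd
    generalize hG : Γ₁ + Γ₂ = G at ht
    cases ht with
    | exp ht =>
      subst hG
      have := h.typed hSg (Γ₃ := 0) (by rwa [add_zero]) (hl hc) (by rwa [add_zero])
        (by rwa [add_zero])
      rw [add_zero] at this
      exact .exp (.check this rfl)
  induction h with
  | session h => exact hexp h fun hc => by cases hc with | sess hc => exact .sess hc
  | beta h => exact hexp h fun hc => by cases hc; exact .beta
  | fork h => exact PPreserved.fork hSg h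
  | new x y hxy hx hy h => exact PPreserved.new hSg hxy hx hy h
  | joinL h₁ h₂ _ _ ih₁ ih₂ =>
    intro Γ₁ Γ₂ Γ₂' ht hc hwf hd
    cases hc with
    | par ha hb => exact PPreserved.par hSg h₁ h₂ ih₁ ih₂ ht ha hb hwf hd
  | joinR h₁ h₂ _ _ ih₁ ih₂ =>
    intro Γ₁ Γ₂ Γ₂' ht hc hwf hd
    cases hc with
    | @par Γa Γb Γa' Γb' _ _ ha hb =>
      rw [add_comm Γa] at ht hwf
      rw [add_comm Γa'] at hd ⊢
      exact PPreserved.par hSg h₁ h₂ ih₁ ih₂ ht hb ha hwf hd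
  | msg x y hxy hx hy h ih => exact PPreserved.msg hSg hxy hx hy h ih
  | bra x y hxy hx hy h ih => exact PPreserved.bra hSg hxy hx hy h ih
  | wait x y hxy hx hy h ih => exact PPreserved.wait hSg hxy hx hy h ih
  | parL h _ ih =>
    intro Γ₁ Γ₂ Γ₂' ht hc hwf hd
    exact PPreserved.parL hSg h ih _ ht hc hwf hd
  | parR h _ ih =>
    intro Γ₁ Γ₂ Γ₂' ht hc hwf hd
    exact (PPreserved.parL hSg h ih _ ht.par_comm hc hwf hd).par_comm
  | res x y hxy hx hy _ hxπ hyπ ih => exact PPreserved.res hSg hxy hx hy ih hxπ hyπ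
  | openL a b hab ha hb h hxa hxb ih => exact PPreserved.openL hSg hab ha hb h ih hxa hxb
  | openR a b hab ha hb h hxa hxb ih => exact PPreserved.openR hSg hab ha hb h ih hxa hxb
  | closeL x y hxy hx hy h ih =>
    refine PPreserved.close hSg hxy hx hy h ih fun A S hA hn => ⟨A, hA, _, .openL, ?_⟩
    rw [hn]
    simp only [Multiset.insert_eq_cons, ← Multiset.singleton_add]; abel
  | closeR x y hxy hx hy h ih =>
    -- The transmitted end `b` must get the negative normal form of the session type, so `Dual A` is
    -- chosen: its N⁻ is A, and its N⁺ is N⁻A.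
    refine PPreserved.close hSg hxy hx hy h ih fun A S hA hn =>
      ⟨.dual A, .sub (.dual hA) (Kind.Sub.refl _), _, .openR, ?_⟩
    rw [nrm_dual, nrm_dual, Pol.flip_pos, Pol.flip_neg, hn]
    simp only [Multiset.insert_eq_cons, ← Multiset.singleton_add]; abel

end ProcPreservation

end AlgST

/-! ### The preservation theorem. -/

theorem mainTheorem1 (Sg : AlgST.Sig) (hSg : Sg.WF) :
    -- expressions, synthesis
    (∀ (Δ : List AlgST.Kind) (Γ₁ Γ₂ Γ₂' Γ₃ : AlgST.Ctx) (e₁ e₂ : AlgST.Expr) (l : AlgST.ELabel)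
        (T : AlgST.Ty),
      AlgST.EStep e₁ l e₂ →
      AlgST.Typed Sg .synth Δ (Γ₁ + Γ₂ + Γ₃) e₁ T Γ₃ →
      AlgST.CtxEStep Sg Γ₂ l Γ₂' →
      AlgST.Ctx.WF Sg Δ (Γ₁ + Γ₂ + Γ₃) →
      AlgST.Ctx.Distinct (Γ₁ + Γ₂' + Γ₃) →
      ∃ T' : AlgST.Ty,
        AlgST.Typed Sg .synth Δ (Γ₁ + Γ₂' + Γ₃) e₂ T' Γ₃ ∧ AlgST.TyConv Sg Δ T' T .T) ∧
    -- expressions, checking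
    (∀ (Δ : List AlgST.Kind) (Γ₁ Γ₂ Γ₂' Γ₃ : AlgST.Ctx) (e₁ e₂ : AlgST.Expr) (l : AlgST.ELabel)
        (T : AlgST.Ty),
      AlgST.EStep e₁ l e₂ →
      AlgST.Typed Sg .check Δ (Γ₁ + Γ₂ + Γ₃) e₁ T Γ₃ →
      AlgST.CtxEStep Sg Γ₂ l Γ₂' →
      AlgST.Ctx.WF Sg Δ (Γ₁ + Γ₂ + Γ₃) →
      AlgST.Ctx.Distinct (Γ₁ + Γ₂' + Γ₃) →
      AlgST.Typed Sg .check Δ (Γ₁ + Γ₂' + Γ₃) e₂ T Γ₃) ∧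
    -- processes
    (∀ (Γ₁ Γ₂ Γ₂' : AlgST.Ctx) (p₁ p₂ : AlgST.Proc) (π : AlgST.PLabel),
      AlgST.PStep p₁ π p₂ →
      AlgST.ProcTyped Sg (Γ₁ + Γ₂) p₁ →
      AlgST.CtxPStep Sg Γ₂ π Γ₂' →
      AlgST.Ctx.WF Sg [] (Γ₁ + Γ₂) →
      AlgST.Ctx.Distinct (Γ₁ + Γ₂') →
      AlgST.ProcTyped Sg (Γ₁ + Γ₂') p₂) := by
  refine ⟨fun Δ Γ₁ Γ₂ Γ₂' Γ₃ e₁ e₂ l T hs h hc hwf hd => ?_,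
    fun Δ Γ₁ Γ₂ Γ₂' Γ₃ e₁ e₂ l T hs h hc hwf hd => .check (hs.typed hSg h hc hwf hd) rfl,
    fun Γ₁ Γ₂ Γ₂' p₁ p₂ π hs h hc hwf hd => hs.preserved hSg _ _ _ h hc hwf hd⟩
  have h' := hs.typed hSg h hc hwf hd
  -- The type is unchanged, so conversion is reflexivity, which only asks that the type be well
  -- kinded.
  exact ⟨T, h', .refl ((h'.decl hSg hd).1.kinding hSg)⟩
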